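/- **Proposition 6 (monotonicity in $|\lambda|^2$).** Consider a log-normal market with $N$ stocks, $dS^i_s=S^i_s(\mu^i ds+\sigma^i\cdot dW_s)$, an invertible volatility matrix $\sigma$ (with columns $\sigma^i$), a constant interest rate $\rho>0$, an $N$-dimensional standard Brownian motion $W$ with its natural filtration, and market price of risk $\lambda=(\sigma^T)^{-1}(\mu-\rho\mathbf 1)$. Let $T\ge 0$ be the horizon. A progressively measurable strategy $\pi$ with $E\int_t^T|\pi_s|^2ds<\infty$ is admissible for the initial wealth $x>0$ at time $t\in[0,T]$ if the wealth process, $dX^\pi_s=\sigma\pi_s\cdot(\lambda ds+dW_s)$, $X^\pi_t=x$, is nonnegative on $[t,T]$. Let $$u(x,t)=\sup_{\pi}E\big(U(X^\pi_T)\mid X^\pi_t=x\big),\qquad r(x,t)=-\frac{u_x(x,t)}{u_{xx}(x,t)},\qquad R(x)=-\frac{U'(x)}{U''(x)},$$ the supremum being over admissible $\pi$. Here $U$ is $C^\infty$, strictly increasing and strictly concave on $(0,\infty)$ (with $U(0):=U(0+)$), $U'(0+)=\infty$, $U'(\infty)=0$; $R(0+)=0$ and $R$ is strictly increasing; and $I=(U')^{-1}$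 satisfies, for positive constants $C,\delta,c_1,c_2,C_1,C_2,C_3$ with $c_2>1$ and all $y>0$, $$I\le C(1+y^{-\delta}),\quad c_1I\le|yI'|\le C_1I,\quad c_2|I'|\le yI''\le C_2|I'|,\quad |yI'''|\le C_3I''.$$ Then $u$ is finite and twice differentiable in $x$ with $u_{xx}<0$ on $(0,\infty)\times[0,T]$, so that $r$ is well defined there. If $R$ is concave, then for every $x>0$ and $t\in[0,T]$ the risk tolerance $r(x,t)$ is (weakly) decreasing in $|\lambda|^2$; if $R$ is convex, it is (weakly) increasing in $|\lambda|^2$. That is, for two such markets (possibly with different numbers of stocks and on different probability spaces), with the same $U$ and $T$, with market prices of risk $\lambda_1,\lambda_2$ satisfying $|\lambda_1|^2\le|\lambda_2|^2$, and with risk tolerances $r_1,r_2$: $r_2(x,t)\le r_1(x,t)$ for all $x>0$, $t\in[0,T]$ if $R$ is concave, and $r_1(x,t)\le r_2(x,t)$ for all such $x,t$ if $R$ is convex. -/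

import Mathlib

open MeasureTheory ProbabilityTheory Set Filter Topology
open scoped NNReal ENNReal Matrix

namespace Merton

noncomputable section

/-! ### Brownian motion and the Itô integral -/

/-- A standard `N`-dimensional Brownian motion on `(Ω, P)`: its coordinates are independent real
Brownian motions. -/
structure BrownianMotion {Ω : Type*} [MeasurableSpace Ω] (P : Measure Ω) (N : ℕ) where
  /-- the process itself -/
  W : ℝ≥0 → Ω → EuclideanSpace ℝ (Fin N)
  stronglyMeasurable : ∀ s, StronglyMeasurable (W s)
  isBrownian : ∀ i, IsBrownianReal (fun s ω => W s ω i) P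
  indep : iIndepFun (fun (i : Fin N) (ω : Ω) (s : ℝ≥0) => W s ω i) P

/-- The filtration `ℱ_t = σ(W_s : 0 ≤ s ≤ t)`. -/
def BrownianMotion.filtration {Ω : Type*} [mΩ : MeasurableSpace Ω] {P : Measure Ω} {N : ℕ}
    (B : BrownianMotion P N) : Filtration ℝ≥0 mΩ :=
  Filtration.natural B.W B.stronglyMeasurable

/-- A simple process on `[t, T]`: for a partition `t = τ 0 ≤ τ 1 ≤ … ≤ τ n = T` it takes on
`(τ i, τ (i + 1)]` the value `ξ i`, a bounded `ℱ_(τ i)`-measurable random vector. -/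
structure SimpleProcess {Ω : Type*} [mΩ : MeasurableSpace Ω] (ℱ : Filtration ℝ≥0 mΩ)
    (N : ℕ) (t T : ℝ≥0) where
  /-- number of intervals -/
  n : ℕ
  /-- partition points -/
  τ : ℕ → ℝ≥0
  /-- values -/
  ξ : ℕ → Ω → EuclideanSpace ℝ (Fin N)
  τ_mono : Monotone τ
  τ_zero : τ 0 = t
  τ_last : τ n = T
  ξ_meas : ∀ i < n, StronglyMeasurable[ℱ (τ i)] (ξ i)
  ξ_bdd : ∀ i < n, ∃ C : ℝ, ∀ ω, ‖ξ i ω‖ ≤ C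

/-- The value of a simple process at time `s`. -/
def SimpleProcess.value {Ω : Type*} [mΩ : MeasurableSpace Ω] {ℱ : Filtration ℝ≥0 mΩ}
    {N : ℕ} {t T : ℝ≥0} (ψ : SimpleProcess ℱ N t T) (s : ℝ≥0) (ω : Ω) :
    EuclideanSpace ℝ (Fin N) :=
  ∑ i ∈ Finset.range ψ.n, (Ioc (ψ.τ i) (ψ.τ (i + 1))).indicator (fun _ => ψ.ξ i ω) s

/-- The stochastic integral `∫_t^s ψ · dW` of a simple process. -/
def SimpleProcess.integral {Ω : Type*} [mΩ : MeasurableSpace Ω] {ℱ : Filtration ℝ≥0 mΩ}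
    {N : ℕ} {t T : ℝ≥0} (ψ : SimpleProcess ℱ N t T)
    (W : ℝ≥0 → Ω → EuclideanSpace ℝ (Fin N)) (s : ℝ≥0) (ω : Ω) : ℝ :=
  ∑ i ∈ Finset.range ψ.n,
    inner ℝ (ψ.ξ i ω) (W (min (ψ.τ (i + 1)) s) ω - W (min (ψ.τ i) s) ω)

/-- `M s = ∫_t^s φ · dW` for all `s ∈ [t, T]`, in the sense of Itô's `L²` theory: `M s` is the
`L²(P)`-limit of the integrals of simple processes that converge to `φ` in
`L²(Ω × [t, T])`. (Time integrals are taken over the real line, whence `Real.toNNReal`.) -/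
structure IsItoIntegral {Ω : Type*} [MeasurableSpace Ω] {P : Measure Ω} {N : ℕ}
    (B : BrownianMotion P N) (t T : ℝ≥0) (φ : ℝ≥0 → Ω → EuclideanSpace ℝ (Fin N))
    (M : ℝ≥0 → Ω → ℝ) : Prop where
  memLp : ∀ s ∈ Icc t T, MemLp (M s) 2 P
  approx : ∃ ψ : ℕ → SimpleProcess B.filtration N t T,
    Tendsto (fun k => ∫⁻ ω, (∫⁻ s in Icc (t : ℝ) T,
        ‖(ψ k).value s.toNNReal ω - φ s.toNNReal ω‖ₑ ^ 2) ∂P)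
      atTop (𝓝 0) ∧
    ∀ s ∈ Icc t T,
      Tendsto (fun k => ∫⁻ ω, ‖(ψ k).integral B.W s ω - M s ω‖ₑ ^ 2 ∂P) atTop (𝓝 0)

/-! ### The market and the wealth process -/

/-- The coefficients of a log-normal market with `N` stocks,
`dSⁱ = Sⁱ (μⁱ dt + ∑ j, σ^{ji} dWʲ)`, and a savings account with interest rate `rate`. The
`i`-th column of the matrix `σ` is the volatility vector of the `i`-th stock. -/
structure Market (N : ℕ) where
  /-- interest rate -/
  rate : ℝ
  /-- drifts -/
  μ : Fin N → ℝ
  /-- volatility matrix -/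
  σ : Matrix (Fin N) (Fin N) ℝ
  rate_pos : 0 < rate
  isUnit_det : IsUnit σ.det

/-- The market price of risk `λ = (σᵀ)⁻¹ (μ - r 𝟏)`. -/
def Market.priceOfRisk {N : ℕ} (m : Market N) : EuclideanSpace ℝ (Fin N) :=
  WithLp.toLp 2 ((m.σᵀ)⁻¹ *ᵥ (fun i => m.μ i - m.rate))

/-- The exposure `σ π`. -/
def Market.exposure {N : ℕ} (m : Market N) (p : EuclideanSpace ℝ (Fin N)) :
    EuclideanSpace ℝ (Fin N) :=
  WithLp.toLp 2 (m.σ *ᵥ (fun i => p i))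

/-- `X` solves `dX = σ π · (λ ds + dW)` on `[t, T]` with `X t = x`, where `π` is the vector of
the present values of the amounts invested in the stocks. -/
structure IsWealth {Ω : Type*} [MeasurableSpace Ω] {P : Measure Ω} {N : ℕ}
    (B : BrownianMotion P N) (m : Market N) (t T : ℝ≥0) (x : ℝ)
    (π : ℝ≥0 → Ω → EuclideanSpace ℝ (Fin N)) (X : ℝ≥0 → Ω → ℝ) : Prop where
  continuousOn : ∀ᵐ ω ∂P, ContinuousOn (fun s => X s ω) (Icc t T)
  equation : ∃ M : ℝ≥0 → Ω → ℝ, IsItoIntegral B t T (fun s ω => m.exposure (π s ω)) M ∧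
    ∀ s ∈ Icc t T, ∀ᵐ ω ∂P,
      X s ω = x + (∫ v in (t : ℝ)..s, inner ℝ (m.exposure (π v.toNNReal ω)) m.priceOfRisk) + M s ω

/-- `π` is an admissible strategy on `[t, T]` with wealth process `X` started from `x` at time `t`:
it is progressively measurable for the Brownian filtration, `E ∫_t^T |π|² ds < ∞`, and the wealth
stays nonnegative. -/
structure IsAdmissible {Ω : Type*} [MeasurableSpace Ω] {P : Measure Ω} {N : ℕ}
    (B : BrownianMotion P N) (m : Market N) (t T : ℝ≥0) (x : ℝ)
    (π : ℝ≥0 → Ω → EuclideanSpace ℝ (Fin N)) (X : ℝ≥0 → Ω → ℝ) : Prop where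
  progressive : IsStronglyProgressive B.filtration π
  square_integrable : ∫⁻ ω, (∫⁻ s in Icc (t : ℝ) T, ‖π s.toNNReal ω‖ₑ ^ 2) ∂P < ∞
  wealth : IsWealth B m t T x π X
  nonneg : ∀ᵐ ω ∂P, ∀ s ∈ Icc t T, 0 ≤ X s ω

/-! ### Utility, value function and risk tolerance -/

/-- The expectation of an extended real random variable, with value `-∞` when both the positive
and the negative part have infinite expectation. -/
def extExpectation {Ω : Type*} [MeasurableSpace Ω] (P : Measure Ω) (Y : Ω → EReal) : EReal :=
  ((∫⁻ ω, (Y ω).toENNReal ∂P : ℝ≥0∞) : EReal) - ((∫⁻ ω, (-Y ω).toENNReal ∂P : ℝ≥0∞) : EReal)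

/-- The utility function, extended to zero wealth by `U 0 = U (0+) ∈ [-∞, ∞)` (for an increasing
`U` the infimum over `(0, ∞)` is the limit at `0`). -/
def extUtility (U : ℝ → ℝ) (x : ℝ) : EReal :=
  if 0 < x then (U x : EReal) else ⨅ y ∈ Ioi (0 : ℝ), (U y : EReal)

/-- The maximal expected utility of terminal wealth, as an extended real number. -/
def extValue {Ω : Type*} [MeasurableSpace Ω] {P : Measure Ω} {N : ℕ}
    (B : BrownianMotion P N) (m : Market N) (U : ℝ → ℝ) (T : ℝ≥0) (x : ℝ) (t : ℝ≥0) : EReal :=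
  sSup {e | ∃ π X, IsAdmissible B m t T x π X ∧
    e = extExpectation P (fun ω => extUtility U (X T ω))}

/-- The value function `u(x, t)`. -/
def value {Ω : Type*} [MeasurableSpace Ω] {P : Measure Ω} {N : ℕ}
    (B : BrownianMotion P N) (m : Market N) (U : ℝ → ℝ) (T : ℝ≥0) (x : ℝ) (t : ℝ≥0) : ℝ :=
  (extValue B m U T x t).toReal

/-- The local risk tolerance function `r(x, t) = - u_x(x, t) / u_xx(x, t)`. -/
def riskTolerance {Ω : Type*} [MeasurableSpace Ω] {P : Measure Ω} {N : ℕ}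
    (B : BrownianMotion P N) (m : Market N) (U : ℝ → ℝ) (T : ℝ≥0) (x : ℝ) (t : ℝ≥0) : ℝ :=
  -(deriv (fun y => value B m U T y t) x /
    deriv (deriv (fun y => value B m U T y t)) x)

/-- The quotient defining the risk tolerance function is meaningful at `(x, t)`: the value function
is finite there and twice differentiable in the wealth variable, with `u_xx < 0`. -/
structure RiskToleranceDefined {Ω : Type*} [MeasurableSpace Ω] {P : Measure Ω} {N : ℕ}
    (B : BrownianMotion P N) (m : Market N) (U : ℝ → ℝ) (T : ℝ≥0) (x : ℝ) (t : ℝ≥0) :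
    Prop where
  ne_bot : extValue B m U T x t ≠ ⊥
  ne_top : extValue B m U T x t ≠ ⊤
  differentiableAt : DifferentiableAt ℝ (fun y => value B m U T y t) x
  differentiableAt_deriv : DifferentiableAt ℝ (deriv (fun y => value B m U T y t)) x
  deriv_deriv_neg : deriv (deriv (fun y => value B m U T y t)) x < 0

/-- The absolute risk tolerance coefficient `R(x) = - U'(x) / U''(x)`. -/
def riskToleranceCoeff (U : ℝ → ℝ) (x : ℝ) : ℝ :=
  -(deriv U x / deriv (deriv U) x)

/-- The inverse marginal utility `I = (U')⁻¹ : (0, ∞) → (0, ∞)`. -/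
def inverseMarginal (U : ℝ → ℝ) : ℝ → ℝ :=
  Function.invFunOn (deriv U) (Ioi 0)

/-- The standing assumptions on the utility function `U : (0, ∞) → ℝ`. -/
structure IsUtility (U : ℝ → ℝ) : Prop where
  smooth : ContDiffOn ℝ ((⊤ : ℕ∞) : WithTop ℕ∞) U (Ioi 0)
  strictMono : StrictMonoOn U (Ioi 0)
  strictConcave : StrictConcaveOn ℝ (Ioi 0) U
  inada_zero : Tendsto (deriv U) (𝓝[>] 0) atTop
  inada_top : Tendsto (deriv U) atTop (𝓝 0)
  decay : ∃ C δ : ℝ, 0 < C ∧ 0 < δ ∧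
    ∀ y > 0, inverseMarginal U y ≤ C * (1 + y ^ (-δ))
  bound_one : ∃ c C : ℝ, 0 < c ∧ 0 < C ∧ ∀ y > 0,
    c * inverseMarginal U y ≤ |y * deriv (inverseMarginal U) y| ∧
    |y * deriv (inverseMarginal U) y| ≤ C * inverseMarginal U y
  bound_two : ∃ c C : ℝ, 1 < c ∧ 0 < C ∧ ∀ y > 0,
    c * |deriv (inverseMarginal U) y| ≤ y * iteratedDeriv 2 (inverseMarginal U) y ∧
    y * iteratedDeriv 2 (inverseMarginal U) y ≤ C * |deriv (inverseMarginal U) y|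
  bound_three : ∃ C : ℝ, 0 < C ∧ ∀ y > 0,
    |y * iteratedDeriv 3 (inverseMarginal U) y| ≤ C * iteratedDeriv 2 (inverseMarginal U) y
  riskTolerance_zero : Tendsto (riskToleranceCoeff U) (𝓝[>] 0) (𝓝 0)
  riskTolerance_strictMono : StrictMonoOn (riskToleranceCoeff U) (Ioi 0)

end

end Merton

namespace Merton

/-! ### Gaussian averages of functions of exponential growth -/

/-! Let f(z) = I(e^{-z}) (`logWealth`), the wealth at which marginal utility equals e^{-z}.
Differentiating U'(I(y)) = y gives f' = R(f), hence f''/f' = R'(f). As f increases, f''/f' is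
decreasing when R is concave and increasing when R is convex.

Let l be the market price of risk, v = |l|²(T - t), and Y_s = z + l·(W_s - W_t) + |l|²(s - t). Then
e^{-Y_T} is a constant multiple of the state price density H = exp(-l·(W_T - W_t)). Every admissible
wealth started from x satisfies E[H(X_T - x)] = 0 (`IsAdmissible.integral_exp_mul_gain`), so the
tangent inequality for U at f(Y_T) shows that f(Y_T) is optimal among terminal wealths with its
price. It is attained: with F_v(z) = E f(z + w), w of law N(0, v), the process F_{|l|²(T-s)}(Y_s) is
an admissible wealth ending at f(Y_T) (`ExpSmooth.exists_isAdmissible`). The stochastic integral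
representation behind this comes from an Euler scheme: the semigroup property of Gaussian averages
makes the one-step errors small in mean, and a discrete Gronwall argument sums them in mean square.

Thus u(F_v(z), t) is the mean of U(f(z + w)) for w of law N(v, v). Differentiating in z gives, at
the point F_v(z), u_x = e^{-z-v/2} and u_xx = -e^{-z-v/2}/F_v'(z), so r(F_v(z), t) = F_v'(z)
(`IsUtility.riskTolerance_eq`). The market enters only through v.

It remains to compare F_v'(z) with F_{v'}'(z') when v ≤ v' and F_v(z) = F_{v'}(z') = x. Shifting the
mean of a Gaussian is an exponential tilt, so Chebyshev's inequality passes the monotonicity of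
f''/f' on to F_v''/F_v' (`antitone_gaussAvg_div`). For concave R, F_v' is therefore a concave
function of F_v and lies below its tangent line. Averaging the tangent inequality at z over the
extra variance v' - v kills the linear term, because both means equal x, and leaves F_{v'}'(z') ≤
F_v'(z) (`mul_gaussAvg_le_of_antitone_logDeriv`). For convex R the signs are reversed. -/

lemma integrable_pow_mul_exp_mul_abs (m : ℝ) (v : ℝ≥0) (p : ℕ) (c : ℝ) :
    Integrable (fun w : ℝ => |w| ^ p * Real.exp (c * |w|)) (gaussianReal m v) := by
  have h (a : ℝ) : Integrable (fun w : ℝ => Real.exp (a * |w|)) (gaussianReal m v) :=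
    ProbabilityTheory.integrable_exp_mul_abs (X := fun w : ℝ => w)
      (integrable_exp_mul_gaussianReal a) (by simpa using integrable_exp_mul_gaussianReal (-a))
  refine ((h (c + 1)).const_mul (p.factorial : ℝ)).mono' (by fun_prop) (ae_of_all _ fun w => ?_)
  have h1 := Real.pow_div_factorial_le_exp |w| (abs_nonneg w) p
  rw [div_le_iff₀ (by positivity)] at h1
  rw [Real.norm_of_nonneg (by positivity)]
  calc |w| ^ p * Real.exp (c * |w|)
      ≤ (Real.exp |w| * p.factorial) * Real.exp (c * |w|) := by gcongr
    _ = p.factorial * Real.exp ((c + 1) * |w|) := by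
      rw [add_mul, Real.exp_add, one_mul]; ring

lemma integrable_exp_mul_abs_gaussianReal (m : ℝ) (v : ℝ≥0) (c : ℝ) :
    Integrable (fun w : ℝ => Real.exp (c * |w|)) (gaussianReal m v) := by
  simpa using integrable_pow_mul_exp_mul_abs m v 0 c

/-- A function is of exponential growth if it is bounded by a multiple of `exp (c * |z|)`. -/
def ExpGrowth (g : ℝ → ℝ) : Prop :=
  ∃ K c : ℝ, 0 ≤ K ∧ 0 ≤ c ∧ ∀ z, |g z| ≤ K * Real.exp (c * |z|)

lemma exp_mul_abs_add_le {c : ℝ} (hc : 0 ≤ c) (z w : ℝ) :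
    Real.exp (c * |z + w|) ≤ Real.exp (c * |z|) * Real.exp (c * |w|) := by
  rw [← Real.exp_add, ← mul_add]
  exact Real.exp_le_exp.2 (mul_le_mul_of_nonneg_left (abs_add_le z w) hc)

lemma ExpGrowth.comp_const_add {g : ℝ → ℝ} (hg : ExpGrowth g) (z : ℝ) :
    ExpGrowth (fun w => g (z + w)) := by
  obtain ⟨K, c, hK, hc, h⟩ := hg
  refine ⟨K * Real.exp (c * |z|), c, by positivity, hc, fun w => (h _).trans ?_⟩
  rw [mul_assoc]
  exact mul_le_mul_of_nonneg_left (exp_mul_abs_add_le hc z w) hK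

lemma ExpGrowth.mul {g h : ℝ → ℝ} (hg : ExpGrowth g) (hh : ExpGrowth h) :
    ExpGrowth (fun w => g w * h w) := by
  obtain ⟨K, c, hK, hc, hg⟩ := hg
  obtain ⟨K', c', hK', hc', hh⟩ := hh
  refine ⟨K * K', c + c', by positivity, by positivity, fun w => ?_⟩
  rw [abs_mul]
  calc |g w| * |h w| ≤ (K * Real.exp (c * |w|)) * (K' * Real.exp (c' * |w|)) :=
        mul_le_mul (hg w) (hh w) (abs_nonneg _) (by positivity)
    _ = K * K' * Real.exp ((c + c') * |w|) := by rw [add_mul, Real.exp_add]; ring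

lemma ExpGrowth.integrable {g : ℝ → ℝ} (hg : ExpGrowth g) (hm : Measurable g) (m : ℝ)
    (v : ℝ≥0) : Integrable g (gaussianReal m v) := by
  obtain ⟨K, c, -, -, h⟩ := hg
  exact ((integrable_exp_mul_abs_gaussianReal m v c).const_mul K).mono' hm.aestronglyMeasurable
    (ae_of_all _ h)

lemma expGrowth_exp (a : ℝ) : ExpGrowth (fun w => Real.exp (a * w)) := by
  refine ⟨1, |a|, by simp, abs_nonneg a, fun z => ?_⟩
  rw [abs_of_pos (Real.exp_pos _), one_mul, ← abs_mul]
  exact Real.exp_le_exp.2 (le_abs_self _)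

/-- Scaling one fixed law moves the variance into the integrand. This yields bounds uniform in the
variance and joint continuity, the degenerate case v = 0 included. -/
lemma gaussianReal_eq_map_sqrt (v : ℝ≥0) :
    gaussianReal 0 v = (gaussianReal 0 1).map (fun w => √(v : ℝ) * w) := by
  rw [gaussianReal_map_const_mul]
  congr 1
  · simp
  · ext; simp [Real.sq_sqrt]

lemma integral_gaussianReal_sqrt (v : ℝ≥0) {g : ℝ → ℝ} (hg : Measurable g) :
    ∫ w, g w ∂gaussianReal 0 v = ∫ w, g (√(v : ℝ) * w) ∂gaussianReal 0 1 := by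
  rw [gaussianReal_eq_map_sqrt, integral_map (by fun_prop) hg.aestronglyMeasurable]

/-- Exponentially weighted absolute moments of centred Gaussian laws of bounded variance. -/
lemma exists_gaussian_moment_le (V : ℝ≥0) (p : ℕ) {c : ℝ} (hc : 0 ≤ c) :
    ∃ C : ℝ, 0 ≤ C ∧ ∀ v ≤ V,
      ∫ w, |w| ^ p * Real.exp (c * |w|) ∂gaussianReal 0 v ≤ C * √(v : ℝ) ^ p := by
  refine ⟨∫ w, |w| ^ p * Real.exp (c * √(V : ℝ) * |w|) ∂gaussianReal 0 1,
    integral_nonneg fun w => by positivity, fun v hv => ?_⟩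
  rw [integral_gaussianReal_sqrt v (by fun_prop), ← integral_mul_const]
  refine integral_mono_of_nonneg (ae_of_all _ fun w => by positivity)
    ((integrable_pow_mul_exp_mul_abs 0 1 p _).mul_const _) (ae_of_all _ fun w => ?_)
  have h1 : √(v : ℝ) ≤ √(V : ℝ) := Real.sqrt_le_sqrt (by exact_mod_cast hv)
  simp only [abs_mul, abs_of_nonneg (Real.sqrt_nonneg (v : ℝ)), mul_pow]
  calc √(v : ℝ) ^ p * |w| ^ p * Real.exp (c * (√(v : ℝ) * |w|))
      ≤ √(v : ℝ) ^ p * |w| ^ p * Real.exp (c * √(V : ℝ) * |w|) := by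
        rw [← mul_assoc c]; gcongr
    _ = _ := by ring

/-- The average of `g (z + w)` over the centred Gaussian law of variance `v`. -/
noncomputable def gaussAvg (g : ℝ → ℝ) (v : ℝ≥0) (z : ℝ) : ℝ :=
  ∫ w, g (z + w) ∂gaussianReal 0 v

@[simp] lemma gaussAvg_zero (g : ℝ → ℝ) (z : ℝ) : gaussAvg g 0 z = g z := by
  simp [gaussAvg]

/-- Tilting a Gaussian law by an exponential shifts its mean. -/
lemma integral_exp_mul_gaussianReal (m a : ℝ) (v : ℝ≥0) (g : ℝ → ℝ) :
    ∫ w, Real.exp (a * w) * g w ∂gaussianReal m v =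
      Real.exp (a * m + a ^ 2 * v / 2) * ∫ w, g w ∂gaussianReal (m + a * v) v := by
  rcases eq_or_ne v 0 with rfl | hv
  · simp
  rw [integral_gaussianReal_eq_integral_smul hv, integral_gaussianReal_eq_integral_smul hv,
    ← integral_const_mul]
  congr 1 with w
  have hv' : (v : ℝ) ≠ 0 := by exact_mod_cast hv
  simp only [gaussianPDFReal, smul_eq_mul]
  have : Real.exp (-(w - m) ^ 2 / (2 * v)) * Real.exp (a * w) =
      Real.exp (a * m + a ^ 2 * v / 2) * Real.exp (-(w - (m + a * v)) ^ 2 / (2 * v)) := by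
    rw [← Real.exp_add, ← Real.exp_add]
    congr 1
    field_simp
    ring
  linear_combination ((√(2 * Real.pi * v))⁻¹ * g w) * this

lemma integral_gaussianReal_shift (m : ℝ) (v : ℝ≥0) {g : ℝ → ℝ} (hg : Measurable g) :
    ∫ w, g w ∂gaussianReal m v = ∫ w, g (w + m) ∂gaussianReal 0 v := by
  have h := gaussianReal_map_add_const (μ := 0) (v := v) m
  rw [zero_add] at h
  rw [← h, integral_map (by fun_prop) hg.aestronglyMeasurable]

/-- The heat semigroup property. It serves twice: to add variance in the comparison of markets, and
in place of the heat equation in the Itô expansion. -/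
lemma gaussAvg_gaussAvg {g : ℝ → ℝ} (hg : ExpGrowth g) (hm : Measurable g) (v v' : ℝ≥0)
    (z : ℝ) : gaussAvg (gaussAvg g v) v' z = gaussAvg g (v + v') z := by
  unfold gaussAvg
  have h := gaussianReal_conv_gaussianReal (m₁ := 0) (m₂ := 0) (v₁ := v') (v₂ := v)
  rw [add_zero, add_comm v' v] at h
  rw [← h, Measure.conv, integral_map (by fun_prop)
    (Measurable.aestronglyMeasurable (by fun_prop))]
  rw [integral_prod]
  · simp only [add_assoc]
  · have hi : Integrable (fun w => g (z + w)) (gaussianReal 0 (v + v')) :=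
      (hg.comp_const_add z).integrable (by fun_prop) _ _
    rw [← h, Measure.conv, integrable_map_measure
      (Measurable.aestronglyMeasurable (by fun_prop)) (by fun_prop)] at hi
    exact hi

/-- `f₁` and `f₂` are the first two derivatives of `f`, and all three functions are bounded by
`K * exp (c * |z|)`. -/
structure ExpSmooth (f f₁ f₂ : ℝ → ℝ) (K c : ℝ) : Prop where
  K_nonneg : 0 ≤ K
  c_nonneg : 0 ≤ c
  deriv_one : ∀ z, HasDerivAt f (f₁ z) z
  deriv_two : ∀ z, HasDerivAt f₁ (f₂ z) z
  cont : Continuous f₂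
  bound : ∀ z, |f z| ≤ K * Real.exp (c * |z|)
  bound_one : ∀ z, |f₁ z| ≤ K * Real.exp (c * |z|)
  bound_two : ∀ z, |f₂ z| ≤ K * Real.exp (c * |z|)

namespace ExpSmooth

variable {f f₁ f₂ : ℝ → ℝ} {K c : ℝ}

lemma continuous (h : ExpSmooth f f₁ f₂ K c) : Continuous f :=
  continuous_iff_continuousAt.2 fun z => (h.deriv_one z).continuousAt

lemma continuous_one (h : ExpSmooth f f₁ f₂ K c) : Continuous f₁ :=
  continuous_iff_continuousAt.2 fun z => (h.deriv_two z).continuousAt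

lemma growth (h : ExpSmooth f f₁ f₂ K c) : ExpGrowth f :=
  ⟨K, c, h.K_nonneg, h.c_nonneg, h.bound⟩

lemma growth_one (h : ExpSmooth f f₁ f₂ K c) : ExpGrowth f₁ :=
  ⟨K, c, h.K_nonneg, h.c_nonneg, h.bound_one⟩

lemma growth_two (h : ExpSmooth f f₁ f₂ K c) : ExpGrowth f₂ :=
  ⟨K, c, h.K_nonneg, h.c_nonneg, h.bound_two⟩

end ExpSmooth

/-- Continuity of Gaussian averages, jointly in the variance and the argument. -/
lemma continuous_gaussAvg {g : ℝ → ℝ} (hg : ExpGrowth g) (hc : Continuous g) :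
    Continuous (fun q : ℝ≥0 × ℝ => gaussAvg g q.1 q.2) := by
  obtain ⟨K, c, hK, hc0, hb⟩ := hg
  have h : (fun q : ℝ≥0 × ℝ => gaussAvg g q.1 q.2) =
      fun q : ℝ≥0 × ℝ => ∫ w, g (q.2 + √(q.1 : ℝ) * w) ∂gaussianReal 0 1 := by
    ext q
    exact integral_gaussianReal_sqrt q.1 (g := fun w => g (q.2 + w)) (by fun_prop)
  rw [h, continuous_iff_continuousAt]
  intro q
  have hev : ∀ᶠ r : ℝ≥0 × ℝ in 𝓝 q, |r.2| < |q.2| + 1 ∧ √(r.1 : ℝ) < √(q.1 : ℝ) + 1 := by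
    refine Filter.Eventually.and ?_ ?_
    · exact (Continuous.tendsto (by fun_prop) q : Tendsto (fun r : ℝ≥0 × ℝ => |r.2|) _ _).eventually
        (gt_mem_nhds (by simp))
    · exact (Continuous.tendsto (by fun_prop) q :
        Tendsto (fun r : ℝ≥0 × ℝ => √(r.1 : ℝ)) _ _).eventually (gt_mem_nhds (by simp))
  refine continuousAt_of_dominated (bound := fun w => K * Real.exp (c * (|q.2| + 1)) *
      Real.exp (c * (√(q.1 : ℝ) + 1) * |w|)) ?_ ?_ ?_ ?_
  · exact Eventually.of_forall fun r => by fun_prop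
  · filter_upwards [hev] with r hr
    refine ae_of_all _ fun w => (hb _).trans ?_
    rw [mul_assoc]
    refine mul_le_mul_of_nonneg_left ?_ hK
    rw [← Real.exp_add]
    refine Real.exp_le_exp.2 ?_
    rw [mul_assoc, ← mul_add]
    refine mul_le_mul_of_nonneg_left ((abs_add_le _ _).trans ?_) hc0
    rw [abs_mul, abs_of_nonneg (Real.sqrt_nonneg (r.1 : ℝ))]
    gcongr
    exacts [hr.1.le, hr.2.le]
  · exact (integrable_exp_mul_abs_gaussianReal 0 1 _).const_mul _
  · exact ae_of_all _ fun w => by fun_prop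

lemma abs_gaussAvg_le {g : ℝ → ℝ} {K c C : ℝ} (hK : 0 ≤ K) (hc : 0 ≤ c)
    (hb : ∀ z, |g z| ≤ K * Real.exp (c * |z|)) {v : ℝ≥0}
    (hC : ∫ w, |w| ^ 0 * Real.exp (c * |w|) ∂gaussianReal 0 v ≤ C) (z : ℝ) :
    |gaussAvg g v z| ≤ K * C * Real.exp (c * |z|) := by
  simp only [pow_zero, one_mul] at hC
  calc |gaussAvg g v z| ≤ ∫ w, K * Real.exp (c * |z|) * Real.exp (c * |w|) ∂gaussianReal 0 v := by
        refine norm_integral_le_of_norm_le (f := fun w => g (z + w))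
          ((integrable_exp_mul_abs_gaussianReal 0 v c).const_mul _) (ae_of_all _ fun w => ?_)
        refine (hb _).trans ?_
        rw [mul_assoc]
        exact mul_le_mul_of_nonneg_left (exp_mul_abs_add_le hc z w) hK
    _ ≤ K * Real.exp (c * |z|) * C := by
        rw [integral_const_mul]
        exact mul_le_mul_of_nonneg_left hC (by positivity)
    _ = _ := by ring

/-- Differentiation under the integral, dominated on a unit ball around z. A general mean is allowed
because expected utility is an average over N(v, v), not N(0, v). -/
lemma hasDerivAt_integral_shift {g g' : ℝ → ℝ} (hg : ExpGrowth g) (hg' : ExpGrowth g')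
    (hc : Measurable g') (hd : ∀ z, HasDerivAt g (g' z) z) (m : ℝ) (v : ℝ≥0) (z : ℝ) :
    HasDerivAt (fun y => ∫ w, g (y + w) ∂gaussianReal m v)
      (∫ w, g' (z + w) ∂gaussianReal m v) z := by
  obtain ⟨K, c, hK, hc0, hb⟩ := hg'
  have hgc : Continuous g := continuous_iff_continuousAt.2 fun z => (hd z).continuousAt
  refine (hasDerivAt_integral_of_dominated_loc_of_deriv_le (𝕜 := ℝ) (s := Metric.ball z 1)
    (F := fun y w => g (y + w)) (F' := fun y w => g' (y + w))
    (bound := fun w => K * Real.exp (c * (|z| + 1)) * Real.exp (c * |w|))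
    (Metric.ball_mem_nhds z one_pos) ?_ ?_ ?_ ?_ ?_ ?_).2
  · exact Eventually.of_forall fun y => by fun_prop
  · exact (hg.comp_const_add z).integrable (by fun_prop) _ _
  · exact Measurable.aestronglyMeasurable (by fun_prop)
  · refine ae_of_all _ fun w y hy => (hb _).trans ?_
    rw [mul_assoc]
    refine mul_le_mul_of_nonneg_left ?_ hK
    refine (exp_mul_abs_add_le hc0 y w).trans ?_
    gcongr
    rw [Metric.mem_ball, Real.dist_eq] at hy
    have := abs_sub_abs_le_abs_sub y z
    linarith
  · exact (integrable_exp_mul_abs_gaussianReal m v c).const_mul _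
  · exact ae_of_all _ fun w y _ => (hd (y + w)).comp_add_const y w

/-- The point is uniformity: one constant serves all variances up to V, and the rate c is unchanged.
The Euler scheme uses every variance in such a range. -/
lemma ExpSmooth.gaussAvg_le {f f₁ f₂ : ℝ → ℝ} {K c : ℝ} (h : ExpSmooth f f₁ f₂ K c) (V : ℝ≥0) :
    ∃ K', ∀ v ≤ V, ExpSmooth (gaussAvg f v) (gaussAvg f₁ v) (gaussAvg f₂ v) K' c := by
  obtain ⟨C, hC0, hC⟩ := exists_gaussian_moment_le V 0 h.c_nonneg
  simp only [pow_zero (√_), mul_one] at hC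
  refine ⟨K * C, fun v hv => ⟨mul_nonneg h.K_nonneg hC0, h.c_nonneg, fun z => ?_, fun z => ?_, ?_,
    abs_gaussAvg_le h.K_nonneg h.c_nonneg h.bound (hC v hv),
    abs_gaussAvg_le h.K_nonneg h.c_nonneg h.bound_one (hC v hv),
    abs_gaussAvg_le h.K_nonneg h.c_nonneg h.bound_two (hC v hv)⟩⟩
  · exact hasDerivAt_integral_shift h.growth h.growth_one h.continuous_one.measurable
      h.deriv_one _ _ _
  · exact hasDerivAt_integral_shift h.growth_one h.growth_two h.cont.measurable
      h.deriv_two _ _ _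
  · exact (continuous_gaussAvg h.growth_two h.cont).comp (by fun_prop : Continuous fun z => (v, z))

lemma ExpSmooth.gaussAvg {f f₁ f₂ : ℝ → ℝ} {K c : ℝ} (h : ExpSmooth f f₁ f₂ K c) (v : ℝ≥0) :
    ∃ K', ExpSmooth (gaussAvg f v) (gaussAvg f₁ v) (gaussAvg f₂ v) K' c :=
  (h.gaussAvg_le v).imp fun _ h => h v le_rfl

/-! ### Taylor bounds -/

lemma abs_sub_le_of_hasDerivAt {g g' : ℝ → ℝ} {K c : ℝ} (hK : 0 ≤ K) (hc : 0 ≤ c)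
    (hd : ∀ z, HasDerivAt g (g' z) z) (hb : ∀ z, |g' z| ≤ K * Real.exp (c * |z|)) (z w : ℝ) :
    |g (z + w) - g z| ≤ K * |w| * Real.exp (c * |z|) * Real.exp (c * |w|) := by
  have h := (convex_uIcc z (z + w)).norm_image_sub_le_of_norm_hasDerivWithin_le (f := g)
    (f' := g') (C := K * (Real.exp (c * |z|) * Real.exp (c * |w|)))
    (fun x _ => (hd x).hasDerivWithinAt) (fun x hx => ?_) left_mem_uIcc right_mem_uIcc
  · simp only [Real.norm_eq_abs, add_sub_cancel_left] at h
    exact h.trans (le_of_eq (by ring))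
  · refine (hb x).trans (mul_le_mul_of_nonneg_left ?_ hK)
    rw [← Real.exp_add, ← mul_add]
    refine Real.exp_le_exp.2 (mul_le_mul_of_nonneg_left ?_ hc)
    have h1 : |x - z| ≤ |z + w - z| := abs_sub_left_of_mem_uIcc hx
    rw [add_sub_cancel_left] at h1
    have := abs_sub_abs_le_abs_sub x z
    linarith

lemma abs_taylor_le {g g' g'' : ℝ → ℝ} {K c : ℝ} (hK : 0 ≤ K) (hc : 0 ≤ c)
    (hd : ∀ z, HasDerivAt g (g' z) z) (hd' : ∀ z, HasDerivAt g' (g'' z) z)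
    (hb : ∀ z, |g'' z| ≤ K * Real.exp (c * |z|)) (z w : ℝ) :
    |g (z + w) - g z - g' z * w| ≤ K * w ^ 2 * Real.exp (c * |z|) * Real.exp (c * |w|) := by
  have h := (convex_uIcc 0 w).norm_image_sub_le_of_norm_hasDerivWithin_le
    (f := fun y => g (z + y) - g' z * y)
    (f' := fun y => g' (z + y) - g' z) (C := K * |w| * Real.exp (c * |z|) * Real.exp (c * |w|))
    (fun x _ => (((hd (z + x)).comp_const_add z x).sub
      (by simpa using (hasDerivAt_id x).const_mul (g' z))).hasDerivWithinAt)
    (fun x hx => ?_) left_mem_uIcc right_mem_uIcc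
  · simp only [Real.norm_eq_abs, sub_zero, add_zero, mul_zero] at h
    rw [← sq_abs w]
    refine le_trans (le_of_eq ?_) (h.trans (le_of_eq (by ring)))
    congr 1; ring
  · refine (abs_sub_le_of_hasDerivAt hK hc hd' hb z x).trans ?_
    have : |x| ≤ |w| := by simpa using abs_sub_left_of_mem_uIcc hx
    gcongr


/-! ### Comparison of Gaussian averages of log-concave and log-convex derivatives -/

lemma gaussAvg_pos {g : ℝ → ℝ} (hg : ExpGrowth g) (hc : Measurable g) (hpos : ∀ z, 0 < g z)
    (v : ℝ≥0) (z : ℝ) : 0 < gaussAvg g v z := by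
  refine (integral_pos_iff_support_of_nonneg (fun w => (hpos _).le)
    ((hg.comp_const_add z).integrable (by fun_prop) _ _)).2 ?_
  have : Function.support (fun w => g (z + w)) = univ :=
    eq_univ_of_forall fun w => (hpos _).ne'
  rw [this]
  simp

/-- Chebyshev's association inequality. -/
lemma integral_exp_mul_mul_integral_le (μ : Measure ℝ) [IsProbabilityMeasure μ] {g k : ℝ → ℝ}
    {a : ℝ} (ha : 0 ≤ a) (hpos : ∀ z, 0 < g z) (hq : Antitone fun z => k z / g z)
    (hg : Integrable g μ) (hk : Integrable k μ)
    (heg : Integrable (fun w => Real.exp (a * w) * g w) μ)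
    (hek : Integrable (fun w => Real.exp (a * w) * k w) μ) :
    (∫ w, Real.exp (a * w) * k w ∂μ) * ∫ w, g w ∂μ ≤
      (∫ w, k w ∂μ) * ∫ w, Real.exp (a * w) * g w ∂μ := by
  -- Symmetrisation over two independent copies: the integrand equals (e^{a p₁} - e^{a p₂}) (k/g(p₁)
  -- - k/g(p₂)) g(p₁) g(p₂), a product of oppositely ordered differences with positive weights.
  have hneg : ∫ p : ℝ × ℝ, (((Real.exp (a * p.1) * k p.1) * g p.2 -
      (Real.exp (a * p.1) * g p.1) * k p.2) + (g p.1 * (Real.exp (a * p.2) * k p.2) -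
      k p.1 * (Real.exp (a * p.2) * g p.2))) ∂(μ.prod μ) ≤ 0 := by
    refine integral_nonpos fun p => ?_
    have h1 : (Real.exp (a * p.1) - Real.exp (a * p.2)) * (k p.1 / g p.1 - k p.2 / g p.2) ≤ 0 := by
      rcases le_total p.1 p.2 with h | h
      · exact mul_nonpos_of_nonpos_of_nonneg (sub_nonpos.2 (Real.exp_le_exp.2 (by gcongr)))
          (sub_nonneg.2 (hq h))
      · exact mul_nonpos_of_nonneg_of_nonpos (sub_nonneg.2 (Real.exp_le_exp.2 (by gcongr)))
          (sub_nonpos.2 (hq h))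
    have h2 := mul_nonpos_of_nonpos_of_nonneg h1 (mul_pos (hpos p.1) (hpos p.2)).le
    refine le_trans (le_of_eq ?_) h2
    have := (hpos p.1).ne'
    have := (hpos p.2).ne'
    field_simp
    ring
  rw [integral_add (f := fun p : ℝ × ℝ => (Real.exp (a * p.1) * k p.1) * g p.2 -
      (Real.exp (a * p.1) * g p.1) * k p.2) (g := fun p : ℝ × ℝ =>
      g p.1 * (Real.exp (a * p.2) * k p.2) - k p.1 * (Real.exp (a * p.2) * g p.2))
      ((hek.mul_prod hg).sub (heg.mul_prod hk)) ((hg.mul_prod hek).sub (hk.mul_prod heg)),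
    integral_sub (hek.mul_prod hg) (heg.mul_prod hk),
    integral_sub (hg.mul_prod hek) (hk.mul_prod heg),
    integral_prod_mul (fun w => Real.exp (a * w) * k w) g,
    integral_prod_mul (fun w => Real.exp (a * w) * g w) k,
    integral_prod_mul g (fun w => Real.exp (a * w) * k w),
    integral_prod_mul k (fun w => Real.exp (a * w) * g w)] at hneg
  linarith

lemma gaussAvg_eq_integral {g : ℝ → ℝ} (hm : Measurable g) (v : ℝ≥0) (z : ℝ) :
    gaussAvg g v z = ∫ w, g w ∂gaussianReal z v := by
  rw [integral_gaussianReal_shift z v hm]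
  simp only [gaussAvg, add_comm]

/-- For v > 0, tilting N(z₁, v) by e^{aw} with a = (z₂ - z₁)/v gives N(z₂, v) up to a factor that is
the same for g and k. Chebyshev's inequality for the tilt is then the claim. -/
lemma antitone_gaussAvg_div {g k : ℝ → ℝ} (hg : ExpGrowth g) (hk : ExpGrowth k)
    (hgm : Measurable g) (hkm : Measurable k) (hpos : ∀ z, 0 < g z)
    (hq : Antitone fun z => k z / g z) (v : ℝ≥0) :
    Antitone fun z => gaussAvg k v z / gaussAvg g v z := by
  rcases eq_or_ne v 0 with rfl | hv
  · simpa using hq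
  intro z₁ z₂ hz
  have hv' : (0 : ℝ) < v := by positivity
  have key (h : ℝ → ℝ) (hm : Measurable h) : ∫ w, Real.exp ((z₂ - z₁) / v * w) * h w
      ∂gaussianReal z₁ v = Real.exp ((z₂ - z₁) / v * z₁ + ((z₂ - z₁) / v) ^ 2 * v / 2) *
        gaussAvg h v z₂ := by
    rw [integral_exp_mul_gaussianReal, gaussAvg_eq_integral hm]
    congr 3
    field_simp
    ring
  have h := integral_exp_mul_mul_integral_le (gaussianReal z₁ v) (a := (z₂ - z₁) / v)
    (div_nonneg (sub_nonneg.2 hz) hv'.le) hpos hq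
    (hg.integrable hgm _ _) (hk.integrable hkm _ _)
    (((expGrowth_exp _).mul hg).integrable (by fun_prop) _ _)
    (((expGrowth_exp _).mul hk).integrable (by fun_prop) _ _)
  rw [key k hkm, key g hgm, ← gaussAvg_eq_integral hgm, ← gaussAvg_eq_integral hkm] at h
  change gaussAvg k v z₂ / gaussAvg g v z₂ ≤ gaussAvg k v z₁ / gaussAvg g v z₁
  rw [div_le_div_iff₀ (gaussAvg_pos hg hgm hpos v z₂) (gaussAvg_pos hg hgm hpos v z₁)]
  refine le_of_mul_le_mul_left ?_ (Real.exp_pos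
    ((z₂ - z₁) / v * z₁ + ((z₂ - z₁) / v) ^ 2 * v / 2))
  linarith

/-- If the logarithmic derivative of `f₁ = f'` is antitone up to the sign `ε`, then `ε * f₁` lies
below its tangent line as a function of `f`. -/
lemma mul_sub_le_of_antitone_logDeriv {f f₁ f₂ : ℝ → ℝ} {ε : ℝ}
    (hd : ∀ z, HasDerivAt f (f₁ z) z) (hd' : ∀ z, HasDerivAt f₁ (f₂ z) z)
    (hpos : ∀ z, 0 < f₁ z) (hq : Antitone fun z => ε * f₂ z / f₁ z) (z ζ : ℝ) :
    ε * f₁ ζ - ε * f₁ z ≤ ε * f₂ z / f₁ z * (f ζ - f z) := by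
  set q := fun z => ε * f₂ z / f₁ z with hqdef
  -- Since q is antitone, this derivative changes sign from nonnegative to nonpositive at y = z, so
  -- ε f₁ - q(z) f is maximal at z.
  have hφ (y : ℝ) : HasDerivAt (fun y => ε * f₁ y - q z * f y) ((q y - q z) * f₁ y) y := by
    refine (((hd' y).const_mul ε).sub ((hd y).const_mul (q z))).congr_deriv ?_
    have := (hpos y).ne'
    simp only [hqdef]
    field_simp
  have hcont : Continuous fun y => ε * f₁ y - q z * f y :=
    continuous_iff_continuousAt.2 fun y => (hφ y).continuousAt
  have hle : ε * f₁ ζ - q z * f ζ ≤ ε * f₁ z - q z * f z := by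
    rcases le_total ζ z with h | h
    · refine monotoneOn_of_hasDerivWithinAt_nonneg (convex_Iic z) hcont.continuousOn
        (fun y _ => (hφ y).hasDerivWithinAt) (fun y hy => ?_) (mem_Iic.2 h) self_mem_Iic h
      rw [interior_Iic] at hy
      exact mul_nonneg (sub_nonneg.2 (hq (le_of_lt hy))) (hpos y).le
    · refine antitoneOn_of_hasDerivWithinAt_nonpos (convex_Ici z) hcont.continuousOn
        (fun y _ => (hφ y).hasDerivWithinAt) (fun y hy => ?_) self_mem_Ici (mem_Ici.2 h) h
      rw [interior_Ici] at hy
      exact mul_nonpos_of_nonpos_of_nonneg (sub_nonpos.2 (hq (le_of_lt hy))) (hpos y).le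
  linarith

lemma gaussAvg_const_mul (ε : ℝ) (g : ℝ → ℝ) (v : ℝ≥0) (z : ℝ) :
    gaussAvg (fun z => ε * g z) v z = ε * gaussAvg g v z := integral_const_mul _ _

lemma ExpGrowth.const_mul {g : ℝ → ℝ} (hg : ExpGrowth g) (ε : ℝ) :
    ExpGrowth fun z => ε * g z := by
  obtain ⟨K, c, hK, hc, h⟩ := hg
  refine ⟨|ε| * K, c, by positivity, hc, fun z => ?_⟩
  rw [abs_mul, mul_assoc]
  exact mul_le_mul_of_nonneg_left (h z) (abs_nonneg ε)

/-- The comparison behind the theorem, with ε = 1 for concave R and ε = -1 for convex R. The tangent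
inequality for the averages of variance v is integrated against the remaining Gaussian of variance η
= v' - v. -/
lemma mul_gaussAvg_le_of_antitone_logDeriv {f f₁ f₂ : ℝ → ℝ} {K c ε : ℝ}
    (h : ExpSmooth f f₁ f₂ K c) (hpos : ∀ z, 0 < f₁ z)
    (hq : Antitone fun z => ε * f₂ z / f₁ z) {v v' : ℝ≥0} (hv : v ≤ v') {z z' : ℝ}
    (hz : gaussAvg f v z = gaussAvg f v' z') :
    ε * gaussAvg f₁ v' z' ≤ ε * gaussAvg f₁ v z := by
  obtain ⟨η, rfl⟩ := exists_add_of_le hv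
  obtain ⟨K', h'⟩ := h.gaussAvg v
  have hq' := antitone_gaussAvg_div h.growth_one (h.growth_two.const_mul ε)
    h.continuous_one.measurable (h.cont.measurable.const_mul ε) hpos hq v
  simp only [gaussAvg_const_mul] at hq'
  have key := mul_sub_le_of_antitone_logDeriv h'.deriv_one h'.deriv_two
    (gaussAvg_pos h.growth_one h.continuous_one.measurable hpos v) hq' z
  rw [← gaussAvg_gaussAvg h.growth_one h.continuous_one.measurable]
  rw [← gaussAvg_gaussAvg h.growth h.continuous.measurable] at hz
  set q := ε * gaussAvg f₂ v z / gaussAvg f₁ v z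
  have hi : Integrable (fun w => gaussAvg f v (z' + w)) (gaussianReal 0 η) :=
    (h'.growth.comp_const_add z').integrable (h'.continuous.measurable.comp (by fun_prop)) _ _
  have hi₁ : Integrable (fun w => gaussAvg f₁ v (z' + w)) (gaussianReal 0 η) :=
    (h'.growth_one.comp_const_add z').integrable
      (h'.continuous_one.measurable.comp (by fun_prop)) _ _
  have hint := integral_mono (μ := gaussianReal 0 η)
    ((hi₁.const_mul ε).sub (integrable_const (ε * gaussAvg f₁ v z)))
    ((hi.sub (integrable_const (gaussAvg f v z))).const_mul q) (fun w => key (z' + w))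
  simp only [Pi.sub_apply] at hint
  rw [integral_sub (hi₁.const_mul ε) (integrable_const _), integral_const_mul ε, integral_const_mul q,
    integral_sub hi (integrable_const _)] at hint
  simp only [integral_const, probReal_univ, smul_eq_mul, one_mul] at hint
  change ε * gaussAvg (gaussAvg f₁ v) η z' - _ ≤ q * (gaussAvg (gaussAvg f v) η z' - _) at hint
  -- The linear term drops out because the two averages of f agree.
  rw [← hz, sub_self, mul_zero] at hint
  linarith


/-! ### The inverse marginal utility in logarithmic coordinates -/

namespace IsUtility

variable {U : ℝ → ℝ} (hU : IsUtility U)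
include hU

lemma contDiffOn_deriv : ContDiffOn ℝ ((⊤ : ℕ∞) : WithTop ℕ∞) (deriv U) (Ioi 0) :=
  hU.smooth.deriv_of_isOpen isOpen_Ioi (by simp)

lemma contDiffOn_deriv_deriv :
    ContDiffOn ℝ ((⊤ : ℕ∞) : WithTop ℕ∞) (deriv (deriv U)) (Ioi 0) :=
  hU.contDiffOn_deriv.deriv_of_isOpen isOpen_Ioi (by simp)

lemma differentiableAt {x : ℝ} (hx : 0 < x) : DifferentiableAt ℝ U x :=
  (hU.smooth.contDiffAt (Ioi_mem_nhds hx)).differentiableAt (by simp)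

lemma differentiableAt_deriv {x : ℝ} (hx : 0 < x) : DifferentiableAt ℝ (deriv U) x :=
  (hU.contDiffOn_deriv.contDiffAt (Ioi_mem_nhds hx)).differentiableAt (by simp)

lemma strictAntiOn_deriv : StrictAntiOn (deriv U) (Ioi 0) :=
  hU.strictConcave.strictAntiOn_deriv fun _ hx => hU.differentiableAt hx

lemma deriv_pos {x : ℝ} (hx : 0 < x) : 0 < deriv U x := by
  have h1 : 0 ≤ deriv U (x + 1) := by
    refine le_of_tendsto hU.inada_top ?_
    filter_upwards [eventually_ge_atTop (x + 1)] with y hy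
    exact hU.strictAntiOn_deriv.antitoneOn (mem_Ioi.2 (by linarith)) (mem_Ioi.2 (by linarith)) hy
  exact h1.trans_lt (hU.strictAntiOn_deriv (mem_Ioi.2 hx) (mem_Ioi.2 (by linarith)) (by linarith))

lemma exists_deriv_eq {y : ℝ} (hy : 0 < y) : ∃ x ∈ Ioi (0 : ℝ), deriv U x = y := by
  obtain ⟨a, ha, ha0⟩ := ((hU.inada_zero.eventually_gt_atTop y).and self_mem_nhdsWithin).exists
  obtain ⟨b, hb, hb0⟩ :=
    ((hU.inada_top.eventually (gt_mem_nhds hy)).and (eventually_gt_atTop 0)).exists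
  have hsub : uIcc a b ⊆ Ioi 0 := (convex_Ioi 0).ordConnected.uIcc_subset ha0 hb0
  obtain ⟨x, hx, h⟩ := intermediate_value_uIcc (hU.contDiffOn_deriv.continuousOn.mono hsub)
    (mem_uIcc_of_ge hb.le ha.le)
  exact ⟨x, hsub hx, h⟩

lemma inverseMarginal_pos {y : ℝ} (hy : 0 < y) : 0 < inverseMarginal U y :=
  Function.invFunOn_mem (hU.exists_deriv_eq hy)

lemma deriv_inverseMarginal {y : ℝ} (hy : 0 < y) : deriv U (inverseMarginal U y) = y :=
  Function.invFunOn_eq (hU.exists_deriv_eq hy)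

lemma differentiableAt_inverseMarginal {y : ℝ} (hy : 0 < y) :
    DifferentiableAt ℝ (inverseMarginal U) y := by
  obtain ⟨c, C, hc, -, h⟩ := hU.bound_one
  -- `deriv` takes the value 0 where a function is not differentiable; the lower bound c I ≤ |y I'|
  -- with I > 0 excludes the value 0, hence forces differentiability.
  refine differentiableAt_of_deriv_ne_zero fun h0 => ?_
  have := (h y hy).1
  rw [h0, mul_zero, abs_zero] at this
  exact absurd this (not_le.2 (mul_pos hc (hU.inverseMarginal_pos hy)))

lemma deriv_deriv_mul_deriv {y : ℝ} (hy : 0 < y) :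
    deriv (deriv U) (inverseMarginal U y) * deriv (inverseMarginal U) y = 1 := by
  have h1 := (hU.differentiableAt_deriv (hU.inverseMarginal_pos hy)).hasDerivAt.comp y
    (hU.differentiableAt_inverseMarginal hy).hasDerivAt
  have h2 : deriv U ∘ inverseMarginal U =ᶠ[𝓝 y] id := by
    filter_upwards [Ioi_mem_nhds hy] with z hz using hU.deriv_inverseMarginal hz
  exact (h2.hasDerivAt_iff.1 h1).unique (hasDerivAt_id y)

lemma inverseMarginal_deriv {x : ℝ} (hx : 0 < x) : inverseMarginal U (deriv U x) = x :=
  hU.strictAntiOn_deriv.injOn (hU.inverseMarginal_pos (hU.deriv_pos hx)) hx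
    (hU.deriv_inverseMarginal (hU.deriv_pos hx))

/-- Strict concavity alone yields U'' ≤ 0. That U'' does not vanish comes from U''(I) I' = 1. -/
lemma deriv_deriv_neg {x : ℝ} (hx : 0 < x) : deriv (deriv U) x < 0 := by
  refine lt_of_le_of_ne ?_ fun h0 => ?_
  · have h : derivWithin (deriv U) (Ioi 0) x ≤ 0 :=
      hU.strictAntiOn_deriv.antitoneOn.derivWithin_nonpos
    rwa [derivWithin_of_isOpen isOpen_Ioi hx] at h
  · have h1 := hU.deriv_deriv_mul_deriv (hU.deriv_pos hx)
    rw [hU.inverseMarginal_deriv hx, h0, zero_mul] at h1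
    exact zero_ne_one h1

lemma riskToleranceCoeff_pos {x : ℝ} (hx : 0 < x) : 0 < riskToleranceCoeff U x := by
  rw [riskToleranceCoeff, neg_pos]
  exact div_neg_of_pos_of_neg (hU.deriv_pos hx) (hU.deriv_deriv_neg hx)

lemma contDiffOn_riskToleranceCoeff :
    ContDiffOn ℝ ((⊤ : ℕ∞) : WithTop ℕ∞) (riskToleranceCoeff U) (Ioi 0) :=
  (hU.contDiffOn_deriv.div hU.contDiffOn_deriv_deriv fun _ hx => (hU.deriv_deriv_neg hx).ne).neg

lemma differentiableAt_riskToleranceCoeff {x : ℝ} (hx : 0 < x) :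
    DifferentiableAt ℝ (riskToleranceCoeff U) x :=
  (hU.contDiffOn_riskToleranceCoeff.contDiffAt (Ioi_mem_nhds hx)).differentiableAt (by simp)

lemma hasDerivAt_inverseMarginal {y : ℝ} (hy : 0 < y) :
    HasDerivAt (inverseMarginal U) (-riskToleranceCoeff U (inverseMarginal U y) / y) y := by
  refine (hU.differentiableAt_inverseMarginal hy).hasDerivAt.congr_deriv ?_
  have h := hU.deriv_deriv_mul_deriv hy
  have hne := (hU.deriv_deriv_neg (hU.inverseMarginal_pos hy)).ne
  rw [riskToleranceCoeff, hU.deriv_inverseMarginal hy]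
  field_simp
  linear_combination h

/-- Obtained by differentiating I' = -R(I)/y. It turns the bounds on I'' into bounds on f'' = R'(f)
f'. -/
lemma iteratedDeriv_two_inverseMarginal {y : ℝ} (hy : 0 < y) :
    y ^ 2 * iteratedDeriv 2 (inverseMarginal U) y =
      deriv (riskToleranceCoeff U) (inverseMarginal U y) *
        riskToleranceCoeff U (inverseMarginal U y) +
      riskToleranceCoeff U (inverseMarginal U y) := by
  have h1 : deriv (inverseMarginal U) =ᶠ[𝓝 y]
      fun y => -riskToleranceCoeff U (inverseMarginal U y) / y := by
    filter_upwards [Ioi_mem_nhds hy] with z hz using (hU.hasDerivAt_inverseMarginal hz).deriv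
  have h2 := (((hU.differentiableAt_riskToleranceCoeff
    (hU.inverseMarginal_pos hy)).hasDerivAt.comp y (hU.hasDerivAt_inverseMarginal hy)).neg.div
    (hasDerivAt_id y) hy.ne')
  rw [iteratedDeriv_succ, iteratedDeriv_one, h1.deriv_eq]
  rw [show (fun y => -riskToleranceCoeff U (inverseMarginal U y) / y) =
    (-(riskToleranceCoeff U ∘ inverseMarginal U)) / id from rfl, h2.deriv]
  simp only [Pi.neg_apply, Function.comp_apply, id_eq]
  field_simp
  ring

end IsUtility

/-- Optimal wealth as a function of minus the logarithm of marginal utility. -/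
noncomputable def logWealth (U : ℝ → ℝ) (z : ℝ) : ℝ := inverseMarginal U (Real.exp (-z))

/-- The first derivative of `logWealth`. -/
noncomputable def logWealthDeriv (U : ℝ → ℝ) (z : ℝ) : ℝ := riskToleranceCoeff U (logWealth U z)

/-- The second derivative of `logWealth`. -/
noncomputable def logWealthDeriv₂ (U : ℝ → ℝ) (z : ℝ) : ℝ :=
  deriv (riskToleranceCoeff U) (logWealth U z) * logWealthDeriv U z

namespace IsUtility

variable {U : ℝ → ℝ} (hU : IsUtility U)
include hU

lemma logWealth_pos (z : ℝ) : 0 < logWealth U z := hU.inverseMarginal_pos (Real.exp_pos _)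

lemma deriv_logWealth (z : ℝ) : deriv U (logWealth U z) = Real.exp (-z) :=
  hU.deriv_inverseMarginal (Real.exp_pos _)

lemma logWealthDeriv_pos (z : ℝ) : 0 < logWealthDeriv U z :=
  hU.riskToleranceCoeff_pos (hU.logWealth_pos z)

lemma hasDerivAt_logWealth (z : ℝ) : HasDerivAt (logWealth U) (logWealthDeriv U z) z := by
  have h := (hU.hasDerivAt_inverseMarginal (Real.exp_pos (-z))).comp z (hasDerivAt_neg z).exp
  refine h.congr_deriv ?_
  have := (Real.exp_pos (-z)).ne'
  simp only [logWealthDeriv, logWealth]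
  field_simp

lemma hasDerivAt_logWealthDeriv (z : ℝ) :
    HasDerivAt (logWealthDeriv U) (logWealthDeriv₂ U z) z :=
  (hU.differentiableAt_riskToleranceCoeff (hU.logWealth_pos z)).hasDerivAt.comp z
    (hU.hasDerivAt_logWealth z)

lemma monotone_logWealth : Monotone (logWealth U) :=
  monotone_of_hasDerivAt_nonneg hU.hasDerivAt_logWealth fun z => (hU.logWealthDeriv_pos z).le

lemma abs_exp_mul_deriv_inverseMarginal (z : ℝ) :
    |Real.exp (-z) * deriv (inverseMarginal U) (Real.exp (-z))| = logWealthDeriv U z := by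
  rw [(hU.hasDerivAt_inverseMarginal (Real.exp_pos (-z))).deriv,
    mul_div_cancel₀ _ (Real.exp_pos (-z)).ne', abs_neg]
  exact abs_of_pos (hU.logWealthDeriv_pos z)

lemma exists_mul_logWealth_le : ∃ c : ℝ, 0 < c ∧ ∀ z, c * logWealth U z ≤ logWealthDeriv U z := by
  obtain ⟨c, C, hc, -, h⟩ := hU.bound_one
  refine ⟨c, hc, fun z => ?_⟩
  rw [← hU.abs_exp_mul_deriv_inverseMarginal]
  exact (h _ (Real.exp_pos _)).1

lemma continuous_logWealthDeriv₂ : Continuous (logWealthDeriv₂ U) := by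
  have h1 : Continuous (logWealth U) :=
    continuous_iff_continuousAt.2 fun z => (hU.hasDerivAt_logWealth z).continuousAt
  have h2 : Continuous (logWealthDeriv U) :=
    continuous_iff_continuousAt.2 fun z => (hU.hasDerivAt_logWealthDeriv z).continuousAt
  have h3 := hU.contDiffOn_riskToleranceCoeff.continuousOn_deriv_of_isOpen isOpen_Ioi (by simp)
  exact (h3.comp_continuous h1 hU.logWealth_pos).mul h2

/-- The structural bounds on I enter here: the power bound on I gives the growth of f, the bound on
|y I'| gives f' ≤ C₁ f, and the bounds on y I'' control f'' by f'. -/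
lemma expSmooth_logWealth :
    ∃ K c, ExpSmooth (logWealth U) (logWealthDeriv U) (logWealthDeriv₂ U) K c := by
  obtain ⟨C, δ, hC, hδ, h0⟩ := hU.decay
  obtain ⟨c₁, C₁, -, hC₁, h1⟩ := hU.bound_one
  obtain ⟨c₂, C₂, hc₂, hC₂, h2⟩ := hU.bound_two
  have hb0 (z : ℝ) : logWealth U z ≤ 2 * C * Real.exp (δ * |z|) := by
    refine (h0 _ (Real.exp_pos (-z))).trans ?_
    rw [← Real.exp_mul, mul_comm 2 C, mul_assoc]
    refine mul_le_mul_of_nonneg_left ?_ hC.le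
    have e1 : (1 : ℝ) ≤ Real.exp (δ * |z|) := Real.one_le_exp (by positivity)
    have e2 : Real.exp (-z * -δ) ≤ Real.exp (δ * |z|) :=
      Real.exp_le_exp.2 (by nlinarith [le_abs_self z])
    linarith
  have hb1 (z : ℝ) : logWealthDeriv U z ≤ C₁ * logWealth U z := by
    rw [← hU.abs_exp_mul_deriv_inverseMarginal]
    exact (h1 _ (Real.exp_pos _)).2
  have hb2 (z : ℝ) : |logWealthDeriv₂ U z| ≤ (C₂ + 1) * logWealthDeriv U z := by
    have hy := Real.exp_pos (-z)
    have e := hU.iteratedDeriv_two_inverseMarginal hy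
    -- With y = e^{-z}: f'' = y² I'' - f', and y² I'' lies between c₂ f' and C₂ f', whence |f''| ≤
    -- (C₂ + 1) f'.
    have e' : logWealthDeriv₂ U z = Real.exp (-z) *
        (Real.exp (-z) * iteratedDeriv 2 (inverseMarginal U) (Real.exp (-z))) -
        logWealthDeriv U z := by
      simp only [logWealthDeriv₂, logWealthDeriv, logWealth]
      linear_combination -e
    have e3 := hU.abs_exp_mul_deriv_inverseMarginal z
    rw [abs_mul, abs_of_pos hy] at e3
    have e4 := mul_le_mul_of_nonneg_left (h2 _ hy).1 hy.le
    have e5 := mul_le_mul_of_nonneg_left (h2 _ hy).2 hy.le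
    have e6 := (hU.logWealthDeriv_pos z).le
    rw [mul_left_comm _ c₂, e3] at e4
    rw [mul_left_comm _ C₂, e3] at e5
    rw [e', abs_le]
    constructor <;> nlinarith
  have hf (z : ℝ) := hU.logWealth_pos z
  have hE (z : ℝ) : 0 < C * Real.exp (δ * |z|) := by positivity
  -- The three summands in parentheses dominate f, f' and f'' respectively, so that a single
  -- constant serves all three.
  refine ⟨2 * C * (1 + C₁ + (C₂ + 1) * C₁), δ, by positivity, hδ.le, hU.hasDerivAt_logWealth,
    hU.hasDerivAt_logWealthDeriv, hU.continuous_logWealthDeriv₂, fun z => ?_, fun z => ?_,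
    fun z => ?_⟩
  · rw [abs_of_pos (hf z)]
    refine (hb0 z).trans ?_
    refine mul_le_mul_of_nonneg_right (le_mul_of_one_le_right (by positivity) ?_) (by positivity)
    nlinarith [mul_pos hC₂ hC₁]
  · rw [abs_of_pos (hU.logWealthDeriv_pos z)]
    calc logWealthDeriv U z ≤ C₁ * (2 * C * Real.exp (δ * |z|)) :=
          (hb1 z).trans (by gcongr; exact hb0 z)
      _ = 2 * C * C₁ * Real.exp (δ * |z|) := by ring
      _ ≤ _ := by
        gcongr
        nlinarith [mul_pos hC₂ hC₁]
  · calc |logWealthDeriv₂ U z| ≤ (C₂ + 1) * (C₁ * (2 * C * Real.exp (δ * |z|))) :=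
          (hb2 z).trans (by gcongr; exact (hb1 z).trans (by gcongr; exact hb0 z))
      _ = 2 * C * ((C₂ + 1) * C₁) * Real.exp (δ * |z|) := by ring
      _ ≤ _ := by
        gcongr
        linarith

lemma antitone_logDeriv_of_concaveOn (h : ConcaveOn ℝ (Ioi 0) (riskToleranceCoeff U)) :
    Antitone fun z => 1 * logWealthDeriv₂ U z / logWealthDeriv U z := by
  have h1 := h.antitoneOn_deriv fun x hx => hU.differentiableAt_riskToleranceCoeff hx
  have h2 (z : ℝ) : 1 * logWealthDeriv₂ U z / logWealthDeriv U z =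
      deriv (riskToleranceCoeff U) (logWealth U z) := by
    have := (hU.logWealthDeriv_pos z).ne'
    rw [logWealthDeriv₂, one_mul, mul_div_cancel_right₀ _ this]
  intro z₁ z₂ hz
  simp only [h2]
  exact h1 (hU.logWealth_pos z₁) (hU.logWealth_pos z₂) (hU.monotone_logWealth hz)

lemma antitone_neg_logDeriv_of_convexOn (h : ConvexOn ℝ (Ioi 0) (riskToleranceCoeff U)) :
    Antitone fun z => -1 * logWealthDeriv₂ U z / logWealthDeriv U z := by
  have h1 := h.monotoneOn_deriv fun x hx => hU.differentiableAt_riskToleranceCoeff hx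
  have h2 (z : ℝ) : -1 * logWealthDeriv₂ U z / logWealthDeriv U z =
      -deriv (riskToleranceCoeff U) (logWealth U z) := by
    have := (hU.logWealthDeriv_pos z).ne'
    rw [logWealthDeriv₂, neg_one_mul, neg_div, mul_div_cancel_right₀ _ this]
  intro z₁ z₂ hz
  simp only [h2]
  exact neg_le_neg
    (h1 (hU.logWealth_pos z₁) (hU.logWealth_pos z₂) (hU.monotone_logWealth hz))

lemma hasDerivAt_utility_logWealth (z : ℝ) :
    HasDerivAt (fun z => U (logWealth U z)) (Real.exp (-z) * logWealthDeriv U z) z := by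
  rw [← hU.deriv_logWealth]
  exact (hU.differentiableAt (hU.logWealth_pos z)).hasDerivAt.comp z (hU.hasDerivAt_logWealth z)

lemma expGrowth_exp_neg_mul_logWealthDeriv :
    ExpGrowth (fun z => Real.exp (-z) * logWealthDeriv U z) := by
  obtain ⟨K, c, h⟩ := hU.expSmooth_logWealth
  simpa using (expGrowth_exp (-1)).mul h.growth_one

lemma expGrowth_utility_logWealth : ExpGrowth (fun z => U (logWealth U z)) := by
  obtain ⟨K, c, hK, hc, h⟩ := hU.expGrowth_exp_neg_mul_logWealthDeriv
  refine ⟨|U (logWealth U 0)| + K, c + 1, by positivity, by positivity, fun z => ?_⟩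
  have h1 := abs_sub_le_of_hasDerivAt hK hc hU.hasDerivAt_utility_logWealth h 0 z
  simp only [zero_add, abs_zero, mul_zero, Real.exp_zero, mul_one] at h1
  have h2 : |z| ≤ Real.exp |z| := (by linarith [Real.add_one_le_exp |z|])
  have h3 : (1 : ℝ) ≤ Real.exp ((c + 1) * |z|) := Real.one_le_exp (by positivity)
  calc |U (logWealth U z)| ≤ |U (logWealth U 0)| + |U (logWealth U z) - U (logWealth U 0)| := by
        have := abs_sub_abs_le_abs_sub (U (logWealth U z)) (U (logWealth U 0))
        linarith
    _ ≤ |U (logWealth U 0)| * Real.exp ((c + 1) * |z|) +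
        K * Real.exp |z| * Real.exp (c * |z|) := by
        refine add_le_add (le_mul_of_one_le_right (abs_nonneg _) h3) (h1.trans ?_)
        gcongr
    _ = _ := by rw [add_mul c 1, Real.exp_add, one_mul]; ring

/-- The tangent of U at f(z) has slope e^{-z}. With z replaced by Y_T this slope is a multiple of
the state price density, which makes the inequality a duality bound. -/
lemma utility_le_tangent (z : ℝ) {x : ℝ} (hx : 0 < x) :
    U x ≤ U (logWealth U z) + Real.exp (-z) * (x - logWealth U z) := by
  have hf := hU.logWealth_pos z
  have hd := hU.differentiableAt hf
  rw [← hU.deriv_logWealth]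
  have hcv := hU.strictConcave.concaveOn
  rcases lt_trichotomy x (logWealth U z) with h | h | h
  · have := hcv.deriv_le_slope hx hf h hd
    rw [slope_def_field, le_div_iff₀ (sub_pos.2 h)] at this
    linarith
  · rw [h]; simp
  · have := hcv.slope_le_deriv hf hx h hd
    rw [slope_def_field, div_le_iff₀ (sub_pos.2 h)] at this
    linarith

lemma extUtility_le_tangent (z : ℝ) {x : ℝ} (hx : 0 ≤ x) :
    extUtility U x ≤ ((U (logWealth U z) + Real.exp (-z) * (x - logWealth U z) : ℝ) : EReal) := by
  rcases hx.lt_or_eq with hx | rfl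
  · rw [extUtility, if_pos hx]
    exact EReal.coe_le_coe_iff.2 (hU.utility_le_tangent z hx)
  · rw [extUtility, if_neg (lt_irrefl _)]
    have hlim : Tendsto (fun y : ℝ => ((U (logWealth U z) +
        Real.exp (-z) * (y - logWealth U z) : ℝ) : EReal)) (𝓝[>] 0)
        (𝓝 ((U (logWealth U z) + Real.exp (-z) * (0 - logWealth U z) : ℝ) : EReal)) :=
      ((continuous_coe_real_ereal.comp (by fun_prop : Continuous fun y : ℝ =>
        U (logWealth U z) + Real.exp (-z) * (y - logWealth U z))).tendsto 0).mono_left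
        nhdsWithin_le_nhds
    -- At zero wealth the utility is an infimum, below U(y) for each y > 0; the tangent bound at y
    -- passes to the limit y → 0.
    refine ge_of_tendsto hlim ?_
    filter_upwards [self_mem_nhdsWithin] with y hy
    exact (iInf₂_le y hy).trans (EReal.coe_le_coe_iff.2 (hU.utility_le_tangent z hy))

end IsUtility


/-! ### Increments of a multidimensional Brownian motion -/

/-- If the pairs `(X i, Y i)` are independent and `X i` is independent of `Y i` for each `i`, then
the families `X` and `Y` are independent. -/
lemma indepFun_pi_of_iIndepFun_prod {Ω ι α β : Type*} [MeasurableSpace Ω] {P : Measure Ω}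
    [IsProbabilityMeasure P] [Fintype ι] [MeasurableSpace α] [MeasurableSpace β]
    {X : ι → Ω → α} {Y : ι → Ω → β} (hX : ∀ i, Measurable (X i)) (hY : ∀ i, Measurable (Y i))
    (h : iIndepFun (fun i ω => (X i ω, Y i ω)) P) (hXY : ∀ i, IndepFun (X i) (Y i) P) :
    IndepFun (fun ω i => X i ω) (fun ω i => Y i ω) P := by
  have hpX (i : ι) : IsProbabilityMeasure (P.map (X i)) :=
    Measure.isProbabilityMeasure_map (hX i).aemeasurable
  have hpY (i : ι) : IsProbabilityMeasure (P.map (Y i)) :=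
    Measure.isProbabilityMeasure_map (hY i).aemeasurable
  have h1 := (iIndepFun_iff_map_fun_eq_pi_map
    (fun i => ((hX i).prodMk (hY i)).aemeasurable)).1 h
  have h2 : (fun i => P.map fun ω => (X i ω, Y i ω)) =
      fun i => (P.map (X i)).prod (P.map (Y i)) := by
    ext1 i
    exact (indepFun_iff_map_prod_eq_prod_map_map (hX i).aemeasurable (hY i).aemeasurable).1 (hXY i)
  rw [h2] at h1
  have hiX : iIndepFun X P := h.comp (fun _ => Prod.fst) fun _ => measurable_fst
  have hiY : iIndepFun Y P := h.comp (fun _ => Prod.snd) fun _ => measurable_snd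
  -- The joint law of the pairs is a product over i of products; regrouping the factors splits it
  -- into the law of X times the law of Y.
  rw [indepFun_iff_map_prod_eq_prod_map_map (measurable_pi_lambda _ hX).aemeasurable
    (measurable_pi_lambda _ hY).aemeasurable,
    (iIndepFun_iff_map_fun_eq_pi_map fun i => (hX i).aemeasurable).1 hiX,
    (iIndepFun_iff_map_fun_eq_pi_map fun i => (hY i).aemeasurable).1 hiY,
    ← (measurePreserving_arrowProdEquivProdArrow α β ι (fun i => P.map (X i))
      (fun i => P.map (Y i))).map_eq, ← h1, Measure.map_map
      (MeasurableEquiv.measurable _)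
      (measurable_pi_lambda _ fun i => (hX i).prodMk (hY i))]
  rfl

/-- Conditional Fubini: integrating a function of an `m`-measurable variable and a variable
independent of `m`. -/
lemma lintegral_comp_of_indep {Ω E F : Type*} {m mΩ : MeasurableSpace Ω} {P : Measure Ω}
    [IsProbabilityMeasure P] [MeasurableSpace E] [MeasurableSpace F]
    (hm : m ≤ mΩ) {ζ : Ω → E} {w : Ω → F} (hζ : Measurable[m] ζ) (hw : Measurable w)
    (h : Indep m (MeasurableSpace.comap w inferInstance) P) {g : E × F → ℝ≥0∞}
    (hg : Measurable g) :
    ∫⁻ ω, g (ζ ω, w ω) ∂P = ∫⁻ ω, ∫⁻ y, g (ζ ω, y) ∂(P.map w) ∂P := by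
  have hζ' : Measurable ζ := hζ.mono hm le_rfl
  have hind : IndepFun ζ w P := indep_of_indep_of_le_left h hζ.comap_le
  have hp : IsProbabilityMeasure (P.map w) := Measure.isProbabilityMeasure_map hw.aemeasurable
  rw [← lintegral_map (f := g) (g := fun ω => (ζ ω, w ω)) hg (hζ'.prodMk hw),
    (indepFun_iff_map_prod_eq_prod_map_map hζ'.aemeasurable hw.aemeasurable).1 hind,
    lintegral_prod _ hg.aemeasurable, lintegral_map (hg.lintegral_prod_right') hζ']

lemma map_sum_gaussianReal {Ω ι : Type*} [MeasurableSpace Ω] {P : Measure Ω}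
    [IsProbabilityMeasure P] {X : ι → Ω → ℝ} {v : ι → ℝ≥0}
    (hX : ∀ i, Measurable (X i)) (h : iIndepFun X P)
    (hlaw : ∀ i, P.map (X i) = gaussianReal 0 (v i)) (S : Finset ι) :
    P.map (fun ω => ∑ i ∈ S, X i ω) = gaussianReal 0 (∑ i ∈ S, v i) := by
  classical
  induction S using Finset.induction_on with
  | empty => simp [Measure.map_const]
  | insert i S hi ih =>
    have h1 := h.indepFun_finsetSum_of_notMem hX hi
    have e : (fun ω => ∑ j ∈ insert i S, X j ω) = (∑ j ∈ S, X j) + X i := by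
      ext ω
      simp [Finset.sum_insert hi, add_comm]
    have e' : (fun ω => ∑ j ∈ S, X j ω) = ∑ j ∈ S, X j := by ext ω; simp
    rw [e' ] at ih
    rw [e, gaussianReal_add_gaussianReal_of_indepFun h1 ih (hlaw i), Finset.sum_insert hi,
      add_zero, add_comm (v i)]

namespace BrownianMotion

variable {Ω : Type*} [mΩ : MeasurableSpace Ω] {P : Measure Ω} {N : ℕ}
  (B : BrownianMotion P N)

lemma measurable (s : ℝ≥0) : Measurable (B.W s) := (B.stronglyMeasurable s).measurable

lemma measurable_coord (s : ℝ≥0) (i : Fin N) : Measurable fun ω => B.W s ω i :=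
  (EuclideanSpace.proj (𝕜 := ℝ) i).continuous.measurable.comp (B.measurable s)

lemma measurable_filtration {s t : ℝ≥0} (h : s ≤ t) : Measurable[B.filtration t] (B.W s) :=
  ((Filtration.stronglyAdapted_natural B.stronglyMeasurable s).mono
    (B.filtration.mono h)).measurable

lemma measurable_inner_increment (s t : ℝ≥0) (u : EuclideanSpace ℝ (Fin N)) :
    Measurable fun ω => inner ℝ u (B.W t ω - B.W s ω) :=
  (by fun_prop : Measurable fun x => inner ℝ u x).comp ((B.measurable t).sub (B.measurable s))

variable [IsProbabilityMeasure P]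

/-- Increments after time `s` are independent of the past. -/
lemma indep_increment {s t : ℝ≥0} (hst : s ≤ t) :
    Indep (B.filtration s)
      (MeasurableSpace.comap (fun ω => B.W t ω - B.W s ω) inferInstance) P := by
  -- The pairs (past, increment) are independent across coordinates, and the two entries are
  -- independent within each coordinate. Together this makes the vector increment independent of the
  -- vector past.
  have h1 : iIndepFun (fun (i : Fin N) ω =>
      ((fun u : Iic s => B.W u ω i), B.W t ω i - B.W s ω i)) P :=
    B.indep.comp (fun _ x => ((fun u : Iic s => x u), x t - x s)) fun _ => by fun_prop
  have h2 (i : Fin N) : IndepFun (fun ω (u : Iic s) => B.W u ω i)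
      (fun ω => B.W t ω i - B.W s ω i) P := by
    have h := (B.isBrownian i).toIsPreBrownianReal.indepFun_shift s
    have hev : Measurable fun x : ℝ≥0 → ℝ => x (t - s) := measurable_pi_apply (t - s)
    have h' := h.symm.comp (φ := id) measurable_id hev
    simpa [Function.comp_def, add_tsub_cancel_of_le hst] using h'
  have hm (i : Fin N) (u : ℝ≥0) := B.measurable_coord u i
  have h3 := indepFun_pi_of_iIndepFun_prod
    (X := fun i ω (u : Iic s) => B.W u ω i) (Y := fun i ω => B.W t ω i - B.W s ω i)
    (fun i => measurable_pi_lambda _ fun u => hm i u) (fun i => (hm i t).sub (hm i s)) h1 h2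
  have h4 := h3.comp (φ := fun x (u : Iic s) => WithLp.toLp 2 fun i => x i u)
    (ψ := fun y => WithLp.toLp 2 y)
    (measurable_pi_lambda _ fun u => (WithLp.measurable_toLp 2 _).comp (by fun_prop))
    (WithLp.measurable_toLp 2 _)
  rw [filtration, Filtration.natural_eq_comap]
  exact h4

lemma indep_inner_increment {s t : ℝ≥0} (hst : s ≤ t) (u : EuclideanSpace ℝ (Fin N)) :
    Indep (B.filtration s)
      (MeasurableSpace.comap (fun ω => inner ℝ u (B.W t ω - B.W s ω)) inferInstance) P := by
  refine indep_of_indep_of_le_right (B.indep_increment hst) ?_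
  have : (fun ω => inner ℝ u (B.W t ω - B.W s ω)) =
      (fun x => inner ℝ u x) ∘ fun ω => B.W t ω - B.W s ω := rfl
  rw [this, ← MeasurableSpace.comap_comp]
  exact MeasurableSpace.comap_mono (Measurable.comap_le (by fun_prop))

lemma map_inner_increment {s t : ℝ≥0} (hst : s ≤ t) (u : EuclideanSpace ℝ (Fin N)) :
    P.map (fun ω => inner ℝ u (B.W t ω - B.W s ω)) =
      gaussianReal 0 (‖u‖₊ ^ 2 * (t - s)) := by
  have hm (i : Fin N) (u : ℝ≥0) := B.measurable_coord u i
  have h1 : iIndepFun (fun (i : Fin N) ω => u i * (B.W t ω i - B.W s ω i)) P :=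
    B.indep.comp (fun i x => u i * (x t - x s)) fun _ => by fun_prop
  have h2 (i : Fin N) : P.map (fun ω => u i * (B.W t ω i - B.W s ω i)) =
      gaussianReal 0 (‖u i‖₊ ^ 2 * (t - s)) := by
    have h := gaussianReal_const_mul
      ((B.isBrownian i).toIsPreBrownianReal.hasLaw_sub t s) (u i)
    refine h.map_eq.trans ?_
    rw [mul_zero]
    congr 1
    ext
    simp only [NNReal.coe_mul, NNReal.coe_mk, NNReal.coe_pow, coe_nnnorm, Real.norm_eq_abs, sq_abs,
      coe_nndist, NNReal.coe_sub hst, Real.dist_eq]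
    congr 1
    exact abs_of_nonneg (sub_nonneg.2 (by exact_mod_cast hst))
  have h3 := map_sum_gaussianReal (X := fun i ω => u i * (B.W t ω i - B.W s ω i))
    (fun i => ((hm i t).sub (hm i s)).const_mul (u i)) h1 h2
    Finset.univ
  have e : (fun ω => inner ℝ u (B.W t ω - B.W s ω)) =
      fun ω => ∑ i, u i * (B.W t ω i - B.W s ω i) := by
    ext ω
    simp [PiLp.inner_apply, mul_comm]
  rw [e, h3, ← Finset.sum_mul]
  congr 2
  ext
  simp [EuclideanSpace.norm_sq_eq]

lemma integrable_comp_increment {s t : ℝ≥0} (hst : s ≤ t) (u : EuclideanSpace ℝ (Fin N))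
    {g : ℝ → ℝ} (hg : ExpGrowth g) (hm : Measurable g) :
    Integrable (fun ω => g (inner ℝ u (B.W t ω - B.W s ω))) P := by
  have h := hg.integrable hm 0 (‖u‖₊ ^ 2 * (t - s))
  rw [← B.map_inner_increment hst u] at h
  exact h.comp_measurable (B.measurable_inner_increment s t u)

lemma integral_comp_increment {s t : ℝ≥0} (hst : s ≤ t) (u : EuclideanSpace ℝ (Fin N))
    {g : ℝ → ℝ} (hm : Measurable g) :
    ∫ ω, g (inner ℝ u (B.W t ω - B.W s ω)) ∂P =
      ∫ w, g w ∂gaussianReal 0 (‖u‖₊ ^ 2 * (t - s)) := by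
  rw [← B.map_inner_increment hst u, integral_map
    (B.measurable_inner_increment s t u).aemeasurable hm.aestronglyMeasurable]

lemma integral_exp_inner_increment {s t : ℝ≥0} (hst : s ≤ t) (u : EuclideanSpace ℝ (Fin N)) :
    ∫ ω, Real.exp (inner ℝ u (B.W t ω - B.W s ω)) ∂P =
      Real.exp (‖u‖ ^ 2 * (t - s) / 2) := by
  rw [B.integral_comp_increment hst u Real.measurable_exp]
  have := integral_exp_mul_gaussianReal 0 1 (‖u‖₊ ^ 2 * (t - s)) fun _ => 1
  simpa [NNReal.coe_sub hst] using this

/-- The Girsanov shift for a single increment. -/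
lemma integral_exp_mul_increment {s t : ℝ≥0} (hst : s ≤ t) (l u : EuclideanSpace ℝ (Fin N)) :
    ∫ ω, Real.exp (-inner ℝ l (B.W t ω - B.W s ω)) *
      (inner ℝ u (B.W t ω - B.W s ω) + inner ℝ u l * (t - s)) ∂P = 0 := by
  set D : Ω → EuclideanSpace ℝ (Fin N) := fun ω => B.W t ω - B.W s ω with hD
  set f : Ω → ℝ := fun ω => -inner ℝ l (D ω) with hf
  set X : Ω → ℝ := fun ω => inner ℝ u (D ω) with hX
  have hexp (v : EuclideanSpace ℝ (Fin N)) :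
      Integrable (fun ω => Real.exp (inner ℝ v (D ω))) P := by
    simpa using B.integrable_comp_increment hst v (expGrowth_exp 1) (by fun_prop)
  have hfi : Integrable (fun ω => Real.exp (f ω)) P := by
    simpa [hf, inner_neg_left] using hexp (-l)
  have hprob := isProbabilityMeasure_tilted hfi
  have hsum (a : ℝ) (ω : Ω) : Real.exp (f ω) * Real.exp (a * X ω) =
      Real.exp (inner ℝ (a • u - l) (D ω)) := by
    rw [← Real.exp_add]
    congr 1
    simp only [hf, hX, inner_sub_left, real_inner_smul_left]
    ring
  have hset : integrableExpSet X (P.tilted f) = univ := by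
    refine eq_univ_of_forall fun a => ?_
    change Integrable _ _
    rw [integrable_tilted_iff hfi]
    simp only [smul_eq_mul, hsum]
    exact hexp _
  have hZ : ∫ ω, Real.exp (f ω) ∂P = Real.exp (‖l‖ ^ 2 * (t - s) / 2) := by
    have := B.integral_exp_inner_increment hst (-l)
    simpa [hf, inner_neg_left] using this
  -- Under the law tilted by exp(-l·D), u·D is Gaussian with mean -(u·l)(t - s). That mean is read
  -- off as the derivative at 0 of the moment generating function.
  have hmgf : mgf X (P.tilted f) = fun a : ℝ =>
      Real.exp ((a ^ 2 * ‖u‖ ^ 2 - 2 * a * inner ℝ u l) * (t - s) / 2) := by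
    ext a
    rw [mgf, integral_tilted]
    simp only [smul_eq_mul, div_mul_eq_mul_div, hsum]
    rw [integral_div, hZ, B.integral_exp_inner_increment hst, ← Real.exp_sub]
    congr 1
    rw [norm_sub_sq_real, norm_smul, real_inner_smul_left, mul_pow, Real.norm_eq_abs, sq_abs]
    ring
  have hder := deriv_mgf_zero (X := X) (μ := P.tilted f) (by rw [hset]; simp)
  have hd : HasDerivAt (fun a : ℝ =>
      Real.exp ((a ^ 2 * ‖u‖ ^ 2 - 2 * a * inner ℝ u l) * (t - s) / 2))
      (-(inner ℝ u l * (t - s))) 0 := by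
    have h1 : HasDerivAt (fun a : ℝ => (a ^ 2 * ‖u‖ ^ 2 - 2 * a * inner ℝ u l) * (t - s) / 2)
        (-(inner ℝ u l * (t - s))) 0 := by
      have := (((((hasDerivAt_pow 2 (0 : ℝ)).mul_const (‖u‖ ^ 2)).sub
        (((hasDerivAt_id (0 : ℝ)).const_mul 2).mul_const (inner ℝ u l))).mul_const
          ((t : ℝ) - s)).div_const 2)
      refine this.congr_deriv ?_
      simp
      ring
    simpa using h1.exp
  rw [hmgf, hd.deriv, integral_tilted] at hder
  simp only [smul_eq_mul, div_mul_eq_mul_div] at hder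
  rw [integral_div, hZ, eq_div_iff (Real.exp_pos _).ne'] at hder
  have hXi : Integrable (fun ω => Real.exp (f ω) * X ω) P := by
    have h0 : (0 : ℝ) ∈ interior (integrableExpSet X (P.tilted f)) := by rw [hset]; simp
    have := integrable_pow_of_mem_interior_integrableExpSet h0 1
    rw [integrable_tilted_iff hfi] at this
    simpa using this
  simp only [mul_add]
  rw [integral_add hXi (hfi.mul_const _), integral_mul_const, hZ, ← hder]
  ring

end BrownianMotion


/-! ### The budget equation -/

lemma sq_lintegral_mul_le {α : Type*} [MeasurableSpace α] (μ : Measure α) {f g : α → ℝ≥0∞}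
    (hf : AEMeasurable f μ) (hg : AEMeasurable g μ) :
    (∫⁻ a, f a * g a ∂μ) ^ 2 ≤ (∫⁻ a, f a ^ 2 ∂μ) * ∫⁻ a, g a ^ 2 ∂μ := by
  have h := ENNReal.lintegral_mul_le_Lp_mul_Lq μ Real.HolderConjugate.two_two hf hg
  have h2 := pow_le_pow_left₀ (zero_le) h 2
  refine h2.trans (le_of_eq ?_)
  have e (x : ℝ≥0∞) : (x ^ (1 / 2 : ℝ)) ^ 2 = x := by
    rw [← ENNReal.rpow_natCast, ← ENNReal.rpow_mul]
    norm_num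
  rw [mul_pow, e, e]
  simp

lemma sq_lintegral_le {α : Type*} [MeasurableSpace α] (μ : Measure α) {f : α → ℝ≥0∞}
    (hf : AEMeasurable f μ) : (∫⁻ a, f a ∂μ) ^ 2 ≤ μ univ * ∫⁻ a, f a ^ 2 ∂μ := by
  have h := sq_lintegral_mul_le μ hf (aemeasurable_const (b := (1 : ℝ≥0∞)))
  simpa [mul_comm] using h

/-- The pairing with a fixed square integrable function is continuous for convergence in mean
square. -/
lemma integral_mul_eq_zero_of_tendsto {Ω : Type*} [MeasurableSpace Ω] {P : Measure Ω}
    {H Y : Ω → ℝ} {Z : ℕ → Ω → ℝ} (hH : MemLp H 2 P) (hY : AEStronglyMeasurable Y P)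
    (hZ : ∀ k, AEStronglyMeasurable (Z k) P) (hi : ∀ k, Integrable (fun ω => H ω * Z k ω) P)
    (h0 : ∀ k, ∫ ω, H ω * Z k ω ∂P = 0)
    (hlim : Tendsto (fun k => ∫⁻ ω, ‖Z k ω - Y ω‖ₑ ^ 2 ∂P) atTop (𝓝 0)) :
    Integrable (fun ω => H ω * Y ω) P ∧ ∫ ω, H ω * Y ω ∂P = 0 := by
  have hHsq : ∫⁻ ω, ‖H ω‖ₑ ^ 2 ∂P ≠ ∞ := by
    have := lintegral_rpow_enorm_lt_top_of_eLpNorm_lt_top two_ne_zero ENNReal.ofNat_ne_top hH.2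
    simpa using this.ne
  have hbound (k : ℕ) : (∫⁻ ω, ‖H ω * (Z k ω - Y ω)‖ₑ ∂P) ^ 2 ≤
      (∫⁻ ω, ‖H ω‖ₑ ^ 2 ∂P) * ∫⁻ ω, ‖Z k ω - Y ω‖ₑ ^ 2 ∂P := by
    simp only [enorm_mul]
    exact sq_lintegral_mul_le P hH.1.enorm ((hZ k).sub hY).enorm
  -- The mean square distance may be infinite for small k, so integrability is available only for
  -- large k; a single such k yields integrability of the limit.
  have hdi : ∀ᶠ k in atTop, Integrable (fun ω => H ω * (Z k ω - Y ω)) P := by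
    filter_upwards [hlim.eventually (gt_mem_nhds ENNReal.zero_lt_top)] with k hk
    refine ⟨hH.1.mul ((hZ k).sub hY), ?_⟩
    have := (hbound k).trans_lt (ENNReal.mul_lt_top hHsq.lt_top hk)
    by_contra hcon
    rw [HasFiniteIntegral, not_lt_top_iff] at hcon
    rw [hcon] at this
    simp at this
  have hYi : Integrable (fun ω => H ω * Y ω) P := by
    obtain ⟨k, hk⟩ := hdi.exists
    refine ((hi k).sub hk).congr (ae_of_all _ fun ω => ?_)
    simp only [Pi.sub_apply]
    ring
  refine ⟨hYi, ?_⟩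
  have hle (k : ℕ) : ‖∫ ω, H ω * Y ω ∂P‖ₑ ^ 2 ≤
      (∫⁻ ω, ‖H ω‖ₑ ^ 2 ∂P) * ∫⁻ ω, ‖Z k ω - Y ω‖ₑ ^ 2 ∂P := by
    refine le_trans ?_ (hbound k)
    have e : ∫ ω, H ω * (Z k ω - Y ω) ∂P = -∫ ω, H ω * Y ω ∂P := by
      simp only [mul_sub]
      rw [integral_sub (hi k) hYi, h0 k, zero_sub]
    rw [← enorm_neg, ← e]
    exact pow_le_pow_left₀ (zero_le) (enorm_integral_le_lintegral_enorm _) 2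
  have hz : Tendsto (fun k => (∫⁻ ω, ‖H ω‖ₑ ^ 2 ∂P) * ∫⁻ ω, ‖Z k ω - Y ω‖ₑ ^ 2 ∂P) atTop
      (𝓝 0) := by
    simpa using ENNReal.Tendsto.const_mul hlim (Or.inr hHsq)
  have := ge_of_tendsto' hz hle
  simpa using this

lemma ENNReal_add_sq_le (a b : ℝ≥0∞) : (a + b) ^ 2 ≤ 4 * (a ^ 2 + b ^ 2) := by
  have h : (a + b) ^ 2 ≤ (2 * max a b) ^ 2 := by
    refine pow_le_pow_left₀ zero_le ?_ 2
    rw [two_mul]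
    exact add_le_add (le_max_left _ _) (le_max_right _ _)
  refine h.trans ?_
  rw [mul_pow, show (2 : ℝ≥0∞) ^ 2 = 4 by norm_num]
  gcongr
  rcases le_total a b with hab | hab
  · rw [max_eq_right hab]; exact le_add_self
  · rw [max_eq_left hab]; exact le_self_add

lemma tendsto_lintegral_enorm_sq_add {Ω : Type*} [MeasurableSpace Ω] {P : Measure Ω}
    {a b : ℕ → Ω → ℝ} {D M Y : Ω → ℝ} (ha : ∀ k, AEMeasurable (a k) P) (hD : AEMeasurable D P)
    (h1 : Tendsto (fun k => ∫⁻ ω, ‖a k ω - D ω‖ₑ ^ 2 ∂P) atTop (𝓝 0))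
    (h2 : Tendsto (fun k => ∫⁻ ω, ‖b k ω - M ω‖ₑ ^ 2 ∂P) atTop (𝓝 0))
    (hY : Y =ᵐ[P] fun ω => D ω + M ω) :
    Tendsto (fun k => ∫⁻ ω, ‖a k ω + b k ω - Y ω‖ₑ ^ 2 ∂P) atTop (𝓝 0) := by
  have hsum := ENNReal.Tendsto.const_mul (a := 4) (h1.add h2) (Or.inr ENNReal.ofNat_ne_top)
  rw [add_zero, mul_zero] at hsum
  refine tendsto_of_tendsto_of_tendsto_of_le_of_le tendsto_const_nhds hsum (fun _ => zero_le)
    fun k => ?_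
  have hm1 : AEMeasurable (fun ω => ‖a k ω - D ω‖ₑ ^ 2) P :=
    ((ha k).sub hD).enorm.pow_const 2
  change _ ≤ 4 * (∫⁻ ω, ‖a k ω - D ω‖ₑ ^ 2 ∂P + ∫⁻ ω, ‖b k ω - M ω‖ₑ ^ 2 ∂P)
  rw [← lintegral_add_left' hm1, ← lintegral_const_mul' _ _ ENNReal.ofNat_ne_top]
  refine lintegral_mono_ae ?_
  filter_upwards [hY] with ω hω
  rw [hω, show a k ω + b k ω - (D ω + M ω) = (a k ω - D ω) + (b k ω - M ω) by ring]
  exact (pow_le_pow_left₀ (zero_le) (enorm_add_le _ _) 2).trans (ENNReal_add_sq_le _ _)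

/-- The time integral of the inner product of a simple process with a fixed vector. -/
noncomputable def SimpleProcess.drift {Ω : Type*} [mΩ : MeasurableSpace Ω]
    {ℱ : Filtration ℝ≥0 mΩ} {N : ℕ} {t T : ℝ≥0} (ψ : SimpleProcess ℱ N t T)
    (l : EuclideanSpace ℝ (Fin N)) (s : ℝ≥0) (ω : Ω) : ℝ :=
  ∑ i ∈ Finset.range ψ.n,
    inner ℝ (ψ.ξ i ω) l * ((min (ψ.τ (i + 1)) s : ℝ≥0) - (min (ψ.τ i) s : ℝ≥0) : ℝ)

namespace SimpleProcess

variable {Ω : Type*} [mΩ : MeasurableSpace Ω] {ℱ : Filtration ℝ≥0 mΩ} {N : ℕ} {t T : ℝ≥0}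
  (ψ : SimpleProcess ℱ N t T)

lemma le_τ (i : ℕ) : t ≤ ψ.τ i := by
  exact ψ.τ_zero.symm.le.trans (ψ.τ_mono (Nat.zero_le i))

lemma τ_le {i : ℕ} (hi : i ≤ ψ.n) : ψ.τ i ≤ T := by
  exact (ψ.τ_mono hi).trans ψ.τ_last.le

/-- Negative times cause no discrepancy: they are sent to 0, which no interval (τ i, τ (i + 1)] with
τ i ≥ 0 contains. -/
lemma value_toNNReal (v : ℝ) (ω : Ω) : ψ.value v.toNNReal ω =
    ∑ i ∈ Finset.range ψ.n, (Ioc (ψ.τ i : ℝ) (ψ.τ (i + 1))).indicator (fun _ => ψ.ξ i ω) v := by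
  refine Finset.sum_congr rfl fun i _ => ?_
  simp only [indicator, mem_Ioc, Real.lt_toNNReal_iff_coe_lt, Real.toNNReal_le_iff_le_coe]

lemma integrable_value (ω : Ω) : Integrable (fun v : ℝ => ψ.value v.toNNReal ω) := by
  simp only [value_toNNReal]
  refine integrable_finsetSum _ fun i _ => ?_
  exact (integrable_indicator_iff measurableSet_Ioc).2 (integrableOn_const (by simp))

lemma integral_inner_value (l : EuclideanSpace ℝ (Fin N)) {s : ℝ≥0} (hs : s ∈ Icc t T) (ω : Ω) :
    ∫ v in (t : ℝ)..s, inner ℝ (ψ.value v.toNNReal ω) l = ψ.drift l s ω := by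
  have hts : (t : ℝ) ≤ s := by exact_mod_cast hs.1
  rw [intervalIntegral.integral_of_le hts]
  simp only [value_toNNReal, sum_inner]
  rw [integral_finsetSum]
  · refine Finset.sum_congr rfl fun i _ => ?_
    have e : (fun v : ℝ => inner ℝ ((Ioc (ψ.τ i : ℝ) (ψ.τ (i + 1))).indicator
        (fun _ => ψ.ξ i ω) v) l) =
        (Ioc (ψ.τ i : ℝ) (ψ.τ (i + 1))).indicator (fun _ => inner ℝ (ψ.ξ i ω) l) := by
      ext v
      by_cases hv : v ∈ Ioc (ψ.τ i : ℝ) (ψ.τ (i + 1)) <;> simp [hv]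
    rw [e, integral_indicator measurableSet_Ioc, Measure.restrict_restrict measurableSet_Ioc,
      setIntegral_const, Ioc_inter_Ioc, Real.volume_real_Ioc, smul_eq_mul, mul_comm]
    congr 1
    have h1 : (t : ℝ) ≤ ψ.τ i := by exact_mod_cast ψ.le_τ i
    have h2 : (ψ.τ i : ℝ) ≤ ψ.τ (i + 1) := by exact_mod_cast ψ.τ_mono (Nat.le_succ i)
    push_cast
    rw [max_eq_left h1]
    rcases le_total (ψ.τ i : ℝ) s with h | h
    · rw [min_eq_left h, max_eq_left (sub_nonneg.2 (le_min h2 h))]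
    · rw [min_eq_right (h.trans h2), min_eq_right h, sub_self, max_eq_right (sub_nonpos.2 h)]
  · intro i _
    refine Integrable.inner_const ?_ l
    exact ((integrable_indicator_iff measurableSet_Ioc).2 (integrableOn_const (by simp))).restrict

lemma measurable_ξ {i : ℕ} (hi : i < ψ.n) : Measurable (ψ.ξ i) :=
  ((ψ.ξ_meas i hi).mono (ℱ.le _)).measurable

lemma measurable_drift (l : EuclideanSpace ℝ (Fin N)) (s : ℝ≥0) : Measurable (ψ.drift l s) := by
  refine Finset.measurable_fun_sum _ fun i hi => Measurable.mul_const ?_ _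
  exact (ψ.measurable_ξ (Finset.mem_range.1 hi)).inner_const

lemma measurable_integral {W : ℝ≥0 → Ω → EuclideanSpace ℝ (Fin N)} (hW : ∀ s, Measurable (W s))
    (s : ℝ≥0) : Measurable (ψ.integral W s) := by
  refine Finset.measurable_fun_sum _ fun i hi => ?_
  exact (ψ.measurable_ξ (Finset.mem_range.1 hi)).inner ((hW _).sub (hW _))

/-- Convergence of the drifts of approximating simple processes. -/
lemma tendsto_drift {P : Measure Ω} [IsProbabilityMeasure P]
    {φ : ℝ≥0 → Ω → EuclideanSpace ℝ (Fin N)}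
    (hφ : Measurable fun p : ℝ × Ω => φ (min p.1.toNNReal T) p.2)
    (hfin : ∫⁻ ω, (∫⁻ s in Icc (t : ℝ) T, ‖φ s.toNNReal ω‖ₑ ^ 2) ∂P < ∞)
    {ψ : ℕ → SimpleProcess ℱ N t T}
    (hconv : Tendsto (fun k => ∫⁻ ω, (∫⁻ s in Icc (t : ℝ) T,
      ‖(ψ k).value s.toNNReal ω - φ s.toNNReal ω‖ₑ ^ 2) ∂P) atTop (𝓝 0))
    (l : EuclideanSpace ℝ (Fin N)) {s : ℝ≥0} (hs : s ∈ Icc t T) :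
    Tendsto (fun k => ∫⁻ ω, ‖(ψ k).drift l s ω -
      ∫ v in (t : ℝ)..s, inner ℝ (φ v.toNNReal ω) l‖ₑ ^ 2 ∂P) atTop (𝓝 0) := by
  -- Progressivity gives joint measurability only up to T, so φ is truncated at time T; on [t, T]
  -- the truncation is invisible.
  have hmin {v : ℝ} (hv : v ∈ Icc (t : ℝ) T) : min v.toNNReal T = v.toNNReal :=
    min_eq_left (Real.toNNReal_le_iff_le_coe.2 hv.2)
  have hφω (ω : Ω) : AEMeasurable (fun v : ℝ => φ v.toNNReal ω)
      (volume.restrict (Icc (t : ℝ) T)) := by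
    refine AEMeasurable.congr
      (hφ.comp (measurable_id.prodMk measurable_const : Measurable fun v : ℝ => (v, ω))).aemeasurable
      ?_
    filter_upwards [ae_restrict_mem measurableSet_Icc] with v hv
    simp [hmin hv]
  have hae : ∀ᵐ ω ∂P, ∫⁻ s in Icc (t : ℝ) T, ‖φ s.toNNReal ω‖ₑ ^ 2 < ∞ := by
    have e (ω : Ω) : ∫⁻ s in Icc (t : ℝ) T, ‖φ s.toNNReal ω‖ₑ ^ 2 =
        ∫⁻ s in Icc (t : ℝ) T, ‖φ (min s.toNNReal T) ω‖ₑ ^ 2 :=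
      setLIntegral_congr_fun measurableSet_Icc fun v hv => by simp only [hmin hv]
    refine ae_lt_top' ?_ hfin.ne
    simp only [e]
    exact (Measurable.lintegral_prod_left' (f := fun p : ℝ × Ω => ‖φ (min p.1.toNNReal T) p.2‖ₑ ^ 2)
      (hφ.enorm.pow_const 2)).aemeasurable
  have hIoc : Ioc (t : ℝ) s ⊆ Icc (t : ℝ) T := fun v hv =>
    ⟨hv.1.le, hv.2.trans (by exact_mod_cast hs.2)⟩
  have hts : (t : ℝ) ≤ s := by exact_mod_cast hs.1
  -- The factor |l|² comes from Cauchy–Schwarz for the inner product, T - t from Cauchy–Schwarz in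
  -- time.
  set C : ℝ≥0∞ := ‖l‖ₑ ^ 2 * ENNReal.ofReal (T - t) with hC
  have hle (k : ℕ) : ∫⁻ ω, ‖(ψ k).drift l s ω -
      ∫ v in (t : ℝ)..s, inner ℝ (φ v.toNNReal ω) l‖ₑ ^ 2 ∂P ≤
      C * ∫⁻ ω, (∫⁻ s in Icc (t : ℝ) T,
      ‖(ψ k).value s.toNNReal ω - φ s.toNNReal ω‖ₑ ^ 2) ∂P := by
    rw [← lintegral_const_mul' _ _ (by simp [hC, ENNReal.mul_eq_top])]
    refine lintegral_mono_ae ?_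
    filter_upwards [hae] with ω hω
    have hφi : IntegrableOn (fun v : ℝ => φ v.toNNReal ω) (Icc (t : ℝ) T) := by
      have : MemLp (fun v : ℝ => φ v.toNNReal ω) 2 (volume.restrict (Icc (t : ℝ) T)) := by
        refine ⟨(hφω ω).aestronglyMeasurable, ?_⟩
        rw [eLpNorm_lt_top_iff_lintegral_rpow_enorm_lt_top two_ne_zero ENNReal.ofNat_ne_top]
        simpa using hω
      exact this.integrable one_le_two
    rw [← (ψ k).integral_inner_value l hs, intervalIntegral.integral_of_le hts,
      intervalIntegral.integral_of_le hts, ← integral_sub]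
    · have hm : AEMeasurable (fun v : ℝ => ‖(ψ k).value v.toNNReal ω - φ v.toNNReal ω‖ₑ)
          (volume.restrict (Icc (t : ℝ) T)) :=
        (((ψ k).integrable_value ω).restrict.aestronglyMeasurable.sub
          (hφω ω).aestronglyMeasurable).enorm
      calc ‖∫ v in Ioc (t : ℝ) s, (inner ℝ ((ψ k).value v.toNNReal ω) l -
            inner ℝ (φ v.toNNReal ω) l)‖ₑ ^ 2
          ≤ (∫⁻ v in Icc (t : ℝ) T, ‖l‖ₑ * ‖(ψ k).value v.toNNReal ω - φ v.toNNReal ω‖ₑ) ^ 2 := by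
            refine pow_le_pow_left₀ (zero_le) ((enorm_integral_le_lintegral_enorm _).trans
              ((lintegral_mono fun v => ?_).trans (lintegral_mono_set hIoc))) 2
            rw [← inner_sub_left, mul_comm]
            simp only [← ofReal_norm]
            rw [← ENNReal.ofReal_mul (norm_nonneg _)]
            exact ENNReal.ofReal_le_ofReal (norm_inner_le_norm _ _)
        _ = ‖l‖ₑ ^ 2 * (∫⁻ v in Icc (t : ℝ) T,
              ‖(ψ k).value v.toNNReal ω - φ v.toNNReal ω‖ₑ) ^ 2 := by
            rw [lintegral_const_mul' _ _ enorm_ne_top, mul_pow]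
        _ ≤ ‖l‖ₑ ^ 2 * (volume.restrict (Icc (t : ℝ) T) univ * ∫⁻ v in Icc (t : ℝ) T,
              ‖(ψ k).value v.toNNReal ω - φ v.toNNReal ω‖ₑ ^ 2) := by
            gcongr
            exact sq_lintegral_le _ hm
        _ = _ := by
            rw [hC, Measure.restrict_apply_univ, Real.volume_Icc, mul_assoc]
    · exact (((ψ k).integrable_value ω).inner_const l).restrict
    · exact Integrable.inner_const (hφi.mono_set hIoc) l
  have hz : Tendsto (fun k => C * ∫⁻ ω, (∫⁻ s in Icc (t : ℝ) T,
      ‖(ψ k).value s.toNNReal ω - φ s.toNNReal ω‖ₑ ^ 2) ∂P) atTop (𝓝 0) := by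
    simpa using ENNReal.Tendsto.const_mul hconv (Or.inr (by simp [hC, ENNReal.mul_eq_top]))
  exact tendsto_of_tendsto_of_tendsto_of_le_of_le tendsto_const_nhds hz (fun _ => zero_le) hle

end SimpleProcess

namespace BrownianMotion

variable {Ω : Type*} [mΩ : MeasurableSpace Ω] {P : Measure Ω} [IsProbabilityMeasure P] {N : ℕ}
  (B : BrownianMotion P N)

lemma indepFun_increment {a b : ℝ≥0} (hab : a ≤ b) {A : Ω → ℝ} (hA : Measurable[B.filtration a] A)
    {g : EuclideanSpace ℝ (Fin N) → ℝ} (hg : Measurable g) :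
    IndepFun A (fun ω => g (B.W b ω - B.W a ω)) P := by
  have h : IndepFun A (fun ω => B.W b ω - B.W a ω) P :=
    indep_of_indep_of_le_left (B.indep_increment hab) hA.comap_le
  exact h.comp measurable_id hg

/-- Independent increments factor the expectation into past, present step and future, and the
present factor has mean zero. This is one summand of the budget equation. -/
lemma integral_mul_increment_mul_increment {a b c : ℝ≥0} (hab : a ≤ b) (hbc : b ≤ c)
    {A : Ω → ℝ} (hA : Measurable[B.filtration a] A) (hAi : Integrable A P)
    {g h : EuclideanSpace ℝ (Fin N) → ℝ} (hg : Measurable g) (hh : Measurable h)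
    (hgi : Integrable (fun ω => g (B.W b ω - B.W a ω)) P)
    (hhi : Integrable (fun ω => h (B.W c ω - B.W b ω)) P)
    (hg0 : ∫ ω, g (B.W b ω - B.W a ω) ∂P = 0) :
    Integrable (fun ω => A ω * g (B.W b ω - B.W a ω) * h (B.W c ω - B.W b ω)) P ∧
      ∫ ω, A ω * g (B.W b ω - B.W a ω) * h (B.W c ω - B.W b ω) ∂P = 0 := by
  have h1 := B.indepFun_increment hab hA hg
  have hAg : Measurable[B.filtration b] fun ω => A ω * g (B.W b ω - B.W a ω) :=
    (hA.mono (B.filtration.mono hab) le_rfl).mul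
      (hg.comp ((B.measurable_filtration le_rfl).sub (B.measurable_filtration hab)))
  have h2 := B.indepFun_increment hbc hAg hh
  have h3 : Integrable (fun ω => A ω * g (B.W b ω - B.W a ω)) P := h1.integrable_mul hAi hgi
  refine ⟨h2.integrable_mul h3 hhi, ?_⟩
  rw [h2.integral_fun_mul_eq_mul_integral h3.1 hhi.1,
    h1.integral_fun_mul_eq_mul_integral hAi.1 hgi.1, hg0, mul_zero, zero_mul]

lemma integrable_exp_neg_inner {s t : ℝ≥0} (hst : s ≤ t) (l : EuclideanSpace ℝ (Fin N)) :
    Integrable (fun ω => Real.exp (-inner ℝ l (B.W t ω - B.W s ω))) P := by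
  simpa using B.integrable_comp_increment hst l (expGrowth_exp (-1)) (by fun_prop)

lemma memLp_exp_neg_inner {s t : ℝ≥0} (hst : s ≤ t) (l : EuclideanSpace ℝ (Fin N)) :
    MemLp (fun ω => Real.exp (-inner ℝ l (B.W t ω - B.W s ω))) 2 P := by
  refine (memLp_two_iff_integrable_sq (B.integrable_exp_neg_inner hst l).1).2 ?_
  have := B.integrable_comp_increment hst l (expGrowth_exp (-2)) (by fun_prop)
  refine this.congr (ae_of_all _ fun ω => ?_)
  simp only [← Real.exp_nat_mul]
  congr 1
  push_cast
  ring

/-- The budget equation for simple strategies: under the state price density each drifted increment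
is centred given the past. -/
lemma integral_exp_mul_gain {t T : ℝ≥0} (l : EuclideanSpace ℝ (Fin N))
    (ψ : SimpleProcess B.filtration N t T) :
    Integrable (fun ω => Real.exp (-inner ℝ l (B.W T ω - B.W t ω)) *
      (ψ.drift l T ω + ψ.integral B.W T ω)) P ∧
    ∫ ω, Real.exp (-inner ℝ l (B.W T ω - B.W t ω)) *
      (ψ.drift l T ω + ψ.integral B.W T ω) ∂P = 0 := by
  -- g is the tilted drifted increment of one coordinate over a step of length d. Passing to
  -- coordinates separates the random vector ξ i from the increment.
  set g : ℝ → Fin N → EuclideanSpace ℝ (Fin N) → ℝ := fun d j x =>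
    Real.exp (-inner ℝ l x) * (inner ℝ (EuclideanSpace.single j (1 : ℝ)) x +
      inner ℝ (EuclideanSpace.single j (1 : ℝ)) l * d) with hg
  set A : ℕ → Fin N → Ω → ℝ := fun i j ω =>
    Real.exp (-inner ℝ l (B.W (ψ.τ i) ω - B.W t ω)) * ψ.ξ i ω j with hA
  have hsplit (ω : Ω) : Real.exp (-inner ℝ l (B.W T ω - B.W t ω)) *
      (ψ.drift l T ω + ψ.integral B.W T ω) = ∑ i ∈ Finset.range ψ.n, ∑ j, A i j ω *
        g (ψ.τ (i + 1) - ψ.τ i) j (B.W (ψ.τ (i + 1)) ω - B.W (ψ.τ i) ω) *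
        Real.exp (-inner ℝ l (B.W T ω - B.W (ψ.τ (i + 1)) ω)) := by
    rw [SimpleProcess.drift, SimpleProcess.integral, ← Finset.sum_add_distrib, Finset.mul_sum]
    refine Finset.sum_congr rfl fun i hi => ?_
    have hi := Finset.mem_range.1 hi
    rw [min_eq_left (ψ.τ_le hi), min_eq_left (ψ.τ_le hi.le)]
    -- The density factors over [t, τ i], [τ i, τ (i + 1)] and [τ (i + 1), T].
    have e : Real.exp (-inner ℝ l (B.W T ω - B.W t ω)) =
        Real.exp (-inner ℝ l (B.W (ψ.τ i) ω - B.W t ω)) *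
        Real.exp (-inner ℝ l (B.W (ψ.τ (i + 1)) ω - B.W (ψ.τ i) ω)) *
        Real.exp (-inner ℝ l (B.W T ω - B.W (ψ.τ (i + 1)) ω)) := by
      rw [← Real.exp_add, ← Real.exp_add]
      congr 1
      simp only [inner_sub_right]
      ring
    have e1 (y : EuclideanSpace ℝ (Fin N)) : inner ℝ (ψ.ξ i ω) y =
        ∑ j, ψ.ξ i ω j * inner ℝ (EuclideanSpace.single j (1 : ℝ)) y := by
      simp [PiLp.inner_apply, mul_comm]
    rw [e, e1, e1, Finset.sum_mul, ← Finset.sum_add_distrib, Finset.mul_sum]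
    refine Finset.sum_congr rfl fun j _ => ?_
    simp only [hA, hg]
    ring
  have hterm (i : ℕ) (hi : i < ψ.n) (j : Fin N) := by
    have hτ : ψ.τ i ≤ ψ.τ (i + 1) := ψ.τ_mono (Nat.le_succ i)
    refine B.integral_mul_increment_mul_increment hτ (ψ.τ_le hi) (A := A i j)
      (g := g (ψ.τ (i + 1) - ψ.τ i) j) (h := fun x => Real.exp (-inner ℝ l x)) ?_ ?_
      (by fun_prop) (by fun_prop) ?_ (B.integrable_exp_neg_inner (ψ.τ_le hi) l)
      (B.integral_exp_mul_increment hτ l _)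
    · refine Measurable.mul ?_ ?_
      · have h1 := (B.measurable_filtration (le_refl (ψ.τ i))).sub
          (B.measurable_filtration (ψ.le_τ i))
        exact (by fun_prop : Measurable fun x => Real.exp (-inner ℝ l x)).comp h1
      · exact (EuclideanSpace.proj (𝕜 := ℝ) j).continuous.measurable.comp
          (ψ.ξ_meas i hi).measurable
    · obtain ⟨C, hC⟩ := ψ.ξ_bdd i hi
      refine (B.integrable_exp_neg_inner (ψ.le_τ i) l).mul_bdd (c := C) ?_
        (ae_of_all _ fun ω => (PiLp.norm_apply_le _ j).trans (hC ω))
      exact ((EuclideanSpace.proj (𝕜 := ℝ) j).continuous.measurable.comp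
          (ψ.measurable_ξ hi)).aestronglyMeasurable
    · simp only [hg, mul_add]
      refine Integrable.add ?_ ((B.integrable_exp_neg_inner hτ l).mul_const _)
      refine (B.memLp_exp_neg_inner hτ l).integrable_mul (q := 2) ?_
      refine (memLp_two_iff_integrable_sq
        (B.measurable_inner_increment _ _ _).aestronglyMeasurable).2 ?_
      refine B.integrable_comp_increment hτ _ (g := fun x => x ^ 2) ⟨2, 1, by norm_num, by norm_num,
        fun z => ?_⟩ (by fun_prop)
      have h1 := Real.pow_div_factorial_le_exp |z| (abs_nonneg z) 2
      rw [div_le_iff₀ (by positivity)] at h1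
      rw [abs_pow, one_mul]
      simpa [mul_comm] using h1
  simp only [hsplit]
  refine ⟨integrable_finsetSum _ fun i hi => integrable_finsetSum _ fun j _ =>
    (hterm i (Finset.mem_range.1 hi) j).1, ?_⟩
  rw [integral_finsetSum _ fun i hi => integrable_finsetSum _ fun j _ =>
    (hterm i (Finset.mem_range.1 hi) j).1]
  refine Finset.sum_eq_zero fun i hi => ?_
  rw [integral_finsetSum _ fun j _ => (hterm i (Finset.mem_range.1 hi) j).1]
  exact Finset.sum_eq_zero fun j _ => (hterm i (Finset.mem_range.1 hi) j).2

end BrownianMotion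

lemma measurable_min_of_isStronglyProgressive {Ω E : Type*} [mΩ : MeasurableSpace Ω]
    [NormedAddCommGroup E] [MeasurableSpace E] [BorelSpace E]
    {ℱ : Filtration ℝ≥0 mΩ} {π : ℝ≥0 → Ω → E} (h : IsStronglyProgressive ℱ π) (T : ℝ≥0) :
    Measurable fun p : ℝ × Ω => π (min p.1.toNNReal T) p.2 := by
  have h1 := (h T).measurable
  have h2 : Measurable[_, Subtype.instMeasurableSpace.prod (ℱ T)] fun p : ℝ × Ω =>
      ((⟨min p.1.toNNReal T, mem_Iic.2 (min_le_right _ _)⟩ : Iic T), p.2) := by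
    refine Measurable.prodMk ?_ ?_
    · exact Measurable.subtype_mk (by fun_prop)
    · exact measurable_snd.mono le_rfl (ℱ.le T) |>.comp measurable_id
  exact h1.comp h2

namespace Market

variable {N : ℕ} (m : Market N)

/-- The exposure as a continuous linear map. -/
noncomputable def exposureCLM : EuclideanSpace ℝ (Fin N) →L[ℝ] EuclideanSpace ℝ (Fin N) :=
  Matrix.toEuclideanCLM (𝕜 := ℝ) m.σ

lemma exposureCLM_apply (p : EuclideanSpace ℝ (Fin N)) : m.exposureCLM p = m.exposure p := rfl

lemma continuous_exposure : Continuous m.exposure := m.exposureCLM.continuous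

lemma enorm_exposure_le (p : EuclideanSpace ℝ (Fin N)) :
    ‖m.exposure p‖ₑ ≤ ‖m.exposureCLM‖ₑ * ‖p‖ₑ := by
  rw [← exposureCLM_apply]
  exact m.exposureCLM.le_opENorm p

end Market

lemma measurable_integral_inner {Ω : Type*} [MeasurableSpace Ω] {N : ℕ} {t T : ℝ≥0}
    {φ : ℝ≥0 → Ω → EuclideanSpace ℝ (Fin N)}
    (hφ : Measurable fun p : ℝ × Ω => φ (min p.1.toNNReal T) p.2) {s : ℝ≥0} (hs : s ∈ Icc t T)
    (l : EuclideanSpace ℝ (Fin N)) :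
    Measurable fun ω => ∫ v in (t : ℝ)..s, inner ℝ (φ v.toNNReal ω) l := by
  have hts : (t : ℝ) ≤ s := by exact_mod_cast hs.1
  have e : (fun ω => ∫ v in (t : ℝ)..s, inner ℝ (φ v.toNNReal ω) l) = fun ω =>
      ∫ v in Ioc (t : ℝ) s, inner ℝ (φ (min v.toNNReal T) ω) l := by
    ext ω
    rw [intervalIntegral.integral_of_le hts]
    refine setIntegral_congr_fun measurableSet_Ioc fun v hv => ?_
    simp only [min_eq_left ((Real.toNNReal_le_iff_le_coe.2 hv.2).trans hs.2)]
  rw [e]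
  have h2 : StronglyMeasurable fun p : Ω × ℝ => inner ℝ (φ (min p.2.toNNReal T) p.1) l :=
    ((hφ.comp measurable_swap).inner_const).stronglyMeasurable
  exact h2.integral_prod_right.measurable

lemma Market.lintegral_exposure_lt_top {Ω : Type*} [MeasurableSpace Ω] {P : Measure Ω} {N : ℕ}
    (m : Market N) {t T : ℝ≥0} {π : ℝ≥0 → Ω → EuclideanSpace ℝ (Fin N)}
    (h : ∫⁻ ω, (∫⁻ s in Icc (t : ℝ) T, ‖π s.toNNReal ω‖ₑ ^ 2) ∂P < ∞) :
    ∫⁻ ω, (∫⁻ s in Icc (t : ℝ) T, ‖m.exposure (π s.toNNReal ω)‖ₑ ^ 2) ∂P < ∞ := by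
  have hne : ‖m.exposureCLM‖ₑ ^ 2 ≠ ∞ := ENNReal.pow_ne_top enorm_ne_top
  calc ∫⁻ ω, (∫⁻ s in Icc (t : ℝ) T, ‖m.exposure (π s.toNNReal ω)‖ₑ ^ 2) ∂P
      ≤ ∫⁻ ω, (∫⁻ s in Icc (t : ℝ) T, ‖m.exposureCLM‖ₑ ^ 2 * ‖π s.toNNReal ω‖ₑ ^ 2) ∂P := by
        refine lintegral_mono fun ω => lintegral_mono fun s => ?_
        rw [← mul_pow]
        exact pow_le_pow_left₀ (zero_le) (m.enorm_exposure_le _) 2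
    _ = ‖m.exposureCLM‖ₑ ^ 2 * ∫⁻ ω, (∫⁻ s in Icc (t : ℝ) T, ‖π s.toNNReal ω‖ₑ ^ 2) ∂P := by
        simp only [lintegral_const_mul' _ _ hne]
    _ < ∞ := ENNReal.mul_lt_top hne.lt_top h

/-- Discounted by the state price density, the gains of an admissible strategy have zero mean. -/
lemma IsAdmissible.integral_exp_mul_gain {Ω : Type*} [MeasurableSpace Ω] {P : Measure Ω}
    [IsProbabilityMeasure P] {N : ℕ} {B : BrownianMotion P N} {m : Market N} {t T : ℝ≥0} {x : ℝ}
    {π : ℝ≥0 → Ω → EuclideanSpace ℝ (Fin N)} {X : ℝ≥0 → Ω → ℝ} (hX : IsAdmissible B m t T x π X)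
    (htT : t ≤ T) :
    Integrable (fun ω => Real.exp (-inner ℝ m.priceOfRisk (B.W T ω - B.W t ω)) * (X T ω - x)) P ∧
    ∫ ω, Real.exp (-inner ℝ m.priceOfRisk (B.W T ω - B.W t ω)) * (X T ω - x) ∂P = 0 := by
  obtain ⟨M, hM, heq⟩ := hX.wealth.equation
  obtain ⟨ψ, hψ, hψM⟩ := hM.approx
  have hT : T ∈ Icc t T := ⟨htT, le_rfl⟩
  have hφm : Measurable fun p : ℝ × Ω => m.exposure (π (min p.1.toNNReal T) p.2) :=
    m.continuous_exposure.measurable.comp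
      (measurable_min_of_isStronglyProgressive hX.progressive T)
  have hfin := m.lintegral_exposure_lt_top hX.square_integrable
  have hdrift := SimpleProcess.tendsto_drift (φ := fun s ω => m.exposure (π s ω)) hφm hfin hψ
    m.priceOfRisk hT
  have hDm := measurable_integral_inner (φ := fun s ω => m.exposure (π s ω)) hφm hT m.priceOfRisk
  have hMm := (hM.memLp T hT).1
  have hY : (fun ω => X T ω - x) =ᵐ[P] fun ω =>
      (∫ v in (t : ℝ)..T, inner ℝ (m.exposure (π v.toNNReal ω)) m.priceOfRisk) + M T ω := by
    filter_upwards [heq T hT] with ω hω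
    rw [hω]
    ring
  have hYm : AEStronglyMeasurable (fun ω => X T ω - x) P :=
    (hDm.aestronglyMeasurable.add hMm).congr hY.symm
  have hZm (k : ℕ) : Measurable fun ω =>
      (ψ k).drift m.priceOfRisk T ω + (ψ k).integral B.W T ω :=
    ((ψ k).measurable_drift _ _).add ((ψ k).measurable_integral B.measurable T)
  -- The gain X_T - x is the mean square limit of gains of simple processes, and the density is
  -- square integrable, so the zero mean survives the limit.
  refine integral_mul_eq_zero_of_tendsto (B.memLp_exp_neg_inner htT m.priceOfRisk) hYm
    (fun k => (hZm k).aestronglyMeasurable) (fun k => (B.integral_exp_mul_gain _ (ψ k)).1)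
    (fun k => (B.integral_exp_mul_gain _ (ψ k)).2) ?_
  exact tendsto_lintegral_enorm_sq_add (fun k => ((ψ k).measurable_drift _ _).aemeasurable)
    hDm.aemeasurable hdrift (hψM T hT) hY


/-! ### One-step estimates for the Itô expansion -/

/-- N(η, η) is the law of a drifted increment. It is N(0, η) tilted by e^w with normalisation
e^{η/2} ≥ 1, so its moments are bounded by centred ones at rate c + 1. -/
lemma exists_shifted_gaussian_moment_le (V : ℝ≥0) (p : ℕ) {c : ℝ} (hc : 0 ≤ c) :
    ∃ C : ℝ, 0 ≤ C ∧ ∀ η ≤ V,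
      ∫ y, |y| ^ p * Real.exp (c * |y|) ∂gaussianReal η η ≤ C * √(η : ℝ) ^ p := by
  obtain ⟨C, hC, h⟩ := exists_gaussian_moment_le V p (add_nonneg hc zero_le_one)
  refine ⟨C, hC, fun η hη => le_trans ?_ (h η hη)⟩
  have e := integral_exp_mul_gaussianReal 0 1 η fun y => |y| ^ p * Real.exp (c * |y|)
  simp only [one_mul, mul_zero, zero_add, one_pow] at e
  have e' : ∫ y, |y| ^ p * Real.exp (c * |y|) ∂gaussianReal η η ≤
      Real.exp (η / 2) * ∫ y, |y| ^ p * Real.exp (c * |y|) ∂gaussianReal η η :=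
    le_mul_of_one_le_left (integral_nonneg fun y => by positivity)
      (Real.one_le_exp (by positivity))
  refine e'.trans (e.symm.le.trans ?_)
  refine integral_mono_of_nonneg (ae_of_all _ fun w => by positivity)
    (integrable_pow_mul_exp_mul_abs _ _ _ _) (ae_of_all _ fun w => ?_)
  change Real.exp w * (|w| ^ p * Real.exp (c * |w|)) ≤ |w| ^ p * Real.exp ((c + 1) * |w|)
  have : Real.exp w ≤ Real.exp |w| := Real.exp_le_exp.2 (le_abs_self w)
  calc Real.exp w * (|w| ^ p * Real.exp (c * |w|))
      ≤ Real.exp |w| * (|w| ^ p * Real.exp (c * |w|)) := by gcongr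
    _ = _ := by rw [add_mul, one_mul, Real.exp_add]; ring

lemma abs_integral_le_of_abs_le {μ : Measure ℝ} {g b : ℝ → ℝ} (hb : Integrable b μ)
    (h : ∀ w, |g w| ≤ b w) : |∫ w, g w ∂μ| ≤ ∫ w, b w ∂μ :=
  norm_integral_le_of_norm_le (f := g) hb (ae_of_all _ h)

lemma integral_sub_sub_mul {μ : Measure ℝ} [IsProbabilityMeasure μ] {g : ℝ → ℝ} (a b : ℝ)
    (hg : Integrable g μ) (hi : Integrable (fun w => w) μ) :
    ∫ w, (g w - a - b * w) ∂μ = ∫ w, g w ∂μ - a - b * ∫ w, w ∂μ := by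
  rw [integral_sub (f := fun w => g w - a) (g := fun w => b * w) (hg.sub (integrable_const _))
    (hi.const_mul _), integral_sub hg (integrable_const _), integral_const_mul]
  simp

lemma integral_add_add_add {μ : Measure ℝ} {f₁ f₂ f₃ f₄ : ℝ → ℝ} (h₁ : Integrable f₁ μ)
    (h₂ : Integrable f₂ μ) (h₃ : Integrable f₃ μ) (h₄ : Integrable f₄ μ) :
    ∫ w, (f₁ w + f₂ w + f₃ w + f₄ w) ∂μ =
      ∫ w, f₁ w ∂μ + ∫ w, f₂ w ∂μ + ∫ w, f₃ w ∂μ + ∫ w, f₄ w ∂μ := by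
  rw [integral_add (f := fun w => f₁ w + f₂ w + f₃ w) (g := f₄) ((h₁.add h₂).add h₃) h₄,
    integral_add (f := fun w => f₁ w + f₂ w) (g := f₃) (h₁.add h₂) h₃, integral_add h₁ h₂]

namespace ExpSmooth

variable {f f₁ f₂ : ℝ → ℝ} {K c : ℝ}

/-- Regularity of Gaussian averages in the variance. -/
lemma exists_abs_gaussAvg_add_sub_le (h : ExpSmooth f f₁ f₂ K c) (V : ℝ≥0) :
    ∃ C : ℝ, 0 ≤ C ∧ ∀ v η : ℝ≥0, v + η ≤ V → ∀ z,
      |Merton.gaussAvg f (v + η) z - Merton.gaussAvg f v z| ≤ C * η * Real.exp (c * |z|) ∧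
      |Merton.gaussAvg f₁ (v + η) z - Merton.gaussAvg f₁ v z| ≤ C * √(η : ℝ) * Real.exp (c * |z|) := by
  obtain ⟨K', h'⟩ := h.gaussAvg_le V
  obtain ⟨C₁, hC₁, h₁⟩ := exists_gaussian_moment_le V 1 h.c_nonneg
  obtain ⟨C₂, hC₂, h₂⟩ := exists_gaussian_moment_le V 2 h.c_nonneg
  have hK' := (h' 0 zero_le).K_nonneg
  refine ⟨K' * C₁ + K' * C₂, by positivity, fun v η hv z => ?_⟩
  have hs := h' v (le_self_add.trans hv)
  have hη : η ≤ V := le_add_self.trans hv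
  have e0 : 0 ≤ K' * C₁ := by positivity
  have e0' : 0 ≤ K' * C₂ := by positivity
  have i0 : Integrable (fun w => Merton.gaussAvg f v (z + w)) (gaussianReal 0 η) :=
    (hs.growth.comp_const_add z).integrable (hs.continuous.measurable.comp (by fun_prop)) _ _
  have i1 : Integrable (fun w => Merton.gaussAvg f₁ v (z + w)) (gaussianReal 0 η) :=
    (hs.growth_one.comp_const_add z).integrable
      (hs.continuous_one.measurable.comp (by fun_prop)) _ _
  have iid : Integrable (fun w : ℝ => w) (gaussianReal 0 η) :=
    (memLp_id_gaussianReal 1).integrable (by simp)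
  constructor
  · rw [← gaussAvg_gaussAvg h.growth h.continuous.measurable v η z]
    -- The linear Taylor term has zero mean and may be subtracted freely; this improves the order
    -- from √η to η.
    have e : Merton.gaussAvg (Merton.gaussAvg f v) η z - Merton.gaussAvg f v z =
        ∫ w, (Merton.gaussAvg f v (z + w) - Merton.gaussAvg f v z -
          Merton.gaussAvg f₁ v z * w) ∂gaussianReal 0 η := by
      rw [integral_sub_sub_mul _ _ i0 iid, integral_id_gaussianReal]
      simp [Merton.gaussAvg]
    rw [e]
    refine (abs_integral_le_of_abs_le (b := fun w => K' * Real.exp (c * |z|) *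
      (|w| ^ 2 * Real.exp (c * |w|))) ((integrable_pow_mul_exp_mul_abs _ _ _ _).const_mul _)
      fun w => ?_).trans ?_
    · refine (abs_taylor_le hs.K_nonneg hs.c_nonneg hs.deriv_one hs.deriv_two hs.bound_two z
        w).trans (le_of_eq ?_)
      rw [sq_abs]; ring
    · rw [integral_const_mul]
      calc _ ≤ K' * Real.exp (c * |z|) * (C₂ * √(η : ℝ) ^ 2) := by gcongr; exact h₂ η hη
        _ = K' * C₂ * η * Real.exp (c * |z|) := by rw [Real.sq_sqrt η.coe_nonneg]; ring
        _ ≤ _ := by gcongr; linarith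
  · rw [← gaussAvg_gaussAvg h.growth_one h.continuous_one.measurable v η z]
    have e : Merton.gaussAvg (Merton.gaussAvg f₁ v) η z - Merton.gaussAvg f₁ v z =
        ∫ w, (Merton.gaussAvg f₁ v (z + w) - Merton.gaussAvg f₁ v z) ∂gaussianReal 0 η := by
      rw [integral_sub i1 (integrable_const _)]
      simp [Merton.gaussAvg]
    rw [e]
    refine (abs_integral_le_of_abs_le (b := fun w => K' * Real.exp (c * |z|) *
      (|w| ^ 1 * Real.exp (c * |w|))) ((integrable_pow_mul_exp_mul_abs _ _ _ _).const_mul _)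
      fun w => ?_).trans ?_
    · refine (abs_sub_le_of_hasDerivAt hs.K_nonneg hs.c_nonneg hs.deriv_two hs.bound_two z
        w).trans (le_of_eq ?_)
      ring
    · rw [integral_const_mul]
      calc _ ≤ K' * Real.exp (c * |z|) * (C₁ * √(η : ℝ) ^ 1) := by gcongr; exact h₁ η hη
        _ = K' * C₁ * √(η : ℝ) * Real.exp (c * |z|) := by ring
        _ ≤ _ := by gcongr; linarith

/-- Pointwise bound for the Itô remainder over one step. -/
lemma exists_abs_remainder_le (h : ExpSmooth f f₁ f₂ K c) (V : ℝ≥0) :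
    ∃ C : ℝ, 0 ≤ C ∧ ∀ v η : ℝ≥0, v + η ≤ V → ∀ z y,
      |Merton.gaussAvg f v (z + y) - Merton.gaussAvg f (v + η) z -
        Merton.gaussAvg f₁ (v + η) z * y| ≤
      C * Real.exp (c * |z|) * ((η + y ^ 2) * Real.exp (c * |y|)) := by
  obtain ⟨K', h'⟩ := h.gaussAvg_le V
  obtain ⟨C, hC, hv⟩ := h.exists_abs_gaussAvg_add_sub_le V
  have hK' := (h' 0 zero_le).K_nonneg
  refine ⟨K' + 2 * C, by positivity, fun v η hvη z y => ?_⟩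
  have hs := h' v (le_self_add.trans hvη)
  have t1 := abs_taylor_le hs.K_nonneg hs.c_nonneg hs.deriv_one hs.deriv_two hs.bound_two z y
  obtain ⟨t2, t3⟩ := hv v η hvη z
  have hE : 1 ≤ Real.exp (c * |y|) := Real.one_le_exp (mul_nonneg h.c_nonneg (abs_nonneg y))
  have hz := Real.exp_pos (c * |z|)
  -- The variance change moves f₁ by order √η; multiplied by |y|, this is absorbed into the
  -- second-order quantity η + y².
  have hq : √(η : ℝ) * |y| ≤ η + y ^ 2 := by
    have := Real.sq_sqrt η.coe_nonneg
    nlinarith [sq_nonneg (√(η : ℝ) - |y|), sq_abs y, sq_nonneg y, η.coe_nonneg]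
  have t3' : |(Merton.gaussAvg f₁ (v + η) z - Merton.gaussAvg f₁ v z) * y| ≤
      C * Real.exp (c * |z|) * (η + y ^ 2) := by
    rw [abs_mul]
    calc _ ≤ C * √(η : ℝ) * Real.exp (c * |z|) * |y| := by gcongr
      _ = C * Real.exp (c * |z|) * (√(η : ℝ) * |y|) := by ring
      _ ≤ _ := by gcongr
  have hηy : (0 : ℝ) ≤ η + y ^ 2 := by positivity
  have e : Merton.gaussAvg f v (z + y) - Merton.gaussAvg f (v + η) z -
        Merton.gaussAvg f₁ (v + η) z * y =
      (Merton.gaussAvg f v (z + y) - Merton.gaussAvg f v z - Merton.gaussAvg f₁ v z * y) -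
      (Merton.gaussAvg f (v + η) z - Merton.gaussAvg f v z) -
      (Merton.gaussAvg f₁ (v + η) z - Merton.gaussAvg f₁ v z) * y := by ring
  rw [e]
  refine (abs_sub _ _).trans ((add_le_add ((abs_sub _ _).trans (add_le_add t1 t2)) t3').trans ?_)
  have b1 : K' * y ^ 2 * Real.exp (c * |z|) * Real.exp (c * |y|) ≤
      K' * Real.exp (c * |z|) * ((η + y ^ 2) * Real.exp (c * |y|)) := by
    calc _ = K' * Real.exp (c * |z|) * (y ^ 2 * Real.exp (c * |y|)) := by ring
      _ ≤ _ := by gcongr; linarith [η.coe_nonneg]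
  have b2 : C * η * Real.exp (c * |z|) ≤
      C * Real.exp (c * |z|) * ((η + y ^ 2) * Real.exp (c * |y|)) := by
    calc _ = C * Real.exp (c * |z|) * (η * 1) := by ring
      _ ≤ _ := by gcongr; nlinarith [sq_nonneg y]
  have b3 : C * Real.exp (c * |z|) * (η + y ^ 2) ≤
      C * Real.exp (c * |z|) * ((η + y ^ 2) * Real.exp (c * |y|)) := by
    gcongr
    exact le_mul_of_one_le_right hηy hE
  linarith

/-- The Itô remainder has a small mean. -/
lemma exists_abs_integral_remainder_le (h : ExpSmooth f f₁ f₂ K c) (V : ℝ≥0) :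
    ∃ C : ℝ, 0 ≤ C ∧ ∀ v η : ℝ≥0, v + η ≤ V → ∀ z,
      |∫ y, (Merton.gaussAvg f v (z + y) - Merton.gaussAvg f (v + η) z -
        Merton.gaussAvg f₁ (v + η) z * y) ∂gaussianReal η η| ≤
      C * Real.exp (c * |z|) * (η * √(η : ℝ)) := by
  obtain ⟨C, hC, hr⟩ := h.exists_abs_remainder_le V
  have hc1 : 0 ≤ c + 1 := by linarith [h.c_nonneg]
  obtain ⟨C₀, hC₀, m₀⟩ := exists_gaussian_moment_le V 0 hc1
  obtain ⟨C₁, hC₁, m₁⟩ := exists_gaussian_moment_le V 1 hc1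
  obtain ⟨C₂, hC₂, m₂⟩ := exists_gaussian_moment_le V 2 hc1
  obtain ⟨C₃, hC₃, m₃⟩ := exists_gaussian_moment_le V 3 hc1
  set D : ℝ := Real.exp V * (C₁ + C₃ + √(V : ℝ) * C₀ + √(V : ℝ) * C₂) with hD
  refine ⟨C * D, by positivity, fun v η hvη z => ?_⟩
  have hη : η ≤ V := le_add_self.trans hvη
  obtain ⟨K', h'⟩ := h.gaussAvg v
  set p : ℝ → ℝ := fun y => Merton.gaussAvg f v (z + y) - Merton.gaussAvg f (v + η) z -
    Merton.gaussAvg f₁ (v + η) z * y with hp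
  have i0 (m : ℝ) : Integrable (fun w => Merton.gaussAvg f v (z + w)) (gaussianReal m η) :=
    (h'.growth.comp_const_add z).integrable (h'.continuous.measurable.comp (by fun_prop)) _ _
  have iid (m : ℝ) : Integrable (fun w : ℝ => w) (gaussianReal m η) :=
    (memLp_id_gaussianReal 1).integrable (by simp)
  have ip : Integrable p (gaussianReal 0 η) :=
    ((i0 0).sub (integrable_const _)).sub ((iid 0).const_mul _)
  -- Under the centred law the remainder has mean exactly zero, by the semigroup property.
  have hp0 : ∫ y, p y ∂gaussianReal 0 η = 0 := by
    simp only [hp]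
    rw [integral_sub_sub_mul _ _ (i0 0) (iid 0), integral_id_gaussianReal,
      ← gaussAvg_gaussAvg h.growth h.continuous.measurable v η z]
    simp [Merton.gaussAvg]
  have hpm : Measurable p :=
    ((h'.continuous.measurable.comp (by fun_prop)).sub measurable_const).sub (by fun_prop)
  have hpg : ExpGrowth p := by
    refine ⟨C * Real.exp (c * |z|) * (V + 2), c + 1, by positivity, hc1, fun y =>
      (hr v η hvη z y).trans ?_⟩
    have h1 := Real.pow_div_factorial_le_exp |y| (abs_nonneg y) 2
    rw [div_le_iff₀ (by positivity), sq_abs] at h1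
    have h2 : (1 : ℝ) ≤ Real.exp |y| := Real.one_le_exp (abs_nonneg y)
    have h3 : (η : ℝ) ≤ V := by exact_mod_cast hη
    have h4 : (η : ℝ) + y ^ 2 ≤ (V + 2) * Real.exp |y| := by
      norm_num at h1
      nlinarith [V.coe_nonneg]
    calc _ ≤ C * Real.exp (c * |z|) * (((V + 2) * Real.exp |y|) * Real.exp (c * |y|)) := by gcongr
      _ = _ := by rw [add_mul c, one_mul, Real.exp_add]; ring
  have e := integral_exp_mul_gaussianReal 0 1 η p
  simp only [one_mul, mul_zero, zero_add, one_pow] at e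
  have ip2 : Integrable (fun y => Real.exp y * p y) (gaussianReal 0 η) := by
    simpa using ((expGrowth_exp 1).mul hpg).integrable (by fun_prop) 0 η
  -- The density of N(η, η) with respect to N(0, η) is e^{y - η/2}. Since p is centred, 1 may be
  -- subtracted from it, and the small factor gains the extra √η.
  have key : ∫ y, p y ∂gaussianReal η η =
      ∫ y, (Real.exp (-(η / 2)) * Real.exp y - 1) * p y ∂gaussianReal 0 η := by
    have e2 : ∀ y, (Real.exp (-(η / 2)) * Real.exp y - 1) * p y =
        Real.exp (-(η / 2)) * (Real.exp y * p y) - p y := fun y => by ring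
    simp only [e2]
    rw [integral_sub (ip2.const_mul _) ip, integral_const_mul, e, hp0, sub_zero, ← mul_assoc,
      ← Real.exp_add]
    simp
  rw [key]
  have hb (y : ℝ) : |(Real.exp (-(η / 2)) * Real.exp y - 1) * p y| ≤
      C * Real.exp (c * |z|) * (Real.exp V * (η * (|y| ^ 1 * Real.exp ((c + 1) * |y|)) +
        (|y| ^ 3 * Real.exp ((c + 1) * |y|)) + η * √(η : ℝ) * (√(V : ℝ) * (|y| ^ 0 * Real.exp ((c + 1) * |y|))) +
        √(η : ℝ) * (√(V : ℝ) * (|y| ^ 2 * Real.exp ((c + 1) * |y|))))) := by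
    have hηV : (η : ℝ) ≤ V := by exact_mod_cast hη
    -- Trades a surplus power of √η for √V, so that every term has the common order η^{3/2}.
    have hηs : (η : ℝ) ≤ √(η : ℝ) * √(V : ℝ) := by
      calc (η : ℝ) = √(η : ℝ) * √(η : ℝ) := (Real.mul_self_sqrt η.coe_nonneg).symm
        _ ≤ _ := by gcongr
    have h1 : |Real.exp (-(η / 2)) * Real.exp y - 1| ≤
        (|y| + η) * (Real.exp V * Real.exp |y|) := by
      rw [← Real.exp_add, ← Real.exp_add]
      have ha : |-(η / 2) + y| ≤ |y| + η := by
        rw [abs_le]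
        constructor <;> linarith [neg_abs_le y, le_abs_self y, η.coe_nonneg]
      have hb : |Real.exp (-(η / 2) + y) - 1| ≤
          |-(η / 2) + y| * Real.exp |-(η / 2) + y| := by
        have := abs_sub_le_of_hasDerivAt (K := 1) (c := 1) zero_le_one zero_le_one
          Real.hasDerivAt_exp (fun z => by
            rw [abs_of_pos (Real.exp_pos z), one_mul, one_mul]
            exact Real.exp_le_exp.2 (le_abs_self z)) 0 (-(η / 2) + y)
        simpa using this
      refine hb.trans ?_
      gcongr
      linarith
    rw [abs_mul]
    calc _ ≤ ((|y| + η) * (Real.exp V * Real.exp |y|)) *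
          (C * Real.exp (c * |z|) * ((η + y ^ 2) * Real.exp (c * |y|))) := by
          gcongr
          exact hr v η hvη z y
      _ = C * Real.exp (c * |z|) * (Real.exp V * (Real.exp ((c + 1) * |y|) *
          (η * |y| + |y| ^ 3 + η * η + η * |y| ^ 2))) := by
          rw [add_mul c, one_mul, Real.exp_add, ← sq_abs y]; ring
      _ ≤ C * Real.exp (c * |z|) * (Real.exp V * (Real.exp ((c + 1) * |y|) *
          (η * |y| + |y| ^ 3 + η * (√(η : ℝ) * √(V : ℝ)) + √(η : ℝ) * √(V : ℝ) * |y| ^ 2))) := by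
          gcongr
      _ = _ := by ring
  have ii (k : ℕ) : Integrable (fun y : ℝ => |y| ^ k * Real.exp ((c + 1) * |y|))
      (gaussianReal 0 η) := integrable_pow_mul_exp_mul_abs 0 η k (c + 1)
  have j1 := (ii 1).const_mul (η : ℝ)
  have j3 := ((ii 0).const_mul √(V : ℝ)).const_mul (η * √(η : ℝ))
  have j4 := ((ii 2).const_mul √(V : ℝ)).const_mul √(η : ℝ)
  refine (abs_integral_le_of_abs_le ((((((j1.add (ii 3)).add j3).add j4).const_mul
    (Real.exp V)).const_mul (C * Real.exp (c * |z|)))) hb).trans ?_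
  simp only [Pi.add_apply]
  rw [integral_const_mul, integral_const_mul, integral_add_add_add j1 (ii 3) j3 j4]
  simp only [integral_const_mul]
  have hsq : √(η : ℝ) ^ 2 = η := Real.sq_sqrt η.coe_nonneg
  calc _ ≤ C * Real.exp (c * |z|) * (Real.exp V * (η * (C₁ * √(η : ℝ) ^ 1) +
        C₃ * √(η : ℝ) ^ 3 + η * √(η : ℝ) * (√(V : ℝ) * (C₀ * √(η : ℝ) ^ 0)) +
        √(η : ℝ) * (√(V : ℝ) * (C₂ * √(η : ℝ) ^ 2)))) := by
        gcongr
        exacts [m₁ η hη, m₃ η hη, m₀ η hη, m₂ η hη]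
    _ = _ := by
        rw [hD, pow_succ (√(η : ℝ)) 2, hsq]
        ring

end ExpSmooth


/-! ### Mean and mean-square errors of one Euler step -/

lemma lintegral_enorm_sq_le_of_sq_le {α : Type*} [MeasurableSpace α] {μ : Measure α} {g b : α → ℝ}
    (hb : Integrable b μ) (h : ∀ w, g w ^ 2 ≤ b w) :
    ∫⁻ w, ‖g w‖ₑ ^ 2 ∂μ ≤ ENNReal.ofReal (∫ w, b w ∂μ) := by
  rw [ofReal_integral_eq_lintegral_ofReal hb (ae_of_all _ fun w => (sq_nonneg _).trans (h w))]
  refine lintegral_mono fun w => ?_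
  rw [Real.enorm_eq_ofReal_abs, ← ENNReal.ofReal_pow (abs_nonneg _), sq_abs]
  exact ENNReal.ofReal_le_ofReal (h w)

lemma sq_add_three_le (a b d : ℝ) : (a + b + d) ^ 2 ≤ 3 * (a ^ 2 + b ^ 2 + d ^ 2) := by
  nlinarith [sq_nonneg (a - b), sq_nonneg (b - d), sq_nonneg (a - d)]

lemma integral_add_add {μ : Measure ℝ} {f₁ f₂ f₃ : ℝ → ℝ} (h₁ : Integrable f₁ μ)
    (h₂ : Integrable f₂ μ) (h₃ : Integrable f₃ μ) :
    ∫ w, (f₁ w + f₂ w + f₃ w) ∂μ = ∫ w, f₁ w ∂μ + ∫ w, f₂ w ∂μ + ∫ w, f₃ w ∂μ := by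
  rw [integral_add (f := fun w => f₁ w + f₂ w) (g := f₃) (h₁.add h₂) h₃, integral_add h₁ h₂]

namespace ExpSmooth

variable {f f₁ f₂ : ℝ → ℝ} {K c : ℝ}

/-- Mean and mean square of the one-step error when the integrand is replaced by `κ`. -/
lemma exists_step_moments_le (h : ExpSmooth f f₁ f₂ K c) (V : ℝ≥0) :
    ∃ C : ℝ, 0 ≤ C ∧ ∀ v η : ℝ≥0, v + η ≤ V → ∀ ε : ℝ, 0 < ε → ε ≤ 1 → η ≤ V * ε → ∀ z κ,
      |Merton.gaussAvg f₁ (v + η) z - κ| ≤ Merton.gaussAvg f₁ (v + η) z ^ 2 * ε →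
      ∀ d : ℝ → ℝ, (d = fun y =>
        Merton.gaussAvg f v (z + y) - Merton.gaussAvg f (v + η) z - κ * y) →
      Integrable d (gaussianReal η η) ∧ Integrable (fun y => d y ^ 2) (gaussianReal η η) ∧
      (∫ y, d y ∂gaussianReal η η) ^ 2 ≤ C * ε ^ 3 * Real.exp (4 * c * |z|) ∧
      ∫ y, d y ^ 2 ∂gaussianReal η η ≤ C * ε ^ 2 * Real.exp (4 * c * |z|) := by
  obtain ⟨K', h'⟩ := h.gaussAvg_le V
  obtain ⟨C₁, hC₁, hr⟩ := h.exists_abs_remainder_le V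
  obtain ⟨C₂, hC₂, hm⟩ := h.exists_abs_integral_remainder_le V
  have hc2 : 0 ≤ 2 * c := by linarith [h.c_nonneg]
  obtain ⟨D₀, hD₀, m₀⟩ := exists_shifted_gaussian_moment_le V 0 hc2
  obtain ⟨D₂, hD₂, m₂⟩ := exists_shifted_gaussian_moment_le V 2 hc2
  obtain ⟨D₄, hD₄, m₄⟩ := exists_shifted_gaussian_moment_le V 4 hc2
  have hK' := (h' 0 zero_le).K_nonneg
  have hV := V.coe_nonneg
  -- C₁ bounds the Itô remainder and K'² the truncation error |a - κ| ≤ a² ε. The latter carries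
  -- e^{2c|z|}, so squares carry e^{4c|z|}.
  set C₃ := C₁ + K' ^ 2 with hC₃
  have hC₃0 : 0 ≤ C₃ := by positivity
  refine ⟨2 * (C₂ ^ 2 * V ^ 3 + K' ^ 4 * V ^ 2) +
    3 * C₃ ^ 2 * (V ^ 2 * D₀ + V ^ 2 * D₄ + V * D₂), by positivity,
    fun v η hv ε hε0 hε1 hηε z κ hκ d hd => ?_⟩
  have hη : η ≤ V := le_add_self.trans hv
  have hη0 := η.coe_nonneg
  have hs := h' v (le_self_add.trans hv)
  have hs' := h' _ hv
  set a := Merton.gaussAvg f₁ (v + η) z with ha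
  set E := Real.exp (c * |z|) with hE
  have hE1 : 1 ≤ E := Real.one_le_exp (mul_nonneg h.c_nonneg (abs_nonneg z))
  have hE4 : Real.exp (4 * c * |z|) = E ^ 4 := by
    rw [hE, ← Real.exp_nat_mul]; push_cast; ring_nf
  rw [hE4]
  have haK : |a| ≤ K' * E := hs'.bound_one z
  have hκ' : |a - κ| ≤ K' ^ 2 * E ^ 2 * ε := by
    refine hκ.trans ?_
    have : a ^ 2 ≤ (K' * E) ^ 2 := by rw [← sq_abs]; gcongr
    nlinarith
  have hE12 : E ≤ E ^ 2 := by nlinarith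
  have ig : Integrable (fun w => Merton.gaussAvg f v (z + w)) (gaussianReal η η) :=
    (hs.growth.comp_const_add z).integrable (hs.continuous.measurable.comp (by fun_prop)) _ _
  have iid : Integrable (fun w : ℝ => w) (gaussianReal η η) :=
    (memLp_id_gaussianReal 1).integrable (by simp)
  have hdm : Measurable d := by
    rw [hd]
    exact ((hs.continuous.measurable.comp (by fun_prop)).sub measurable_const).sub (by fun_prop)
  have id1 : Integrable d (gaussianReal η η) := by
    rw [hd]; exact (ig.sub (integrable_const _)).sub (iid.const_mul _)
  have hdb (y : ℝ) : d y ^ 2 ≤ 3 * C₃ ^ 2 * E ^ 4 *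
      (η ^ 2 * (|y| ^ 0 * Real.exp (2 * c * |y|)) + |y| ^ 4 * Real.exp (2 * c * |y|) +
        ε ^ 2 * (|y| ^ 2 * Real.exp (2 * c * |y|))) := by
    have e1 : d y = (Merton.gaussAvg f v (z + y) - Merton.gaussAvg f (v + η) z - a * y) +
        (a - κ) * y := by rw [hd]; ring
    have hF1 : 1 ≤ Real.exp (c * |y|) :=
      Real.one_le_exp (mul_nonneg h.c_nonneg (abs_nonneg y))
    have hF2 : Real.exp (2 * c * |y|) = Real.exp (c * |y|) ^ 2 := by
      rw [← Real.exp_nat_mul]; push_cast; ring_nf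
    rw [hF2]
    set F := Real.exp (c * |y|)
    have b1 : |d y| ≤ C₃ * E ^ 2 * F * (η + |y| ^ 2 + ε * |y|) := by
      rw [e1]
      refine (abs_add_le _ _).trans ?_
      rw [abs_mul]
      calc _ ≤ C₁ * E * ((η + y ^ 2) * F) + K' ^ 2 * E ^ 2 * ε * |y| := by
            gcongr; exact hr v η hv z y
        _ ≤ C₁ * E ^ 2 * ((η + y ^ 2) * F) + K' ^ 2 * E ^ 2 * ε * |y| * F := by
            refine add_le_add (by gcongr) (le_mul_of_one_le_right (by positivity) hF1)
        -- Nonnegative cross terms are added so that the sum factors as C₃ times η + |y|² + ε|y|.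
        _ ≤ (C₁ * E ^ 2 * ((η + y ^ 2) * F) + K' ^ 2 * E ^ 2 * ε * |y| * F) +
            (C₁ * E ^ 2 * (ε * |y|) * F + K' ^ 2 * E ^ 2 * (η + y ^ 2) * F) :=
            le_add_of_nonneg_right (by positivity)
        _ = _ := by rw [hC₃, sq_abs]; ring
    calc d y ^ 2 = |d y| ^ 2 := (sq_abs _).symm
      _ ≤ (C₃ * E ^ 2 * F * (η + |y| ^ 2 + ε * |y|)) ^ 2 := by gcongr
      _ = C₃ ^ 2 * E ^ 4 * F ^ 2 * (η + |y| ^ 2 + ε * |y|) ^ 2 := by ring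
      _ ≤ C₃ ^ 2 * E ^ 4 * F ^ 2 * (3 * (η ^ 2 + (|y| ^ 2) ^ 2 + (ε * |y|) ^ 2)) := by
          gcongr; exact sq_add_three_le _ _ _
      _ = _ := by ring
  have ii (k : ℕ) : Integrable (fun y : ℝ => |y| ^ k * Real.exp (2 * c * |y|))
      (gaussianReal η η) := integrable_pow_mul_exp_mul_abs η η k (2 * c)
  have j0 := (ii 0).const_mul ((η : ℝ) ^ 2)
  have j2 := (ii 2).const_mul (ε ^ 2)
  have ib := ((((j0.add (ii 4)).add j2)).const_mul
    (3 * C₃ ^ 2 * E ^ 4))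
  have id2 : Integrable (fun y => d y ^ 2) (gaussianReal η η) :=
    ib.mono' (hdm.pow_const 2).aestronglyMeasurable (ae_of_all _ fun y => by
      rw [Real.norm_of_nonneg (sq_nonneg _)]; exact hdb y)
  have hsq : √(η : ℝ) ^ 2 = η := Real.sq_sqrt hη0
  refine ⟨id1, id2, ?_, ?_⟩
  · have e : ∫ y, d y ∂gaussianReal η η = ∫ y, (Merton.gaussAvg f v (z + y) -
        Merton.gaussAvg f (v + η) z - a * y) ∂gaussianReal η η + (a - κ) * η := by
      rw [hd, integral_sub_sub_mul _ _ ig iid, integral_sub_sub_mul _ _ ig iid,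
        integral_id_gaussianReal]
      ring
    have b := hm v η hv z
    have b2 : |∫ y, d y ∂gaussianReal η η| ≤ E ^ 2 * (C₂ * (η * √(η : ℝ)) + K' ^ 2 * ε * η) := by
      rw [e]
      refine (abs_add_le _ _).trans ?_
      rw [abs_mul, abs_of_nonneg hη0]
      calc _ ≤ C₂ * E * (η * √(η : ℝ)) + K' ^ 2 * E ^ 2 * ε * η := by gcongr
        _ ≤ C₂ * E ^ 2 * (η * √(η : ℝ)) + K' ^ 2 * E ^ 2 * ε * η := by gcongr
        _ = _ := by ring
    calc _ = |∫ y, d y ∂gaussianReal η η| ^ 2 := (sq_abs _).symm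
      _ ≤ (E ^ 2 * (C₂ * (η * √(η : ℝ)) + K' ^ 2 * ε * η)) ^ 2 := by gcongr
      _ = E ^ 4 * (C₂ * (η * √(η : ℝ)) + K' ^ 2 * ε * η) ^ 2 := by ring
      _ ≤ E ^ 4 * (2 * ((C₂ * (η * √(η : ℝ))) ^ 2 + (K' ^ 2 * ε * η) ^ 2)) := by
          gcongr; exact add_sq_le
      _ = E ^ 4 * (2 * (C₂ ^ 2 * η ^ 2 * √(η : ℝ) ^ 2 + K' ^ 4 * ε ^ 2 * η ^ 2)) := by ring
      _ = E ^ 4 * (2 * (C₂ ^ 2 * η ^ 3 + K' ^ 4 * ε ^ 2 * η ^ 2)) := by rw [hsq]; ring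
      _ ≤ E ^ 4 * (2 * (C₂ ^ 2 * (V * ε) ^ 3 + K' ^ 4 * ε ^ 2 * (V * ε) ^ 2)) := by gcongr
      _ = E ^ 4 * (2 * (C₂ ^ 2 * V ^ 3 * ε ^ 3 + K' ^ 4 * V ^ 2 * (ε ^ 3 * ε))) := by ring
      _ ≤ E ^ 4 * (2 * (C₂ ^ 2 * V ^ 3 * ε ^ 3 + K' ^ 4 * V ^ 2 * (ε ^ 3 * 1))) := by gcongr
      _ = (2 * (C₂ ^ 2 * V ^ 3 + K' ^ 4 * V ^ 2)) * ε ^ 3 * E ^ 4 := by ring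
      _ ≤ _ := by gcongr; exact le_add_of_nonneg_right (by positivity)
  · refine (integral_mono id2 ib hdb).trans ?_
    simp only [Pi.add_apply]
    rw [integral_const_mul, integral_add_add j0 (ii 4) j2]
    simp only [integral_const_mul]
    calc _ ≤ 3 * C₃ ^ 2 * E ^ 4 * (η ^ 2 * (D₀ * √(η : ℝ) ^ 0) + D₄ * √(η : ℝ) ^ 4 +
          ε ^ 2 * (D₂ * √(η : ℝ) ^ 2)) := by
          gcongr
          exacts [m₀ η hη, m₄ η hη, m₂ η hη]
      _ = 3 * C₃ ^ 2 * E ^ 4 * (η ^ 2 * D₀ + D₄ * η ^ 2 + ε ^ 2 * (D₂ * η)) := by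
          rw [show √(η : ℝ) ^ 4 = (√(η : ℝ) ^ 2) ^ 2 by ring, hsq, pow_zero, mul_one]
      _ ≤ 3 * C₃ ^ 2 * E ^ 4 * ((V * ε) ^ 2 * D₀ + D₄ * (V * ε) ^ 2 + ε ^ 2 * (D₂ * V)) := by
          have : (η : ℝ) ≤ V := by exact_mod_cast hη
          gcongr
      _ = (3 * C₃ ^ 2 * (V ^ 2 * D₀ + V ^ 2 * D₄ + V * D₂)) * ε ^ 2 * E ^ 4 := by ring
      _ ≤ _ := by gcongr; exact le_add_of_nonneg_left (by positivity)

/-- One step of the recursion for the mean square error of the Euler scheme. -/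
lemma exists_lintegral_step_le (h : ExpSmooth f f₁ f₂ K c) (V : ℝ≥0) :
    ∃ C : ℝ, 0 ≤ C ∧ ∀ v η : ℝ≥0, v + η ≤ V → ∀ ε : ℝ, 0 < ε → ε ≤ 1 → η ≤ V * ε → ∀ z κ,
      |Merton.gaussAvg f₁ (v + η) z - κ| ≤ Merton.gaussAvg f₁ (v + η) z ^ 2 * ε → ∀ s : ℝ,
      ∫⁻ y, ‖s + (Merton.gaussAvg f v (z + y) - Merton.gaussAvg f (v + η) z - κ * y)‖ₑ ^ 2
        ∂gaussianReal η η ≤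
      ENNReal.ofReal ((1 + ε) * s ^ 2 + C * ε ^ 2 * Real.exp (4 * c * |z|)) := by
  obtain ⟨C, hC, hm⟩ := h.exists_step_moments_le V
  refine ⟨2 * C, by positivity, fun v η hv ε hε0 hε1 hηε z κ hκ s => ?_⟩
  obtain ⟨i1, i2, b1, b2⟩ := hm v η hv ε hε0 hε1 hηε z κ hκ _ rfl
  set d : ℝ → ℝ := fun y => Merton.gaussAvg f v (z + y) - Merton.gaussAvg f (v + η) z - κ * y
  have ib : Integrable (fun y => s ^ 2 + 2 * s * d y + d y ^ 2) (gaussianReal η η) :=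
    ((integrable_const _).add (i1.const_mul _)).add i2
  refine (lintegral_enorm_sq_le_of_sq_le ib fun y => le_of_eq (by ring)).trans
    (ENNReal.ofReal_le_ofReal ?_)
  rw [integral_add (f := fun y => s ^ 2 + 2 * s * d y) ((integrable_const _).add
    (i1.const_mul _)) i2, integral_add (integrable_const _) (i1.const_mul _), integral_const_mul]
  simp only [integral_const, probReal_univ, one_smul]
  set m := ∫ y, d y ∂gaussianReal η η
  set E := Real.exp (4 * c * |z|)
  -- Young's inequality 2sm ≤ ε s² + m²/ε with m² = O(ε³). The smaller order of the mean keeps the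
  -- cross term at O(ε²), and the sum over about 1/ε steps then tends to 0.
  have key : 2 * s * m ≤ ε * s ^ 2 + C * ε ^ 2 * E := by
    have h1 : ε * (2 * s * m) ≤ ε * (ε * s ^ 2 + C * ε ^ 2 * E) := by
      nlinarith [sq_nonneg (ε * s - m)]
    exact le_of_mul_le_mul_left h1 hε0
  linarith

/-- The integrand varies little over one step. -/
lemma exists_lintegral_sub_le (h : ExpSmooth f f₁ f₂ K c) (V : ℝ≥0) :
    ∃ C : ℝ, 0 ≤ C ∧ ∀ v η : ℝ≥0, v + η ≤ V → ∀ ε : ℝ, 0 < ε → ε ≤ 1 → η ≤ V * ε → ∀ z κ,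
      |Merton.gaussAvg f₁ (v + η) z - κ| ≤ Merton.gaussAvg f₁ (v + η) z ^ 2 * ε →
      ∫⁻ y, ‖κ - Merton.gaussAvg f₁ v (z + y)‖ₑ ^ 2 ∂gaussianReal η η ≤
      ENNReal.ofReal (C * ε * Real.exp (4 * c * |z|)) := by
  obtain ⟨K', h'⟩ := h.gaussAvg_le V
  obtain ⟨C₁, hC₁, hr⟩ := h.exists_abs_gaussAvg_add_sub_le V
  have hc2 : 0 ≤ 2 * c := by linarith [h.c_nonneg]
  obtain ⟨D₀, hD₀, m₀⟩ := exists_shifted_gaussian_moment_le V 0 hc2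
  obtain ⟨D₂, hD₂, m₂⟩ := exists_shifted_gaussian_moment_le V 2 hc2
  have hK' := (h' 0 zero_le).K_nonneg
  have hV := V.coe_nonneg
  set C₃ := K' ^ 2 + C₁ + K' with hC₃
  have hC₃0 : 0 ≤ C₃ := by positivity
  refine ⟨3 * C₃ ^ 2 * (D₀ + V * D₀ + V * D₂), by positivity,
    fun v η hv ε hε0 hε1 hηε z κ hκ => ?_⟩
  have hη : η ≤ V := le_add_self.trans hv
  have hη0 := η.coe_nonneg
  have hs := h' v (le_self_add.trans hv)
  have hs' := h' _ hv
  set a := Merton.gaussAvg f₁ (v + η) z with ha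
  set E := Real.exp (c * |z|) with hE
  have hE1 : 1 ≤ E := Real.one_le_exp (mul_nonneg h.c_nonneg (abs_nonneg z))
  have hE4 : Real.exp (4 * c * |z|) = E ^ 4 := by
    rw [hE, ← Real.exp_nat_mul]; push_cast; ring_nf
  rw [hE4]
  have haK : |a| ≤ K' * E := hs'.bound_one z
  have hκ' : |a - κ| ≤ K' ^ 2 * E ^ 2 * ε := by
    refine hκ.trans ?_
    have : a ^ 2 ≤ (K' * E) ^ 2 := by rw [← sq_abs]; gcongr
    nlinarith
  have hE12 : E ≤ E ^ 2 := by nlinarith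
  have hsq : √(η : ℝ) ^ 2 = η := Real.sq_sqrt hη0
  have hdb (y : ℝ) : (κ - Merton.gaussAvg f₁ v (z + y)) ^ 2 ≤ 3 * C₃ ^ 2 * E ^ 4 *
      (ε ^ 2 * (|y| ^ 0 * Real.exp (2 * c * |y|)) + η * (|y| ^ 0 * Real.exp (2 * c * |y|)) +
        |y| ^ 2 * Real.exp (2 * c * |y|)) := by
    have e1 : κ - Merton.gaussAvg f₁ v (z + y) = -(a - κ) +
        (a - Merton.gaussAvg f₁ v z) +
        -(Merton.gaussAvg f₁ v (z + y) - Merton.gaussAvg f₁ v z) := by ring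
    have hF1 : 1 ≤ Real.exp (c * |y|) :=
      Real.one_le_exp (mul_nonneg h.c_nonneg (abs_nonneg y))
    have hF2 : Real.exp (2 * c * |y|) = Real.exp (c * |y|) ^ 2 := by
      rw [← Real.exp_nat_mul]; push_cast; ring_nf
    have t := abs_sub_le_of_hasDerivAt hs.K_nonneg hs.c_nonneg hs.deriv_two hs.bound_two z y
    rw [hF2]
    set F := Real.exp (c * |y|)
    have b1 : |κ - Merton.gaussAvg f₁ v (z + y)| ≤ C₃ * E ^ 2 * F * (ε + √(η : ℝ) + |y|) := by
      rw [e1]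
      refine (abs_add_three _ _ _).trans ?_
      rw [abs_neg, abs_neg]
      calc _ ≤ K' ^ 2 * E ^ 2 * ε + C₁ * √(η : ℝ) * E + K' * |y| * E * F := by
            gcongr
            exact (hr v η hv z).2
        _ ≤ K' ^ 2 * E ^ 2 * ε * F + C₁ * √(η : ℝ) * E ^ 2 * F + K' * |y| * E ^ 2 * F := by
            refine add_le_add (add_le_add (le_mul_of_one_le_right (by positivity) hF1) ?_)
              (by gcongr)
            calc _ ≤ C₁ * √(η : ℝ) * E ^ 2 := by gcongr
              _ ≤ _ := le_mul_of_one_le_right (by positivity) hF1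
        _ ≤ (K' ^ 2 * E ^ 2 * ε * F + C₁ * √(η : ℝ) * E ^ 2 * F + K' * |y| * E ^ 2 * F) +
            (K' ^ 2 * E ^ 2 * F * (√(η : ℝ) + |y|) + C₁ * E ^ 2 * F * (ε + |y|) +
              K' * E ^ 2 * F * (ε + √(η : ℝ))) :=
            le_add_of_nonneg_right (by positivity)
        _ = _ := by rw [hC₃]; ring
    calc _ = |κ - Merton.gaussAvg f₁ v (z + y)| ^ 2 := (sq_abs _).symm
      _ ≤ (C₃ * E ^ 2 * F * (ε + √(η : ℝ) + |y|)) ^ 2 := by gcongr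
      _ = C₃ ^ 2 * E ^ 4 * F ^ 2 * (ε + √(η : ℝ) + |y|) ^ 2 := by ring
      _ ≤ C₃ ^ 2 * E ^ 4 * F ^ 2 * (3 * (ε ^ 2 + √(η : ℝ) ^ 2 + |y| ^ 2)) := by
          gcongr; exact sq_add_three_le _ _ _
      _ = _ := by rw [hsq]; ring
  have ii (k : ℕ) : Integrable (fun y : ℝ => |y| ^ k * Real.exp (2 * c * |y|))
      (gaussianReal η η) := integrable_pow_mul_exp_mul_abs η η k (2 * c)
  have j0 := (ii 0).const_mul (ε ^ 2)
  have j1 := (ii 0).const_mul (η : ℝ)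
  have ib := ((((j0.add j1).add (ii 2))).const_mul
    (3 * C₃ ^ 2 * E ^ 4))
  refine (lintegral_enorm_sq_le_of_sq_le ib hdb).trans (ENNReal.ofReal_le_ofReal ?_)
  simp only [Pi.add_apply]
  rw [integral_const_mul, integral_add_add j0 j1 (ii 2)]
  simp only [integral_const_mul]
  calc _ ≤ 3 * C₃ ^ 2 * E ^ 4 * (ε ^ 2 * (D₀ * √(η : ℝ) ^ 0) + η * (D₀ * √(η : ℝ) ^ 0) +
        D₂ * √(η : ℝ) ^ 2) := by
        gcongr
        exacts [m₀ η hη, m₀ η hη, m₂ η hη]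
    _ = 3 * C₃ ^ 2 * E ^ 4 * (ε * ε * D₀ + η * D₀ + D₂ * η) := by
        rw [hsq, pow_zero, mul_one]; ring
    _ ≤ 3 * C₃ ^ 2 * E ^ 4 * (ε * 1 * D₀ + V * ε * D₀ + D₂ * (V * ε)) := by gcongr
    _ = _ := by ring

end ExpSmooth


/-! ### The optimal wealth process -/

/-- The discretisation looks backwards in time, so only values up to i occur. There are countably
many grid times, which gives joint measurability; the minimum with i covers grid times that are
never reached. -/
lemma measurable_floor_div {Ω : Type*} [MeasurableSpace Ω] {i : ℝ≥0} {Y : ℝ≥0 → Ω → ℝ}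
    (hY : ∀ s ≤ i, Measurable (Y s)) (k : ℕ) :
    Measurable fun p : Iic i × Ω => Y (⌊(p.1 : ℝ≥0) * ((k : ℝ≥0) + 1)⌋₊ / ((k : ℝ≥0) + 1)) p.2 := by
  have e : (fun p : Iic i × Ω => Y (⌊(p.1 : ℝ≥0) * ((k : ℝ≥0) + 1)⌋₊ / ((k : ℝ≥0) + 1)) p.2) =
      (fun q : ℕ × Ω => Y (min (q.1 / ((k : ℝ≥0) + 1)) i) q.2) ∘
        fun p : Iic i × Ω => (⌊(p.1 : ℝ≥0) * ((k : ℝ≥0) + 1)⌋₊, p.2) := by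
    funext p
    have hp : (⌊(p.1 : ℝ≥0) * ((k : ℝ≥0) + 1)⌋₊ : ℝ≥0) / ((k : ℝ≥0) + 1) ≤ i := by
      rw [div_le_iff₀ (by positivity)]
      exact (Nat.floor_le zero_le).trans (mul_le_mul_left p.1.2 _)
    simp only [Function.comp, min_eq_left hp]
  rw [e]
  have h : Measurable fun q : ℕ × Ω => Y (min (q.1 / ((k : ℝ≥0) + 1)) i) q.2 :=
    measurable_from_prod_countable_right fun m => hY _ (min_le_right ((m : ℝ≥0) / (k + 1)) i)
  exact h.comp ((Nat.measurable_floor.comp (by fun_prop)).prodMk measurable_snd)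

/-- An adapted process with almost surely continuous paths has a progressive modification. -/
lemma exists_isStronglyProgressive {Ω : Type*} [mΩ : MeasurableSpace Ω] {P : Measure Ω}
    {ℱ : Filtration ℝ≥0 mΩ} {Y : ℝ≥0 → Ω → ℝ} (hY : ∀ s, Measurable[ℱ s] (Y s))
    (hc : ∀ᵐ ω ∂P, Continuous fun s => Y s ω) :
    ∃ Z : ℝ≥0 → Ω → ℝ, IsStronglyProgressive ℱ Z ∧ ∀ᵐ ω ∂P, ∀ s, Z s ω = Y s ω := by
  -- An upper limit is measurable even on the null set of discontinuous paths; on continuous paths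
  -- it is the limit Y s.
  refine ⟨fun s ω => limsup (fun k : ℕ => Y (⌊s * ((k : ℝ≥0) + 1)⌋₊ / ((k : ℝ≥0) + 1)) ω) atTop,
    fun i => ?_, ?_⟩
  · exact Measurable.stronglyMeasurable (Measurable.limsup fun k => @measurable_floor_div Ω (ℱ i) i Y
      (fun s hs => (hY s).mono (ℱ.mono hs) le_rfl) k)
  · filter_upwards [hc] with ω hω s
    have h1 : Tendsto (fun k : ℕ => ((k : ℝ) + 1)) atTop atTop :=
      tendsto_atTop_add_const_right _ _ tendsto_natCast_atTop_atTop
    have h2 := (tendsto_nat_floor_mul_div_atTop (R := ℝ) (a := s) s.coe_nonneg).comp h1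
    have h3 : Tendsto (fun k : ℕ => (⌊s * ((k : ℝ≥0) + 1)⌋₊ : ℝ≥0) / ((k : ℝ≥0) + 1)) atTop
        (𝓝 s) := by
      rw [← NNReal.tendsto_coe]
      refine h2.congr fun k => ?_
      rw [Function.comp_apply]
      have e : ⌊(s : ℝ) * ((k : ℝ) + 1)⌋₊ = ⌊s * ((k : ℝ≥0) + 1)⌋₊ :=
        (Nat.floor_eq_iff (by positivity)).2
          ⟨by exact_mod_cast Nat.floor_le (zero_le (a := s * ((k : ℝ≥0) + 1))),
            by exact_mod_cast Nat.lt_floor_add_one (s * ((k : ℝ≥0) + 1))⟩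
      rw [e]
      push_cast
      rfl
    exact ((hω.tendsto s).comp h3).limsup_eq

namespace BrownianMotion

variable {Ω : Type*} [mΩ : MeasurableSpace Ω] {P : Measure Ω} {N : ℕ} (B : BrownianMotion P N)

/-- The increment over `[s, s']` of `l · W` with drift `|l|²`. -/
noncomputable def driftedIncrement (l : EuclideanSpace ℝ (Fin N)) (s s' : ℝ≥0) (ω : Ω) : ℝ :=
  inner ℝ l (B.W s' ω - B.W s ω) + ‖l‖ ^ 2 * ((s' : ℝ) - s)

/-- The process `l · W` with drift `|l|²`, started from `z` at time `t`. -/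
noncomputable def drifted (l : EuclideanSpace ℝ (Fin N)) (t : ℝ≥0) (z : ℝ) (s : ℝ≥0) (ω : Ω) : ℝ :=
  z + B.driftedIncrement l (min s t) s ω

variable (l : EuclideanSpace ℝ (Fin N)) {t : ℝ≥0} (z : ℝ)

lemma driftedIncrement_self (s : ℝ≥0) (ω : Ω) : B.driftedIncrement l s s ω = 0 := by
  simp [driftedIncrement]

lemma drifted_self (ω : Ω) : B.drifted l t z t ω = z := by
  simp [drifted, driftedIncrement_self]

lemma drifted_eq_add {s s' : ℝ≥0} (hts : t ≤ s) (hss : s ≤ s') (ω : Ω) :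
    B.drifted l t z s' ω = B.drifted l t z s ω + B.driftedIncrement l s s' ω := by
  simp only [drifted, driftedIncrement, min_eq_right hts, min_eq_right (hts.trans hss)]
  rw [← sub_add_sub_cancel (B.W s' ω) (B.W s ω) (B.W t ω), inner_add_right]
  ring

lemma measurable_driftedIncrement (s s' : ℝ≥0) : Measurable (B.driftedIncrement l s s') :=
  (B.measurable_inner_increment s s' l).add_const _

/-- Adaptedness must hold at all times, also before t. The `min s t` in the definition makes the
process equal to z there. -/
lemma measurable_drifted (s : ℝ≥0) : Measurable[B.filtration s] (B.drifted l t z s) := by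
  have h : Measurable fun q : EuclideanSpace ℝ (Fin N) × EuclideanSpace ℝ (Fin N) =>
      z + (inner ℝ l (q.1 - q.2) + ‖l‖ ^ 2 * ((s : ℝ) - (min s t : ℝ≥0))) := by fun_prop
  have h1 : Measurable[B.filtration s] (B.W s) := B.measurable_filtration le_rfl
  have h2 : Measurable[B.filtration s] (B.W (min s t)) := B.measurable_filtration (min_le_left s t)
  have h3 : Measurable[B.filtration s] fun ω => (B.W s ω, B.W (min s t) ω) := h1.prodMk h2
  have e : B.drifted l t z s = (fun q : EuclideanSpace ℝ (Fin N) × EuclideanSpace ℝ (Fin N) =>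
      z + (inner ℝ l (q.1 - q.2) + ‖l‖ ^ 2 * ((s : ℝ) - (min s t : ℝ≥0)))) ∘
        fun ω => (B.W s ω, B.W (min s t) ω) := by
    funext ω
    rw [drifted, driftedIncrement]
    rfl
  rw [e]
  exact h.comp h3

lemma continuous_W : ∀ᵐ ω ∂P, Continuous fun s => B.W s ω := by
  filter_upwards [ae_all_iff.2 fun i => (B.isBrownian i).cont] with ω hω
  exact (PiLp.continuous_toLp 2 _).comp (continuous_pi hω)

lemma continuous_drifted : ∀ᵐ ω ∂P, Continuous fun s => B.drifted l t z s ω := by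
  filter_upwards [B.continuous_W] with ω hω
  unfold drifted driftedIncrement
  have : Continuous fun s => B.W (min s t) ω := hω.comp (by fun_prop)
  fun_prop

variable [IsProbabilityMeasure P]

/-- Mean and variance coincide because the drift rate |l|² is also the variance rate of l·W. -/
lemma map_driftedIncrement {s s' : ℝ≥0} (hss : s ≤ s') :
    P.map (B.driftedIncrement l s s') =
      gaussianReal (‖l‖₊ ^ 2 * (s' - s) : ℝ≥0) (‖l‖₊ ^ 2 * (s' - s)) := by
  have h := gaussianReal_map_add_const (μ := 0) (v := ‖l‖₊ ^ 2 * (s' - s))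
    (‖l‖ ^ 2 * ((s' : ℝ) - s))
  rw [← B.map_inner_increment hss l, Measure.map_map (by fun_prop)
    (B.measurable_inner_increment s s' l), zero_add] at h
  rw [NNReal.coe_mul, NNReal.coe_sub hss, NNReal.coe_pow, coe_nnnorm]
  exact h

lemma lintegral_comp_driftedIncrement {s s' : ℝ≥0} (hss : s ≤ s') {E : Type*} [MeasurableSpace E]
    {ζ : Ω → E} (hζ : Measurable[B.filtration s] ζ) {g : E × ℝ → ℝ≥0∞} (hg : Measurable g) :
    ∫⁻ ω, g (ζ ω, B.driftedIncrement l s s' ω) ∂P =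
      ∫⁻ ω, ∫⁻ y, g (ζ ω, y) ∂gaussianReal (‖l‖₊ ^ 2 * (s' - s) : ℝ≥0) (‖l‖₊ ^ 2 * (s' - s)) ∂P := by
  rw [← B.map_driftedIncrement l hss]
  refine lintegral_comp_of_indep (B.filtration.le s) hζ (B.measurable_driftedIncrement l s s')
    (indep_of_indep_of_le_right (B.indep_inner_increment hss l) ?_) hg
  have h : Measurable[MeasurableSpace.comap (fun ω => inner ℝ l (B.W s' ω - B.W s ω))
      inferInstance] fun ω => inner ℝ l (B.W s' ω - B.W s ω) := comap_measurable _
  exact (Measurable.add_const h _).comap_le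

lemma exists_lintegral_exp_mul_abs_drifted_le (t T : ℝ≥0) {a : ℝ} (ha : 0 ≤ a) :
    ∃ C : ℝ, 0 ≤ C ∧ ∀ s ∈ Icc t T,
      ∫⁻ ω, ENNReal.ofReal (Real.exp (a * |B.drifted l t z s ω|)) ∂P ≤ ENNReal.ofReal C := by
  obtain ⟨C, hC, hm⟩ := exists_shifted_gaussian_moment_le (‖l‖₊ ^ 2 * (T - t)) 0 ha
  refine ⟨Real.exp (a * |z|) * C, by positivity, fun s hs => ?_⟩
  have e (ω : Ω) : B.drifted l t z s ω = z + B.driftedIncrement l t s ω := by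
    rw [B.drifted_eq_add l z le_rfl hs.1, drifted_self]
  simp only [e]
  have := B.lintegral_comp_driftedIncrement l hs.1 (ζ := fun _ => z) measurable_const
    (g := fun p => ENNReal.ofReal (Real.exp (a * |p.1 + p.2|))) (by fun_prop)
  simp only at this
  rw [this]
  simp only [lintegral_const, measure_univ, mul_one]
  set η := ‖l‖₊ ^ 2 * (s - t)
  have hη : η ≤ ‖l‖₊ ^ 2 * (T - t) := by
    have := hs.2
    simp only [η]
    gcongr
  have i := (integrable_pow_mul_exp_mul_abs η η 0 a).const_mul (Real.exp (a * |z|))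
  calc _ ≤ ∫⁻ y, ENNReal.ofReal (Real.exp (a * |z|) * (|y| ^ 0 * Real.exp (a * |y|)))
        ∂gaussianReal η η := by
        refine lintegral_mono fun y => ENNReal.ofReal_le_ofReal ?_
        rw [pow_zero, one_mul]
        exact exp_mul_abs_add_le ha _ _
    _ = ENNReal.ofReal (Real.exp (a * |z|) * ∫ y, |y| ^ 0 * Real.exp (a * |y|)
        ∂gaussianReal η η) := by
        rw [← integral_const_mul, ofReal_integral_eq_lintegral_ofReal i
          (ae_of_all _ fun y => by positivity)]
    _ ≤ _ := by
        refine ENNReal.ofReal_le_ofReal ?_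
        gcongr
        simpa using hm η hη

end BrownianMotion

namespace ExpSmooth

variable {f f₁ f₂ : ℝ → ℝ} {K c : ℝ} {Ω : Type*} [mΩ : MeasurableSpace Ω] {P : Measure Ω}
  [IsProbabilityMeasure P] {N : ℕ}

/-- One step of the Euler scheme for the stochastic integral of the gradient. -/
lemma exists_euler_step_le (h : ExpSmooth f f₁ f₂ K c) (B : BrownianMotion P N)
    (l : EuclideanSpace ℝ (Fin N)) (t T : ℝ≥0) (z : ℝ) {ρ : ℝ≥0 → ℝ≥0}
    (hρ : ρ = fun s => ‖l‖₊ ^ 2 * (T - s)) :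
    ∃ C : ℝ, 0 ≤ C ∧ ∀ s s' : ℝ≥0, t ≤ s → s ≤ s' → s' ≤ T → ∀ ε : ℝ, 0 < ε → ε ≤ 1 →
      ((s' : ℝ) - s) ≤ (T - t) * ε → ∀ k : ℝ → ℝ, Measurable k →
      (∀ y, |Merton.gaussAvg f₁ (ρ s) y - k y| ≤ Merton.gaussAvg f₁ (ρ s) y ^ 2 * ε) →
      (∀ ζ : Ω → ℝ, Measurable[B.filtration s] ζ →
        ∫⁻ ω, ‖ζ ω + (Merton.gaussAvg f (ρ s') (B.drifted l t z s' ω) -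
          Merton.gaussAvg f (ρ s) (B.drifted l t z s ω) -
          k (B.drifted l t z s ω) * B.driftedIncrement l s s' ω)‖ₑ ^ 2 ∂P ≤
        ENNReal.ofReal (1 + ε) * ∫⁻ ω, ‖ζ ω‖ₑ ^ 2 ∂P + ENNReal.ofReal (C * ε ^ 2)) ∧
      ∫⁻ ω, ‖k (B.drifted l t z s ω) -
        Merton.gaussAvg f₁ (ρ s') (B.drifted l t z s' ω)‖ₑ ^ 2 ∂P ≤ ENNReal.ofReal (C * ε) := by
  obtain ⟨C₁, hC₁, h₁⟩ := h.exists_lintegral_step_le (‖l‖₊ ^ 2 * (T - t))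
  obtain ⟨C₂, hC₂, h₂⟩ := h.exists_lintegral_sub_le (‖l‖₊ ^ 2 * (T - t))
  obtain ⟨Cm, hCm, hm⟩ := B.exists_lintegral_exp_mul_abs_drifted_le l z t T
    (a := 4 * c) (by linarith [h.c_nonneg])
  refine ⟨(C₁ + C₂) * Cm, by positivity, fun s s' hts hss hsT ε hε0 hε1 hε k hk hkA => ?_⟩
  set Y := B.drifted l t z with hY
  set η := ‖l‖₊ ^ 2 * (s' - s) with hη
  -- The variance consumed by the step is exactly what the remaining variance loses; hence the
  -- one-step estimates apply to F_{ρ(s)}(Y_s).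
  have hρ' : ρ s' + η = ρ s := by
    rw [hρ, hη, ← mul_add, tsub_add_tsub_cancel hsT hss]
  have hV : ρ s' + η ≤ ‖l‖₊ ^ 2 * (T - t) := by
    rw [hρ', hρ]
    simp only
    gcongr
  have hηε : (η : ℝ) ≤ (‖l‖₊ ^ 2 * (T - t) : ℝ≥0) * ε := by
    rw [hη]
    push_cast [NNReal.coe_sub hss, NNReal.coe_sub (hts.trans (hss.trans hsT))]
    rw [mul_assoc]
    gcongr
  have hkA' (y : ℝ) : |Merton.gaussAvg f₁ (ρ s' + η) y - k y| ≤
      Merton.gaussAvg f₁ (ρ s' + η) y ^ 2 * ε := by rw [hρ']; exact hkA y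
  have hGm : Measurable fun y => Merton.gaussAvg f (ρ s') y :=
    ((h.gaussAvg (ρ s')).choose_spec).continuous.measurable
  have hGm' : Measurable fun y => Merton.gaussAvg f (ρ s) y :=
    ((h.gaussAvg (ρ s)).choose_spec).continuous.measurable
  have hAm : Measurable fun y => Merton.gaussAvg f₁ (ρ s') y :=
    ((h.gaussAvg (ρ s')).choose_spec).continuous_one.measurable
  have hYs : Measurable[B.filtration s] (Y s) := B.measurable_drifted l z s
  have hYm : Measurable (Y s) := hYs.mono (B.filtration.le s) le_rfl
  have hYE : ∫⁻ ω, ENNReal.ofReal (Real.exp (4 * c * |Y s ω|)) ∂P ≤ ENNReal.ofReal Cm :=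
    hm s ⟨hts, hss.trans hsT⟩
  have hadd (ω : Ω) : Y s' ω = Y s ω + B.driftedIncrement l s s' ω :=
    B.drifted_eq_add l z hts hss ω
  constructor
  · intro ζ hζ
    have hζm : Measurable ζ := hζ.mono (B.filtration.le s) le_rfl
    -- The accumulated error ζ and the state Y_s are frozen and the independent increment is
    -- integrated first.
    have e := B.lintegral_comp_driftedIncrement l hss (ζ := fun ω => (ζ ω, Y s ω))
      (hζ.prodMk hYs) (g := fun p => ‖p.1.1 + (Merton.gaussAvg f (ρ s') (p.1.2 + p.2) -
        Merton.gaussAvg f (ρ s) p.1.2 - k p.1.2 * p.2)‖ₑ ^ 2) (by fun_prop)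
    simp only at e
    simp only [hadd]
    rw [e]
    calc _ ≤ ∫⁻ ω, (ENNReal.ofReal (1 + ε) * ‖ζ ω‖ₑ ^ 2 +
          ENNReal.ofReal (C₁ * ε ^ 2) * ENNReal.ofReal (Real.exp (4 * c * |Y s ω|))) ∂P := by
          refine lintegral_mono fun ω => ?_
          have := h₁ (ρ s') η hV ε hε0 hε1 hηε (Y s ω) (k (Y s ω)) (hkA' _) (ζ ω)
          rw [hρ'] at this
          refine this.trans (le_of_eq ?_)
          rw [ENNReal.ofReal_add (by positivity) (by positivity),
            ENNReal.ofReal_mul (by positivity), ENNReal.ofReal_mul (by positivity),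
            Real.enorm_eq_ofReal_abs, ← ENNReal.ofReal_pow (abs_nonneg _), sq_abs]
      _ = ENNReal.ofReal (1 + ε) * ∫⁻ ω, ‖ζ ω‖ₑ ^ 2 ∂P + ENNReal.ofReal (C₁ * ε ^ 2) *
          ∫⁻ ω, ENNReal.ofReal (Real.exp (4 * c * |Y s ω|)) ∂P := by
          rw [lintegral_add_left (by fun_prop), lintegral_const_mul _ (by fun_prop),
            lintegral_const_mul _ (by fun_prop)]
      _ ≤ ENNReal.ofReal (1 + ε) * ∫⁻ ω, ‖ζ ω‖ₑ ^ 2 ∂P + ENNReal.ofReal (C₁ * ε ^ 2) *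
          ENNReal.ofReal Cm := by gcongr
      _ ≤ _ := by
          rw [← ENNReal.ofReal_mul (by positivity)]
          refine add_le_add le_rfl (ENNReal.ofReal_le_ofReal ?_)
          nlinarith [mul_nonneg (mul_nonneg hC₂ hCm) (sq_nonneg ε)]
  · have e := B.lintegral_comp_driftedIncrement l hss (ζ := Y s) hYs
      (g := fun p => ‖k p.1 - Merton.gaussAvg f₁ (ρ s') (p.1 + p.2)‖ₑ ^ 2) (by fun_prop)
    simp only at e
    simp only [hadd]
    rw [e]
    calc _ ≤ ∫⁻ ω, ENNReal.ofReal (C₂ * ε) * ENNReal.ofReal (Real.exp (4 * c * |Y s ω|)) ∂P := by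
          refine lintegral_mono fun ω => ?_
          rw [← ENNReal.ofReal_mul (by positivity)]
          exact h₂ (ρ s') η hV ε hε0 hε1 hηε (Y s ω) (k (Y s ω)) (hkA' _)
      _ ≤ ENNReal.ofReal (C₂ * ε) * ENNReal.ofReal Cm := by
          rw [lintegral_const_mul _ (by fun_prop)]
          gcongr
      _ ≤ _ := by
          rw [← ENNReal.ofReal_mul (by positivity)]
          gcongr ENNReal.ofReal ?_
          nlinarith [mul_nonneg (mul_nonneg hC₁ hCm) hε0.le]

end ExpSmooth


/-! ### Convergence of the Euler scheme -/

/-- Truncation to `[-n, n]`. -/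
noncomputable def clamp (n x : ℝ) : ℝ := max (-n) (min n x)

lemma measurable_clamp (n : ℝ) : Measurable (clamp n) := by unfold clamp; fun_prop

lemma abs_clamp_le {n : ℝ} (hn : 0 ≤ n) (x : ℝ) : |clamp n x| ≤ n :=
  abs_le.2 ⟨le_max_left _ _, max_le (by linarith) (min_le_left _ _)⟩

/-- Simple processes need bounded values. Truncating at the number of steps n costs at most x²/n,
which is of the order of the mesh. -/
lemma abs_sub_clamp_le {n : ℝ} (hn : 0 < n) (x : ℝ) : |x - clamp n x| ≤ x ^ 2 * n⁻¹ := by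
  rw [← div_eq_mul_inv, le_div_iff₀ hn]
  unfold clamp
  rcases le_total n x with h | h
  · rw [min_eq_left h, max_eq_right (by linarith), abs_of_nonneg (by linarith)]
    nlinarith
  · rw [min_eq_right h]
    rcases le_total (-n) x with h' | h'
    · rw [max_eq_right h', sub_self, abs_zero, zero_mul]
      positivity
    · rw [max_eq_left h', abs_of_nonpos (by linarith)]
      nlinarith

/-- Discrete Gronwall inequality. -/
lemma le_of_forall_succ_le {a : ℕ → ℝ≥0∞} {ε b : ℝ} (hε : 0 ≤ ε) (hb : 0 ≤ b) (h0 : a 0 = 0)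
    {n : ℕ} (h : ∀ j < n, a (j + 1) ≤ ENNReal.ofReal (1 + ε) * a j + ENNReal.ofReal b) :
    ∀ j ≤ n, a j ≤ ENNReal.ofReal (j * b * (1 + ε) ^ j) := by
  intro j
  induction j with
  | zero => simp [h0]
  | succ j ih =>
    intro hj
    refine (h j hj).trans ?_
    calc _ ≤ ENNReal.ofReal (1 + ε) * ENNReal.ofReal (j * b * (1 + ε) ^ j) +
          ENNReal.ofReal b := by gcongr; exact ih (by omega)
      _ = ENNReal.ofReal ((1 + ε) * (j * b * (1 + ε) ^ j) + b) := by
          rw [← ENNReal.ofReal_mul (by positivity), ENNReal.ofReal_add (by positivity) hb]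
      _ ≤ _ := by
          refine ENNReal.ofReal_le_ofReal ?_
          have h1 : b * 1 ≤ b * (1 + ε) ^ (j + 1) := by
            gcongr
            exact one_le_pow₀ (by linarith)
          push_cast
          calc _ = j * b * (1 + ε) ^ (j + 1) + b * 1 := by ring
            _ ≤ j * b * (1 + ε) ^ (j + 1) + b * (1 + ε) ^ (j + 1) := by gcongr
            _ = _ := by ring

namespace SimpleProcess

variable {Ω : Type*} [mΩ : MeasurableSpace Ω] {ℱ : Filtration ℝ≥0 mΩ} {N : ℕ} {t T : ℝ≥0}
  (ψ : SimpleProcess ℱ N t T)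

lemma value_of_mem {i : ℕ} (hi : i < ψ.n) {s : ℝ≥0} (hs : s ∈ Ioc (ψ.τ i) (ψ.τ (i + 1))) (ω : Ω) :
    ψ.value s ω = ψ.ξ i ω := by
  unfold value
  rw [Finset.sum_eq_single_of_mem i (Finset.mem_range.2 hi), indicator_of_mem hs]
  intro j _ hj
  exact indicator_of_notMem (fun h => (disjoint_left.1
    (ψ.τ_mono.pairwise_disjoint_on_Ioc_succ hj) h) hs) _

lemma exists_mem_Ioc {s : ℝ≥0} (hs : s ∈ Ioc t T) :
    ∃ i < ψ.n, s ∈ Ioc (ψ.τ i) (ψ.τ (i + 1)) := by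
  have h := ψ.τ_mono.biUnion_Ico_Ioc_map_succ 0 ψ.n
  rw [ψ.τ_zero, ψ.τ_last] at h
  rw [← h] at hs
  simpa [and_left_comm] using hs

lemma memLp_drift {P : Measure Ω} [IsProbabilityMeasure P] (l : EuclideanSpace ℝ (Fin N))
    (s : ℝ≥0) : MemLp (ψ.drift l s) 2 P := by
  unfold drift
  refine memLp_finsetSum _ fun i hi => ?_
  obtain ⟨C, hC⟩ := ψ.ξ_bdd i (Finset.mem_range.1 hi)
  have hm := ψ.measurable_ξ (Finset.mem_range.1 hi)
  refine MemLp.mul_const (MemLp.of_bound (by fun_prop) (C * ‖l‖) (ae_of_all _ fun ω => ?_)) _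
  exact (norm_inner_le_norm _ _).trans (by gcongr; exact hC ω)

end SimpleProcess

lemma isStronglyProgressive_comp {Ω E : Type*} [mΩ : MeasurableSpace Ω] [TopologicalSpace E]
    {ℱ : Filtration ℝ≥0 mΩ} {Z : ℝ≥0 → Ω → ℝ} (hZ : IsStronglyProgressive ℱ Z)
    {F : ℝ≥0 × ℝ → E} (hF : Continuous F) :
    IsStronglyProgressive ℱ fun s ω => F (s, Z s ω) := fun i =>
  hF.comp_stronglyMeasurable (StronglyMeasurable.prodMk
    (Measurable.stronglyMeasurable (measurable_subtype_coe.comp measurable_fst)) (hZ i))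

/-- The Euler approximation of `a(s, Y s) l`, where `Y` is the drifted process. -/
noncomputable def BrownianMotion.eulerApprox {Ω : Type*} [mΩ : MeasurableSpace Ω] {P : Measure Ω}
    {N : ℕ} (B : BrownianMotion P N) (l : EuclideanSpace ℝ (Fin N)) {t T : ℝ≥0} (htT : t ≤ T)
    (z : ℝ) {a : ℝ≥0 → ℝ → ℝ} (ha : ∀ s, Measurable (a s)) (k : ℕ) :
    SimpleProcess B.filtration N t T where
  n := k + 1
  τ i := t + i * ((T - t) / (k + 1))
  ξ i ω := clamp (k + 1) (a (t + i * ((T - t) / (k + 1)))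
    (B.drifted l t z (t + i * ((T - t) / (k + 1))) ω)) • l
  τ_mono i j hij := by
    have : (i : ℝ≥0) ≤ j := by exact_mod_cast hij
    dsimp only
    gcongr
  τ_zero := by simp
  τ_last := by
    push_cast
    rw [mul_div_cancel₀ _ (by positivity), add_tsub_cancel_of_le htT]
  ξ_meas i _ := by
    have h : Measurable fun y => clamp (k + 1) (a (t + i * ((T - t) / (k + 1))) y) • l :=
      ((measurable_clamp _).comp (ha _)).smul_const l
    exact (h.comp (B.measurable_drifted l z _)).stronglyMeasurable
  ξ_bdd i _ := ⟨(k + 1) * ‖l‖, fun ω => by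
    rw [norm_smul, Real.norm_eq_abs]
    gcongr
    exact abs_clamp_le (by positivity) _⟩

namespace ExpSmooth

variable {f f₁ f₂ : ℝ → ℝ} {K c : ℝ} {Ω : Type*} [mΩ : MeasurableSpace Ω] {P : Measure Ω}
  [IsProbabilityMeasure P] {N : ℕ}

lemma measurable_gaussAvg (h : ExpSmooth f f₁ f₂ K c) (v : ℝ≥0) :
    Measurable fun y => Merton.gaussAvg f v y :=
  ((h.gaussAvg v).choose_spec).continuous.measurable

lemma measurable_gaussAvg_one (h : ExpSmooth f f₁ f₂ K c) (v : ℝ≥0) :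
    Measurable fun y => Merton.gaussAvg f₁ v y :=
  ((h.gaussAvg v).choose_spec).continuous_one.measurable

/-- Convergence of the Euler scheme. -/
lemma exists_euler_le (h : ExpSmooth f f₁ f₂ K c) (B : BrownianMotion P N)
    (l : EuclideanSpace ℝ (Fin N)) {t T : ℝ≥0} (htT : t ≤ T) (z : ℝ) {ρ : ℝ≥0 → ℝ≥0}
    (hρ : ρ = fun s => ‖l‖₊ ^ 2 * (T - s)) {ψ : ℕ → SimpleProcess B.filtration N t T}
    (hψ : ψ = B.eulerApprox l htT z fun s => h.measurable_gaussAvg_one (ρ s)) :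
    ∃ C : ℝ, 0 ≤ C ∧ ∀ k : ℕ,
      (∀ s ∈ Icc t T, ∫⁻ ω, ‖(ψ k).drift l s ω + (ψ k).integral B.W s ω -
        (Merton.gaussAvg f (ρ s) (B.drifted l t z s ω) - Merton.gaussAvg f (ρ t) z)‖ₑ ^ 2 ∂P ≤
        ENNReal.ofReal (C * ((k : ℝ) + 1)⁻¹)) ∧
      ∀ s ∈ Ioc t T, ∫⁻ ω, ‖(ψ k).value s ω -
        Merton.gaussAvg f₁ (ρ s) (B.drifted l t z s ω) • l‖ₑ ^ 2 ∂P ≤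
        ENNReal.ofReal (C * ((k : ℝ) + 1)⁻¹) := by
  obtain ⟨C, hC, hstep⟩ := h.exists_euler_step_le B l t T z hρ
  -- The first term is the Gronwall constant for the accumulated error, the second bounds the error
  -- of the integrand.
  refine ⟨C * Real.exp 1 + C * ‖l‖ ^ 2, by positivity, fun k => ?_⟩
  set ε : ℝ := ((k : ℝ) + 1)⁻¹ with hε
  have hk : (0 : ℝ) < (k : ℝ) + 1 := by positivity
  have hε0 : 0 < ε := by positivity
  have hε1 : ε ≤ 1 := inv_le_one_of_one_le₀ (by linarith [(Nat.cast_nonneg k : (0 : ℝ) ≤ k)])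
  set τ : ℕ → ℝ≥0 := fun i => t + i * ((T - t) / (k + 1)) with hτ
  set a : ℕ → ℝ → ℝ := fun i y => clamp (k + 1) (Merton.gaussAvg f₁ (ρ (τ i)) y) with ha
  have ham (i : ℕ) : Measurable (a i) := (measurable_clamp _).comp (h.measurable_gaussAvg_one _)
  have hab (i : ℕ) (y : ℝ) : |Merton.gaussAvg f₁ (ρ (τ i)) y - a i y| ≤
      Merton.gaussAvg f₁ (ρ (τ i)) y ^ 2 * ε := abs_sub_clamp_le hk _
  set Y := B.drifted l t z with hY
  have hn : (ψ k).n = k + 1 := by rw [hψ]; rfl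
  have hτψ : (ψ k).τ = τ := by rw [hψ]; rfl
  have hξ (i : ℕ) (ω : Ω) : (ψ k).ξ i ω = a i (Y (τ i) ω) • l := by rw [hψ]; rfl
  have htτ (i : ℕ) : t ≤ τ i := le_self_add
  have hmono : Monotone τ := hτψ ▸ (ψ k).τ_mono
  have hlen {i : ℕ} {s : ℝ≥0} (hs : s ≤ τ (i + 1)) : (s : ℝ) - τ i ≤ (T - t) * ε := by
    have h1 : (s : ℝ) ≤ τ (i + 1) := by exact_mod_cast hs
    refine (sub_le_sub_right h1 _).trans (le_of_eq ?_)
    simp only [hτ, hε]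
    push_cast [NNReal.coe_sub htT]
    field_simp
    ring
  refine ⟨fun s hs => ?_, fun s hs => ?_⟩
  · set d : ℕ → Ω → ℝ := fun i ω => Merton.gaussAvg f (ρ (min (τ (i + 1)) s))
      (Y (min (τ (i + 1)) s) ω) - Merton.gaussAvg f (ρ (min (τ i) s)) (Y (min (τ i) s) ω) -
      a i (Y (τ i) ω) * B.driftedIncrement l (min (τ i) s) (min (τ (i + 1)) s) ω with hd
    have hYm (i j : ℕ) (hij : i ≤ j) (u : ℝ≥0) (hu : u ≤ τ i) :
        Measurable[B.filtration (τ j)] (Y u) :=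
      (B.measurable_drifted l z u).mono (B.filtration.mono (hu.trans (hmono hij))) le_rfl
    have hdm (i j : ℕ) (hij : i + 1 ≤ j) : Measurable[B.filtration (τ j)] (d i) := by
      have m1 := (h.measurable_gaussAvg (ρ (min (τ (i + 1)) s))).comp
        (hYm _ j hij _ (min_le_left _ s))
      have m2 := (h.measurable_gaussAvg (ρ (min (τ i) s))).comp
        (hYm i j (by omega) _ (min_le_left _ s))
      have m3 := (ham i).comp (hYm i j (by omega) _ le_rfl)
      have m4 : Measurable[B.filtration (τ j)]
          (B.driftedIncrement l (min (τ i) s) (min (τ (i + 1)) s)) := by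
        have e : B.driftedIncrement l (min (τ i) s) (min (τ (i + 1)) s) = fun ω =>
            Y (min (τ (i + 1)) s) ω - Y (min (τ i) s) ω := by
          funext ω
          rw [hY, B.drifted_eq_add l z (le_min (htτ i) hs.1)
            (min_le_min_right s (hmono (Nat.le_succ i)))]
          ring
        rw [e]
        exact (hYm _ j hij _ (min_le_left _ s)).sub (hYm i j (by omega) _ (min_le_left _ s))
      exact (m1.sub m2).sub (m3.mul m4)
    -- The increments of F telescope. The drift and stochastic parts of the simple process combine
    -- into a i times the drifted increment, since its values are multiples of l.
    have e (ω : Ω) : ∑ i ∈ Finset.range (k + 1), d i ω =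
        Merton.gaussAvg f (ρ s) (Y s ω) - Merton.gaussAvg f (ρ t) z -
        ((ψ k).drift l s ω + (ψ k).integral B.W s ω) := by
      simp only [hd]
      rw [Finset.sum_sub_distrib, Finset.sum_range_sub fun i => Merton.gaussAvg f
        (ρ (min (τ i) s)) (Y (min (τ i) s) ω)]
      have e1 : τ (k + 1) = T := by rw [← hτψ, ← hn, (ψ k).τ_last]
      have e2 : τ 0 = t := by rw [← hτψ, (ψ k).τ_zero]
      rw [e1, e2, min_eq_right hs.2, min_eq_left hs.1, hY, BrownianMotion.drifted_self]
      congr 1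
      rw [SimpleProcess.drift, SimpleProcess.integral, ← Finset.sum_add_distrib, hn, hτψ]
      refine Finset.sum_congr rfl fun i _ => ?_
      rw [hξ, inner_smul_left, inner_smul_left, BrownianMotion.driftedIncrement,
        real_inner_self_eq_norm_sq]
      simp only [conj_trivial]
      ring
    have key := le_of_forall_succ_le (a := fun j => ∫⁻ ω, ‖∑ i ∈ Finset.range j, d i ω‖ₑ ^ 2 ∂P)
      (ε := ε) (b := C * ε ^ 2) hε0.le (by positivity) (by simp) (n := k + 1) (fun j _ => by
        simp only [Finset.sum_range_succ]
        rcases le_total (τ j) s with hj | hj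
        · have hss : τ j ≤ min (τ (j + 1)) s := le_min (hmono (Nat.le_succ j)) hj
          have := (hstep (τ j) (min (τ (j + 1)) s) (htτ j) hss ((min_le_right _ _).trans hs.2) ε
            hε0 hε1 (hlen (min_le_left _ _)) (a j) (ham j) (hab j)).1
            (fun ω => ∑ i ∈ Finset.range j, d i ω)
            (Finset.measurable_fun_sum _ fun i hi => hdm i j (Finset.mem_range.1 hi))
          simpa only [hd, min_eq_left hj] using this
        -- Steps starting at or after time s are empty and contribute nothing.
        · have hz (ω : Ω) : d j ω = 0 := by
            simp only [hd]
            rw [min_eq_right hj, min_eq_right (hj.trans (hmono (Nat.le_succ j))),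
              BrownianMotion.driftedIncrement_self]
            ring
          simp only [hz, add_zero]
          refine le_trans ?_ le_self_add
          refine le_mul_of_one_le_left zero_le ?_
          rw [← ENNReal.ofReal_one]
          exact ENNReal.ofReal_le_ofReal (by linarith)) (k + 1) le_rfl
    simp only [e] at key
    calc _ = ∫⁻ ω, ‖Merton.gaussAvg f (ρ s) (Y s ω) - Merton.gaussAvg f (ρ t) z -
        ((ψ k).drift l s ω + (ψ k).integral B.W s ω)‖ₑ ^ 2 ∂P := by
          refine lintegral_congr fun ω => ?_
          rw [enorm_sub_rev]
      _ ≤ _ := key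
      _ ≤ _ := by
          refine ENNReal.ofReal_le_ofReal ?_
          -- With ε = 1/(k + 1) the growth factor stays below e, while k + 1 errors of size C ε² add
          -- up to C ε.
          have h1 : (1 + ε) ^ (k + 1) ≤ Real.exp 1 := by
            calc (1 + ε) ^ (k + 1) ≤ Real.exp ε ^ (k + 1) := by
                  gcongr
                  linarith [Real.add_one_le_exp ε]
              _ = Real.exp 1 := by
                  rw [← Real.exp_nat_mul, hε]
                  push_cast
                  rw [mul_inv_cancel₀ hk.ne']
          have h2 : ((k + 1 : ℕ) : ℝ) * (C * ε ^ 2) = C * ε := by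
            rw [hε]
            push_cast
            field_simp
          rw [h2]
          calc C * ε * (1 + ε) ^ (k + 1) ≤ C * ε * Real.exp 1 := by gcongr
            _ = C * Real.exp 1 * ε := by ring
            _ ≤ _ := by gcongr; exact le_add_of_nonneg_right (by positivity)
  · obtain ⟨i, hi, his⟩ := (ψ k).exists_mem_Ioc hs
    simp only [(ψ k).value_of_mem hi his, hξ, ← sub_smul]
    rw [hτψ] at his
    have := (hstep (τ i) s (htτ i) his.1.le hs.2 ε hε0 hε1 (hlen his.2) (a i) (ham i) (hab i)).2
    simp only [enorm_smul, mul_pow]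
    rw [lintegral_mul_const' _ _ (by simp)]
    calc _ ≤ ENNReal.ofReal (C * ε) * ‖l‖ₑ ^ 2 := by gcongr
      _ = ENNReal.ofReal (C * ‖l‖ ^ 2 * ε) := by
          rw [← ofReal_norm, ← ENNReal.ofReal_pow (norm_nonneg _),
            ← ENNReal.ofReal_mul (by positivity)]
          ring_nf
      _ ≤ _ := by
          refine ENNReal.ofReal_le_ofReal ?_
          gcongr
          exact le_add_of_nonneg_left (by positivity)

end ExpSmooth


/-! ### Admissibility of the candidate wealth process -/

lemma lintegral_lintegral_enorm_sq_le {Ω E : Type*} [MeasurableSpace Ω] {P : Measure Ω}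
    [SFinite P] [NormedAddCommGroup E] [MeasurableSpace E] [BorelSpace E]
    {t T : ℝ≥0} {φ : ℝ≥0 → Ω → E}
    (hφ : Measurable fun p : ℝ × Ω => φ (min p.1.toNNReal T) p.2) {C : ℝ≥0∞}
    (h : ∀ s ∈ Ioc t T, ∫⁻ ω, ‖φ s ω‖ₑ ^ 2 ∂P ≤ C) :
    ∫⁻ ω, (∫⁻ s in Icc (t : ℝ) T, ‖φ s.toNNReal ω‖ₑ ^ 2) ∂P ≤ C * ENNReal.ofReal (T - t) := by
  have e (ω : Ω) : ∫⁻ s in Icc (t : ℝ) T, ‖φ s.toNNReal ω‖ₑ ^ 2 =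
      ∫⁻ s in Ioc (t : ℝ) T, ‖φ (min s.toNNReal T) ω‖ₑ ^ 2 := by
    -- The endpoint t is null and has to be dropped: simple processes are controlled only on (t, T].
    rw [← restrict_Ioc_eq_restrict_Icc]
    refine setLIntegral_congr_fun measurableSet_Ioc fun v hv => ?_
    simp only [min_eq_left (Real.toNNReal_le_iff_le_coe.2 hv.2)]
  simp only [e]
  rw [lintegral_lintegral_swap (f := fun ω (s : ℝ) => ‖φ (min s.toNNReal T) ω‖ₑ ^ 2)
    ((hφ.enorm.pow_const 2).comp measurable_swap).aemeasurable]
  calc _ ≤ ∫⁻ _ in Ioc (t : ℝ) T, C := by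
        refine setLIntegral_mono measurable_const fun v hv => ?_
        rw [min_eq_left (Real.toNNReal_le_iff_le_coe.2 hv.2)]
        exact h _ ⟨Real.lt_toNNReal_iff_coe_lt.2 hv.1, Real.toNNReal_le_iff_le_coe.2 hv.2⟩
    _ = _ := by rw [setLIntegral_const, Real.volume_Ioc]

lemma SimpleProcess.measurable_value_min {Ω : Type*} [mΩ : MeasurableSpace Ω]
    {ℱ : Filtration ℝ≥0 mΩ} {N : ℕ} {t T : ℝ≥0} (ψ : SimpleProcess ℱ N t T) :
    Measurable fun p : ℝ × Ω => ψ.value (min p.1.toNNReal T) p.2 := by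
  unfold value
  refine Finset.measurable_fun_sum _ fun i hi => ?_
  have h1 : MeasurableSet {p : ℝ × Ω | min p.1.toNNReal T ∈ Ioc (ψ.τ i) (ψ.τ (i + 1))} :=
    measurableSet_Ioc.preimage (by fun_prop : Measurable fun p : ℝ × Ω => min p.1.toNNReal T)
  exact ((ψ.measurable_ξ (Finset.mem_range.1 hi)).comp measurable_snd).indicator h1

namespace ExpSmooth

variable {f f₁ f₂ : ℝ → ℝ} {K c : ℝ} {Ω : Type*} [mΩ : MeasurableSpace Ω] {P : Measure Ω}
  [IsProbabilityMeasure P] {N : ℕ}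

lemma exists_lintegral_gaussAvg_sq_le (h : ExpSmooth f f₁ f₂ K c) (B : BrownianMotion P N)
    (l : EuclideanSpace ℝ (Fin N)) (t T : ℝ≥0) (z : ℝ) :
    ∃ C : ℝ, ∀ s ∈ Icc t T,
      ∫⁻ ω, ‖Merton.gaussAvg f (‖l‖₊ ^ 2 * (T - s)) (B.drifted l t z s ω)‖ₑ ^ 2 ∂P ≤
        ENNReal.ofReal C ∧
      ∫⁻ ω, ‖Merton.gaussAvg f₁ (‖l‖₊ ^ 2 * (T - s)) (B.drifted l t z s ω)‖ₑ ^ 2 ∂P ≤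
        ENNReal.ofReal C := by
  obtain ⟨K', h'⟩ := h.gaussAvg_le (‖l‖₊ ^ 2 * (T - t))
  obtain ⟨Cm, hCm, hm⟩ := B.exists_lintegral_exp_mul_abs_drifted_le l z t T
    (a := 2 * c) (by linarith [h.c_nonneg])
  refine ⟨K' ^ 2 * Cm, fun s hs => ?_⟩
  have hv : ‖l‖₊ ^ 2 * (T - s) ≤ ‖l‖₊ ^ 2 * (T - t) := by
    have := hs.1
    gcongr
  have key {g : ℝ → ℝ} (hg : ∀ y, |g y| ≤ K' * Real.exp (c * |y|)) :
      ∫⁻ ω, ‖g (B.drifted l t z s ω)‖ₑ ^ 2 ∂P ≤ ENNReal.ofReal (K' ^ 2 * Cm) := by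
    calc _ ≤ ∫⁻ ω, ENNReal.ofReal (K' ^ 2) *
          ENNReal.ofReal (Real.exp (2 * c * |B.drifted l t z s ω|)) ∂P := by
          refine lintegral_mono fun ω => ?_
          rw [Real.enorm_eq_ofReal_abs, ← ENNReal.ofReal_pow (abs_nonneg _),
            ← ENNReal.ofReal_mul (sq_nonneg _)]
          refine ENNReal.ofReal_le_ofReal ?_
          calc _ ≤ (K' * Real.exp (c * |B.drifted l t z s ω|)) ^ 2 := by
                gcongr; exact hg _
            _ = _ := by rw [mul_pow, ← Real.exp_nat_mul]; push_cast; ring_nf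
      _ ≤ _ := by
          rw [lintegral_const_mul' _ _ ENNReal.ofReal_ne_top, ENNReal.ofReal_mul (sq_nonneg _)]
          gcongr
          exact hm s hs
  exact ⟨key (h' _ hv).bound, key (h' _ hv).bound_one⟩

/-- The function `f` of the drifted process at time `T` is the terminal value of an admissible
wealth process. -/
lemma exists_isAdmissible (h : ExpSmooth f f₁ f₂ K c) (hpos : ∀ y, 0 < f y)
    (B : BrownianMotion P N) (m : Market N) {t T : ℝ≥0} (htT : t ≤ T) (z : ℝ) :
    ∃ π X, IsAdmissible B m t T (Merton.gaussAvg f (‖m.priceOfRisk‖₊ ^ 2 * (T - t)) z) π X ∧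
      ∀ ω, X T ω = f (B.drifted m.priceOfRisk t z T ω) := by
  set l := m.priceOfRisk with hl
  set ρ : ℝ≥0 → ℝ≥0 := fun s => ‖l‖₊ ^ 2 * (T - s) with hρ
  set Y := B.drifted l t z with hY
  set X : ℝ≥0 → Ω → ℝ := fun s ω => Merton.gaussAvg f (ρ s) (Y s ω) with hX
  set x := Merton.gaussAvg f (ρ t) z with hx
  -- Y has continuous paths only almost surely, so the strategy is built from a progressive
  -- modification.
  obtain ⟨Z, hZ, hZY⟩ := exists_isStronglyProgressive (P := P) (B.measurable_drifted l z)
    (B.continuous_drifted l (t := t) z)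
  -- Inverting σ produces a portfolio with exposure exactly l; the strategy is a scalar multiple of
  -- it.
  set p₀ : EuclideanSpace ℝ (Fin N) := WithLp.toLp 2 (m.σ⁻¹ *ᵥ (fun i => l i)) with hp₀
  have hp₀l : m.exposure p₀ = l := by
    have : m.σ *ᵥ (m.σ⁻¹ *ᵥ (fun i => l i)) = fun i => l i := by
      rw [Matrix.mulVec_mulVec, Matrix.mul_nonsing_inv _ m.isUnit_det, Matrix.one_mulVec]
    rw [Market.exposure, hp₀]
    simp only [this]
  set a : ℝ≥0 → Ω → ℝ := fun s ω => Merton.gaussAvg f₁ (ρ s) (Z s ω) with ha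
  set π : ℝ≥0 → Ω → EuclideanSpace ℝ (Fin N) := fun s ω => a s ω • p₀ with hπ
  have hexp (s : ℝ≥0) (ω : Ω) : m.exposure (π s ω) = a s ω • l := by
    rw [← Market.exposureCLM_apply, hπ, map_smul, Market.exposureCLM_apply, hp₀l]
  have hρc : Continuous ρ := by fun_prop
  have hG : Continuous fun q : ℝ≥0 × ℝ => Merton.gaussAvg f (ρ q.1) q.2 :=
    (continuous_gaussAvg h.growth h.continuous).comp (f := fun q : ℝ≥0 × ℝ => (ρ q.1, q.2))
      (by fun_prop)
  have hA : Continuous fun q : ℝ≥0 × ℝ => Merton.gaussAvg f₁ (ρ q.1) q.2 :=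
    (continuous_gaussAvg h.growth_one h.continuous_one).comp
      (f := fun q : ℝ≥0 × ℝ => (ρ q.1, q.2)) (by fun_prop)
  have hprog : IsStronglyProgressive B.filtration π :=
    isStronglyProgressive_comp hZ (F := fun q => Merton.gaussAvg f₁ (ρ q.1) q.2 • p₀)
      (hA.smul continuous_const)
  have hπm : Measurable fun p : ℝ × Ω => π (min p.1.toNNReal T) p.2 :=
    measurable_min_of_isStronglyProgressive hprog T
  have hφm : Measurable fun p : ℝ × Ω => m.exposure (π (min p.1.toNNReal T) p.2) :=
    m.continuous_exposure.measurable.comp hπm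
  obtain ⟨C₀, hC₀⟩ := h.exists_lintegral_gaussAvg_sq_le B l t T z
  have hsq : ∫⁻ ω, (∫⁻ s in Icc (t : ℝ) T, ‖π s.toNNReal ω‖ₑ ^ 2) ∂P < ∞ := by
    refine (lintegral_lintegral_enorm_sq_le (C := ENNReal.ofReal C₀ * ‖p₀‖ₑ ^ 2) hπm
      fun s hs => ?_).trans_lt (ENNReal.mul_lt_top (ENNReal.mul_lt_top ENNReal.ofReal_lt_top
        (ENNReal.pow_lt_top enorm_lt_top)) ENNReal.ofReal_lt_top)
    simp only [hπ, enorm_smul, mul_pow]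
    rw [lintegral_mul_const' _ _ (ENNReal.pow_ne_top enorm_ne_top)]
    gcongr
    refine le_trans (le_of_eq (lintegral_congr_ae ?_)) (hC₀ s ⟨hs.1.le, hs.2⟩).2
    filter_upwards [hZY] with ω hω
    simp only [ha, hω s, hρ]
  have hfin := m.lintegral_exposure_lt_top hsq
  set ψ := B.eulerApprox l htT z fun s => h.measurable_gaussAvg_one (ρ s) with hψ
  obtain ⟨C, hC, hCψ⟩ := h.exists_euler_le B l htT z hρ hψ
  have hlim (D : ℝ≥0∞) (hD : D ≠ ∞) :
      Tendsto (fun k : ℕ => ENNReal.ofReal (C * ((k : ℝ) + 1)⁻¹) * D) atTop (𝓝 0) := by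
    have h1 : Tendsto (fun k : ℕ => C * ((k : ℝ) + 1)⁻¹) atTop (𝓝 0) := by
      have := (tendsto_one_div_add_atTop_nhds_zero_nat (𝕜 := ℝ)).const_mul C
      simpa [one_div] using this
    have h2 := ENNReal.tendsto_ofReal h1
    rw [ENNReal.ofReal_zero] at h2
    simpa using ENNReal.Tendsto.mul_const h2 (Or.inr hD)
  have hconv : Tendsto (fun k => ∫⁻ ω, (∫⁻ s in Icc (t : ℝ) T,
      ‖(ψ k).value s.toNNReal ω - m.exposure (π s.toNNReal ω)‖ₑ ^ 2) ∂P) atTop (𝓝 0) := by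
    refine tendsto_of_tendsto_of_tendsto_of_le_of_le tendsto_const_nhds
      (hlim (ENNReal.ofReal (T - t)) ENNReal.ofReal_ne_top) (fun _ => zero_le) fun k => ?_
    refine lintegral_lintegral_enorm_sq_le
      (φ := fun s ω => (ψ k).value s ω - m.exposure (π s ω))
      ((ψ k).measurable_value_min.sub hφm) fun s hs => ?_
    refine le_trans (le_of_eq (lintegral_congr_ae ?_)) ((hCψ k).2 s hs)
    filter_upwards [hZY] with ω hω
    simp only [hexp, ha, hω s]
  set D : ℝ≥0 → Ω → ℝ := fun s ω =>
    ∫ v in (t : ℝ)..s, inner ℝ (m.exposure (π v.toNNReal ω)) l with hD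
  have hdrift {s : ℝ≥0} (hs : s ∈ Icc t T) := SimpleProcess.tendsto_drift
    (φ := fun s ω => m.exposure (π s ω)) hφm hfin hconv l hs
  have hDm {s : ℝ≥0} (hs : s ∈ Icc t T) : Measurable (D s) :=
    measurable_integral_inner (φ := fun s ω => m.exposure (π s ω)) hφm hs l
  have hmemLp {g : Ω → ℝ} (hg : Measurable g) (hlt : ∫⁻ ω, ‖g ω‖ₑ ^ 2 ∂P < ∞) : MemLp g 2 P := by
    refine ⟨hg.aestronglyMeasurable, ?_⟩
    rw [eLpNorm_lt_top_iff_lintegral_rpow_enorm_lt_top two_ne_zero ENNReal.ofNat_ne_top]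
    simpa using hlt
  have hXm (s : ℝ≥0) : Measurable (X s) :=
    (h.measurable_gaussAvg (ρ s)).comp ((B.measurable_drifted l z s).mono (B.filtration.le s) le_rfl)
  -- D differs from the square integrable drift of some approximating simple process by a function
  -- of finite mean square.
  have hDL {s : ℝ≥0} (hs : s ∈ Icc t T) : MemLp (D s) 2 P := by
    obtain ⟨k, hk⟩ := ((hdrift hs).eventually (gt_mem_nhds ENNReal.zero_lt_top)).exists
    have h1 := (ψ k).memLp_drift (P := P) l s
    have h2 : MemLp (fun ω => (ψ k).drift l s ω - D s ω) 2 P :=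
      hmemLp (((ψ k).measurable_drift l s).sub (hDm hs)) hk
    refine (h1.sub h2).ae_eq (ae_of_all _ fun ω => ?_)
    simp
  -- Taking X - x - D as the stochastic integral makes the wealth equation trivial. The content is
  -- that it is the Itô integral: the Euler gains tend to X - x and their drifts to D.
  refine ⟨π, X, ⟨hprog, hsq, ⟨?_, fun s ω => X s ω - x - D s ω, ⟨?_, ψ, hconv, ?_⟩, ?_⟩, ?_⟩, ?_⟩
  · filter_upwards [B.continuous_drifted l (t := t) z] with ω hω
    exact (hG.comp (continuous_id.prodMk hω)).continuousOn
  · intro s hs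
    exact ((hmemLp (hXm s) ((hC₀ s hs).1.trans_lt ENNReal.ofReal_lt_top)).sub
      (memLp_const x)).sub (hDL hs)
  · intro s hs
    have h1 : Tendsto (fun k => ∫⁻ ω, ‖-(ψ k).drift l s ω - -D s ω‖ₑ ^ 2 ∂P) atTop (𝓝 0) := by
      refine (hdrift hs).congr fun k => lintegral_congr fun ω => ?_
      rw [neg_sub_neg, enorm_sub_rev]
    have h2 : Tendsto (fun k => ∫⁻ ω, ‖((ψ k).drift l s ω + (ψ k).integral B.W s ω) -
        (X s ω - x)‖ₑ ^ 2 ∂P) atTop (𝓝 0) := by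
      refine tendsto_of_tendsto_of_tendsto_of_le_of_le tendsto_const_nhds
        (by simpa using hlim 1 ENNReal.one_ne_top) (fun _ => zero_le) fun k => (hCψ k).1 s hs
    have h3 := tendsto_lintegral_enorm_sq_add (a := fun k ω => -(ψ k).drift l s ω)
      (D := fun ω => -D s ω) (Y := fun ω => X s ω - x - D s ω)
      (fun k => ((ψ k).measurable_drift l s).neg.aemeasurable) (hDm hs).neg.aemeasurable h1 h2
      (ae_of_all _ fun ω => by ring)
    refine h3.congr fun k => lintegral_congr fun ω => ?_
    rw [neg_add_cancel_left]
  · intro s _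
    refine ae_of_all _ fun ω => ?_
    simp only [hD]
    ring
  · exact ae_of_all _ fun ω s _ => (gaussAvg_pos h.growth h.continuous.measurable hpos _ _).le
  · intro ω
    simp only [hX, hρ, tsub_self, mul_zero, gaussAvg_zero]

end ExpSmooth


/-! ### The value function -/

/-- Nothing is assumed about u: near G z it equals Φ composed with the local inverse of G, so
differentiability is a conclusion. -/
lemma hasDerivAt_of_forall_comp_eq {G G₁ u Φ : ℝ → ℝ} (hG : ∀ z, HasDerivAt G (G₁ z) z)
    (hc : Continuous G₁) (hne : ∀ z, G₁ z ≠ 0) (hu : ∀ z, u (G z) = Φ z) {z Φ' : ℝ}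
    (hΦ : HasDerivAt Φ Φ' z) : HasDerivAt u (Φ' / G₁ z) (G z) := by
  have hs : HasStrictDerivAt G (G₁ z) z :=
    hasStrictDerivAt_of_hasDerivAt_of_continuousAt (Eventually.of_forall hG) hc.continuousAt
  have hs' := hs.to_localInverse (hne z)
  have h1 := (hs.hasStrictFDerivAt_equiv (hne z)).eventually_right_inverse
  have h0 := (hs.hasStrictFDerivAt_equiv (hne z)).localInverse_apply_image
  have h2 : HasDerivAt (fun y => Φ (hs.localInverse G (G₁ z) z (hne z) y))
      (Φ' * (G₁ z)⁻¹) (G z) := by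
    refine HasDerivAt.comp (G z) ?_ hs'.hasDerivAt
    rw [HasStrictDerivAt.localInverse, h0]
    exact hΦ
  refine h2.congr_of_eventuallyEq ?_
  filter_upwards [h1] with y hy
  rw [← hu, HasStrictDerivAt.localInverse, hy]

lemma mul_le_gaussAvg {g g' : ℝ → ℝ} (hg : ExpGrowth g) (hg' : ExpGrowth g') (hm : Measurable g)
    (hm' : Measurable g') {c : ℝ} (h : ∀ z, c * g z ≤ g' z) (v : ℝ≥0) (z : ℝ) :
    c * gaussAvg g v z ≤ gaussAvg g' v z := by
  rw [← gaussAvg_const_mul]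
  exact integral_mono (((hg.const_mul c).comp_const_add z).integrable (by fun_prop) _ _)
    ((hg'.comp_const_add z).integrable (by fun_prop) _ _) fun w => h _

/-- The bound makes log G(z) - c z monotone, so log G is unbounded in both directions and the
intermediate value theorem applies. -/
lemma exists_eq_of_mul_le_deriv {G G₁ : ℝ → ℝ} (hG : ∀ z, HasDerivAt G (G₁ z) z)
    (hpos : ∀ z, 0 < G z) {c : ℝ} (hc : 0 < c) (h : ∀ z, c * G z ≤ G₁ z) {x : ℝ} (hx : 0 < x) :
    ∃ z, G z = x := by
  have hd (z : ℝ) : HasDerivAt (fun y => Real.log (G y) - c * y) (G₁ z / G z - c) z := by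
    have h1 : HasDerivAt (fun y => c * y) c z := by
      simpa using (hasDerivAt_id z).const_mul c
    exact ((hG z).log (hpos z).ne').fun_sub h1
  have hm : Monotone fun y => Real.log (G y) - c * y :=
    monotone_of_hasDerivAt_nonneg hd fun z => sub_nonneg.2 ((le_div_iff₀ (hpos z)).2 (h z))
  have hcont : Continuous fun z => Real.log (G z) :=
    continuous_iff_continuousAt.2 fun z => ((hG z).log (hpos z).ne').continuousAt
  -- q solves log G(0) + c q = log x; the points min(0, q) and max(0, q) bracket the level log x.
  set q := (Real.log x - Real.log (G 0)) / c with hq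
  have hqc : c * q = Real.log x - Real.log (G 0) := by rw [hq]; field_simp
  obtain ⟨z, hz⟩ := mem_range_of_exists_le_of_exists_ge hcont (c := Real.log x)
    ⟨min 0 q, by
      have h1 := hm (min_le_left 0 q)
      have h2 : c * min 0 q ≤ c * q := by gcongr; exact min_le_right _ _
      simp only at h1
      linarith⟩
    ⟨max 0 q, by
      have h1 := hm (le_max_left 0 q)
      have h2 : c * q ≤ c * max 0 q := by gcongr; exact le_max_right _ _
      simp only at h1
      linarith⟩
  exact ⟨z, Real.log_injOn_pos (hpos z) hx hz⟩

lemma extExpectation_coe {Ω : Type*} [MeasurableSpace Ω] {P : Measure Ω} {g : Ω → ℝ}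
    (hg : Integrable g P) :
    extExpectation P (fun ω => (g ω : EReal)) = ((∫ ω, g ω ∂P : ℝ) : EReal) := by
  have h1 : ∫⁻ ω, ENNReal.ofReal (g ω) ∂P ≠ ∞ := hg.lintegral_lt_top.ne
  have h2 : ∫⁻ ω, ENNReal.ofReal (-g ω) ∂P ≠ ∞ := hg.neg.lintegral_lt_top.ne
  rw [integral_eq_lintegral_pos_part_sub_lintegral_neg_part hg, EReal.coe_sub,
    EReal.coe_ennreal_toReal h1, EReal.coe_ennreal_toReal h2]
  rfl

lemma extExpectation_mono {Ω : Type*} [MeasurableSpace Ω] {P : Measure Ω} {Y Z : Ω → EReal}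
    (h : ∀ᵐ ω ∂P, Y ω ≤ Z ω) : extExpectation P Y ≤ extExpectation P Z := by
  refine EReal.sub_le_sub ?_ ?_
  · refine EReal.coe_ennreal_le_coe_ennreal_iff.2 (lintegral_mono_ae ?_)
    filter_upwards [h] with ω hω using EReal.toENNReal_le_toENNReal hω
  · refine EReal.coe_ennreal_le_coe_ennreal_iff.2 (lintegral_mono_ae ?_)
    filter_upwards [h] with ω hω using EReal.toENNReal_le_toENNReal (EReal.neg_le_neg_iff.2 hω)

namespace IsUtility

variable {U : ℝ → ℝ} {Ω : Type*} [MeasurableSpace Ω] {P : Measure Ω} [IsProbabilityMeasure P]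
  {N : ℕ}

lemma measurable_utility_logWealth (hU : IsUtility U) : Measurable fun z => U (logWealth U z) :=
  (continuous_iff_continuousAt.2 fun z =>
    (hU.hasDerivAt_utility_logWealth z).continuousAt).measurable

/-- Duality gives the upper bound, the explicit strategy attains it. The law is N(v, v) because the
expectation is under P, where Y_T - z has mean v, whereas initial wealth is an average over N(0, v).
-/
lemma extValue_eq (hU : IsUtility U) (B : BrownianMotion P N) (m : Market N) {t T : ℝ≥0}
    (htT : t ≤ T) {v : ℝ≥0} (hv : v = ‖m.priceOfRisk‖₊ ^ 2 * (T - t)) (z : ℝ) :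
    extValue B m U T (gaussAvg (logWealth U) v z) t =
      ((∫ w, U (logWealth U (z + w)) ∂gaussianReal v v : ℝ) : EReal) := by
  obtain ⟨K, c, hf⟩ := hU.expSmooth_logWealth
  obtain ⟨π₀, X₀, hX₀, hXT⟩ := hf.exists_isAdmissible hU.logWealth_pos B m htT z
  rw [← hv] at hX₀
  set l := m.priceOfRisk with hl
  set Y := B.drifted l t z T with hY
  have hYz (ω : Ω) : Y ω = z + B.driftedIncrement l t T ω := by
    rw [hY, B.drifted_eq_add l z le_rfl htT, BrownianMotion.drifted_self]
  have hum := hU.measurable_utility_logWealth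
  have hi : Integrable (fun w => U (logWealth U (z + w))) (P.map (B.driftedIncrement l t T)) := by
    rw [B.map_driftedIncrement l htT]
    exact (hU.expGrowth_utility_logWealth.comp_const_add z).integrable
      (hum.comp (measurable_const_add z)) _ _
  have hI : Integrable (fun ω => U (logWealth U (Y ω))) P := by
    simp only [hYz]
    exact hi.comp_measurable (B.measurable_driftedIncrement l t T)
  have hE : ∫ ω, U (logWealth U (Y ω)) ∂P = ∫ w, U (logWealth U (z + w)) ∂gaussianReal v v := by
    rw [hv, ← B.map_driftedIncrement l htT, integral_map
      (B.measurable_driftedIncrement l t T).aemeasurable hi.1]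
    simp only [hYz]
  rw [← hE]
  refine le_antisymm (sSup_le ?_) (le_sSup ⟨π₀, X₀, hX₀, ?_⟩)
  · rintro _ ⟨π, X, hX, rfl⟩
    obtain ⟨i1, e1⟩ := hX.integral_exp_mul_gain htT
    obtain ⟨i2, e2⟩ := hX₀.integral_exp_mul_gain htT
    set x := gaussAvg (logWealth U) v z
    set H : Ω → ℝ := fun ω => Real.exp (-inner ℝ l (B.W T ω - B.W t ω)) with hH
    -- The slope of the tangent at f(Y_T) is a constant multiple of the state price density.
    have hHY (ω : Ω) : Real.exp (-Y ω) = Real.exp (-z - v) * H ω := by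
      rw [hH, ← Real.exp_add, hYz, BrownianMotion.driftedIncrement, hv]
      push_cast [NNReal.coe_sub htT]
      ring_nf
    have i3 : Integrable (fun ω => Real.exp (-z - v) * (H ω * (X T ω - x) - H ω * (X₀ T ω - x))) P :=
      (i1.sub i2).const_mul _
    have e (ω : Ω) : Real.exp (-Y ω) * (X T ω - logWealth U (Y ω)) =
        Real.exp (-z - v) * (H ω * (X T ω - x) - H ω * (X₀ T ω - x)) := by
      rw [hHY, hXT]
      ring
    have i4 : Integrable (fun ω => U (logWealth U (Y ω)) +
        Real.exp (-Y ω) * (X T ω - logWealth U (Y ω))) P := by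
      simp only [e]
      exact hI.add i3
    -- The linear correction has mean zero: X and X₀ start from the same wealth x and both satisfy
    -- the budget equation.
    have e4 : ∫ ω, (U (logWealth U (Y ω)) + Real.exp (-Y ω) * (X T ω - logWealth U (Y ω))) ∂P =
        ∫ ω, U (logWealth U (Y ω)) ∂P := by
      simp only [e]
      rw [integral_add hI i3, integral_const_mul, integral_sub i1 i2, e1, e2]
      simp
    rw [← e4, ← extExpectation_coe i4]
    refine extExpectation_mono ?_
    filter_upwards [hX.nonneg] with ω hω
    exact hU.extUtility_le_tangent (Y ω) (hω T ⟨htT, le_rfl⟩)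
  · rw [← extExpectation_coe hI]
    congr 1
    funext ω
    rw [hXT, extUtility, if_pos (hU.logWealth_pos _)]

/-- The factor e^{-w} produced by U'(f) = e^{-(z + w)} tilts N(v, v) back to N(0, v), at the cost of
e^{-v/2}. -/
lemma hasDerivAt_integral_utility (hU : IsUtility U) (v : ℝ≥0) (z : ℝ) :
    HasDerivAt (fun z => ∫ w, U (logWealth U (z + w)) ∂gaussianReal v v)
      (Real.exp (-z - v / 2) * gaussAvg (logWealthDeriv U) v z) z := by
  obtain ⟨K, c, hf⟩ := hU.expSmooth_logWealth
  have hm : Measurable fun z => Real.exp (-z) * logWealthDeriv U z :=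
    (Real.measurable_exp.comp measurable_neg).mul hf.continuous_one.measurable
  refine (hasDerivAt_integral_shift hU.expGrowth_utility_logWealth
    hU.expGrowth_exp_neg_mul_logWealthDeriv hm hU.hasDerivAt_utility_logWealth v v z).congr_deriv ?_
  have e := integral_exp_mul_gaussianReal v (-1) v fun w => logWealthDeriv U (z + w)
  have e2 (w : ℝ) : Real.exp (-(z + w)) * logWealthDeriv U (z + w) =
      Real.exp (-z) * (Real.exp (-1 * w) * logWealthDeriv U (z + w)) := by
    rw [← mul_assoc, ← Real.exp_add]
    ring_nf
  simp only [e2]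
  rw [integral_const_mul, e, ← mul_assoc, ← Real.exp_add, gaussAvg]
  ring_nf

/-- The value function in the parametrisation `x = E f(z + w)`: it is twice differentiable and the
risk tolerance is `E f'(z + w)`. -/
lemma riskTolerance_eq (hU : IsUtility U) (B : BrownianMotion P N) (m : Market N) {t T : ℝ≥0}
    (htT : t ≤ T) {v : ℝ≥0} (hv : v = ‖m.priceOfRisk‖₊ ^ 2 * (T - t)) (z : ℝ) :
    RiskToleranceDefined B m U T (gaussAvg (logWealth U) v z) t ∧
    riskTolerance B m U T (gaussAvg (logWealth U) v z) t = gaussAvg (logWealthDeriv U) v z := by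
  obtain ⟨K, c, hf⟩ := hU.expSmooth_logWealth
  obtain ⟨K', hf'⟩ := hf.gaussAvg v
  set u : ℝ → ℝ := fun y => value B m U T y t with hu
  set G := gaussAvg (logWealth U) v
  set G₁ := gaussAvg (logWealthDeriv U) v with hG₁
  have hG₁pos (z : ℝ) : 0 < G₁ z :=
    gaussAvg_pos hf.growth_one hf.continuous_one.measurable hU.logWealthDeriv_pos v z
  have hval (z : ℝ) := hU.extValue_eq B m htT hv z
  have huG (z : ℝ) : u (G z) = ∫ w, U (logWealth U (z + w)) ∂gaussianReal v v := by
    rw [hu]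
    simp only [value, G, hval, EReal.toReal_coe]
  -- The factor G₁ = dG/dz cancels. As u_x depends on z through an exponential only, a second
  -- division by G₁ gives u_xx, and -u_x/u_xx reduces to G₁.
  have h1 (z : ℝ) : HasDerivAt u (Real.exp (-z - v / 2)) (G z) := by
    have := hasDerivAt_of_forall_comp_eq hf'.deriv_one hf'.continuous_one
      (fun z => (hG₁pos z).ne') huG (hU.hasDerivAt_integral_utility v z)
    rwa [mul_div_cancel_right₀ _ (hG₁pos z).ne'] at this
  have h2 : HasDerivAt (deriv u) (-Real.exp (-z - v / 2) / G₁ z) (G z) := by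
    refine hasDerivAt_of_forall_comp_eq hf'.deriv_one hf'.continuous_one
      (fun z => (hG₁pos z).ne') (Φ := fun z => Real.exp (-z - v / 2)) (fun z => (h1 z).deriv) ?_
    simpa using (((hasDerivAt_id z).neg).sub_const (v / 2 : ℝ)).exp
  have hE := Real.exp_pos (-z - v / 2)
  refine ⟨⟨?_, ?_, (h1 z).differentiableAt, h2.differentiableAt, ?_⟩, ?_⟩
  · rw [hval]; exact EReal.coe_ne_bot _
  · rw [hval]; exact EReal.coe_ne_top _
  · rw [h2.deriv]
    exact div_neg_of_neg_of_pos (neg_neg_of_pos hE) (hG₁pos z)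
  · rw [riskTolerance, h2.deriv, (h1 z).deriv]
    have := (hG₁pos z).ne'
    field_simp

lemma exists_gaussAvg_logWealth_eq (hU : IsUtility U) (v : ℝ≥0) {x : ℝ} (hx : 0 < x) :
    ∃ z, gaussAvg (logWealth U) v z = x := by
  obtain ⟨K, c, hf⟩ := hU.expSmooth_logWealth
  obtain ⟨K', hf'⟩ := hf.gaussAvg v
  obtain ⟨c₁, hc₁, hle⟩ := hU.exists_mul_logWealth_le
  exact exists_eq_of_mul_le_deriv hf'.deriv_one
    (gaussAvg_pos hf.growth hf.continuous.measurable hU.logWealth_pos v) hc₁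
    (mul_le_gaussAvg hf.growth hf.growth_one hf.continuous.measurable hf.continuous_one.measurable
      hle v) hx

end IsUtility

end Merton

/-! ### Comparison of the two markets -/

theorem proposition6
    {Ω₁ Ω₂ : Type*} [MeasurableSpace Ω₁] [MeasurableSpace Ω₂]
    {P₁ : Measure Ω₁} {P₂ : Measure Ω₂} [IsProbabilityMeasure P₁] [IsProbabilityMeasure P₂]
    {N₁ N₂ : ℕ} (B₁ : Merton.BrownianMotion P₁ N₁) (B₂ : Merton.BrownianMotion P₂ N₂)
    (m₁ : Merton.Market N₁) (m₂ : Merton.Market N₂)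
    (hm : ‖m₁.priceOfRisk‖ ^ 2 ≤ ‖m₂.priceOfRisk‖ ^ 2)
    (U : ℝ → ℝ) (hU : Merton.IsUtility U) (T : ℝ≥0) :
    (∀ x : ℝ, 0 < x → ∀ t ≤ T,
      Merton.RiskToleranceDefined B₁ m₁ U T x t ∧ Merton.RiskToleranceDefined B₂ m₂ U T x t) ∧
    (ConcaveOn ℝ (Ioi 0) (Merton.riskToleranceCoeff U) →
      ∀ x : ℝ, 0 < x → ∀ t ≤ T,
        Merton.riskTolerance B₂ m₂ U T x t ≤ Merton.riskTolerance B₁ m₁ U T x t) ∧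
    (ConvexOn ℝ (Ioi 0) (Merton.riskToleranceCoeff U) →
      ∀ x : ℝ, 0 < x → ∀ t ≤ T,
        Merton.riskTolerance B₁ m₁ U T x t ≤ Merton.riskTolerance B₂ m₂ U T x t) := by
  obtain ⟨K, c, hf⟩ := hU.expSmooth_logWealth
  have hv (t : ℝ≥0) : ‖m₁.priceOfRisk‖₊ ^ 2 * (T - t) ≤ ‖m₂.priceOfRisk‖₊ ^ 2 * (T - t) := by
    have : ‖m₁.priceOfRisk‖₊ ^ 2 ≤ ‖m₂.priceOfRisk‖₊ ^ 2 := by exact_mod_cast hm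
    gcongr
  refine ⟨fun x hx t ht => ?_, fun h x hx t ht => ?_, fun h x hx t ht => ?_⟩
  -- The same wealth x is represented in both markets, by different parameters z₁ and z₂; both risk
  -- tolerances then become averages of f'.
  all_goals
    obtain ⟨z₁, h₁⟩ := hU.exists_gaussAvg_logWealth_eq (‖m₁.priceOfRisk‖₊ ^ 2 * (T - t)) hx
    obtain ⟨z₂, h₂⟩ := hU.exists_gaussAvg_logWealth_eq (‖m₂.priceOfRisk‖₊ ^ 2 * (T - t)) hx
    have r₁ := hU.riskTolerance_eq B₁ m₁ ht rfl z₁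
    have r₂ := hU.riskTolerance_eq B₂ m₂ ht rfl z₂
    rw [h₁] at r₁
    rw [h₂] at r₂
  · exact ⟨r₁.1, r₂.1⟩
  · rw [r₁.2, r₂.2]
    simpa using Merton.mul_gaussAvg_le_of_antitone_logDeriv hf hU.logWealthDeriv_pos
      (hU.antitone_logDeriv_of_concaveOn h) (hv t) (h₁.trans h₂.symm)
  · rw [r₁.2, r₂.2]
    simpa using Merton.mul_gaussAvg_le_of_antitone_logDeriv hf hU.logWealthDeriv_pos
      (hU.antitone_neg_logDeriv_of_convexOn h) (hv t) (h₁.trans h₂.symm)
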